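/- Let $d\ge 1$. All cubes are half-open with sides parallel to the axes, $Q=[x_1,x_1+l)\times\dots\times[x_d,x_d+l)$, $l>0$. For $0<\eta<1$, a collection $\mathcal S$ of measurable sets is $\eta$-sparse if every $Q\in\mathcal S$ has a measurable subset $G(Q)\subseteq Q$ with $|G(Q)|\ge\eta|Q|$ such that the sets $G(Q)$, $Q\in\mathcal S$, are pairwise disjoint. Let $T$ be a bounded linear operator on $L^2(\mathbb R^d)$ (real or complex scalars) and $K$ a kernel such that, for every $f\in L^\infty(\mathbb R^d)$ with compact support, $Tf(x)=\int K(x,y)f(y)\,dy$ for a.e. $x\notin\operatorname{supp} f$. Assume that - $|K(x,y)|\le C_K/|x-y|^d$ for all $x\ne y$; - $|K(x,y)-K(x',y)|+|K(y,x)-K(y,x')|\le \omega\!\left(\frac{|x-x'|}{|x-y|}\right)\frac1{|x-y|^d}$ whenever $|x-y|>2|x-x'|$, where $\omega:[0,1]\to[0,\infty)$ is increasing and subadditive, $\omega(0)=0$ and $[\omega]_{\mathrm{Dini}}=\int_0^1\frac{\omega(t)}t\,dt<\infty$. Then there is exactly one linear operator, still denoted $T$, from $L^1(\mathbb R^d)$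 to the measurable functions (modulo a.e. equality) that is of weak type $(1,1)$ and agrees with $T$ on $L^1(\mathbb R^d)\cap L^2(\mathbb R^d)$. Moreover there is a constant $c_d>0$ depending only on $d$ such that, with $\eta_d=\frac1{2(4\sqrt d+2)^d}$, for every $f\in L^1(\mathbb R^d)$ with compact support: 1. there is an $\eta_d$-sparse family $\mathcal S$ of cubes with $$|Tf(x)|\le c_d\,\bigl(C_K+[\omega]_{\mathrm{Dini}}+\|T\|_{L^2\to L^2}\bigr)\sum_{Q\in\mathcal S}\chi_Q(x)\,\frac1{|Q|}\int_Q|f|\quad\text{for a.e. }x\in\mathbb R^d;$$ 2. the maximal truncated operator $T^*f(x)=\sup_{\varepsilon>0}\left|\int_{|x-y|>\varepsilon}K(x,y)f(y)\,dy\right|$ satisfies, for some $\eta_d$-sparse family $\mathcal S$ of cubes, the same bound $$T^*f(x)\le c_d\,\bigl(C_K+[\omega]_{\mathrm{Dini}}+\|T\|_{L^2\to L^2}\bigr)\sum_{Q\in\mathcal S}\chi_Q(x)\,\frac1{|Q|}\int_Q|f|\quad\text{for a.e. }x\in\mathbb R^d.$$ -/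

import Mathlib

open MeasureTheory
open scoped ENNReal

namespace SparseCZ

/-- Half-open cubes `[a₁, a₁ + l) × ⋯ × [a_d, a_d + l)` with side length `l > 0`. -/
def IsCube {d : ℕ} (Q : Set (EuclideanSpace ℝ (Fin d))) : Prop :=
  ∃ (a : EuclideanSpace ℝ (Fin d)) (l : ℝ), 0 < l ∧
    Q = {x | ∀ i, a i ≤ x i ∧ x i < a i + l}

/-- A collection `S` of measurable sets is `η`-sparse if each `Q ∈ S` has a measurable subset
`G Q` with `|G Q| ≥ η |Q|`, and the sets `G Q`, `Q ∈ S`, are pairwise disjoint. -/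
def IsSparse {d : ℕ} (η : ℝ) (S : Set (Set (EuclideanSpace ℝ (Fin d)))) : Prop :=
  0 < η ∧ η < 1 ∧ (∀ Q ∈ S, MeasurableSet Q) ∧
    ∃ G : Set (EuclideanSpace ℝ (Fin d)) → Set (EuclideanSpace ℝ (Fin d)),
      (∀ Q ∈ S, MeasurableSet (G Q) ∧ G Q ⊆ Q ∧ ENNReal.ofReal η * volume Q ≤ volume (G Q)) ∧
      S.PairwiseDisjoint G

/-- The sparse operator `A_S f (x) = ∑_{Q ∈ S} χ_Q(x) ⨍_Q |f|`, with values in `[0, ∞]`. -/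
noncomputable def sparseOp {d : ℕ} {𝕜 : Type*} [RCLike 𝕜]
    (S : Set (Set (EuclideanSpace ℝ (Fin d))))
    (f : EuclideanSpace ℝ (Fin d) → 𝕜) (x : EuclideanSpace ℝ (Fin d)) : ℝ≥0∞ :=
  ∑' Q : S, (Q : Set (EuclideanSpace ℝ (Fin d))).indicator
    (fun _ => (volume (Q : Set (EuclideanSpace ℝ (Fin d))))⁻¹ *
      ∫⁻ y in (Q : Set (EuclideanSpace ℝ (Fin d))), ‖f y‖ₑ) x

/-- A modulus of continuity on `[0, 1]` (increasing, subadditive, `ω 0 = 0`) satisfying the Dini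
condition. Only the values of `ω` on `[0, 1]` matter. -/
structure IsDiniModulus (ω : ℝ → ℝ) : Prop where
  zero : ω 0 = 0
  mono : MonotoneOn ω (Set.Icc 0 1)
  subadd : ∀ s t : ℝ, 0 ≤ s → 0 ≤ t → s + t ≤ 1 → ω (s + t) ≤ ω s + ω t
  dini : IntegrableOn (fun t => ω t / t) (Set.Ioc 0 1)

/-- `[ω]_Dini = ∫₀¹ ω(t) / t dt`. -/
noncomputable def diniConst (ω : ℝ → ℝ) : ℝ := ∫ t in Set.Ioc (0 : ℝ) 1, ω t / t

/-- Size and smoothness conditions on a kernel; nothing is asked on the diagonal. -/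
structure IsCZKernel {d : ℕ} {𝕜 : Type*} [RCLike 𝕜]
    (K : EuclideanSpace ℝ (Fin d) → EuclideanSpace ℝ (Fin d) → 𝕜) (C : ℝ) (ω : ℝ → ℝ) :
    Prop where
  size : ∀ x y, x ≠ y → ‖K x y‖ ≤ C / ‖x - y‖ ^ d
  smooth : ∀ x x' y, 2 * ‖x - x'‖ < ‖x - y‖ →
    ‖K x y - K x' y‖ + ‖K y x - K y x'‖ ≤ ω (‖x - x'‖ / ‖x - y‖) * (1 / ‖x - y‖ ^ d)

/-- `T f (x) = ∫ K(x, y) f(y) dy` for `f ∈ L^∞` with compact support and (almost every)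
`x ∉ supp f`. Such an `f` is in `L²`, so the argument `hf` is no restriction. -/
def HasKernel {d : ℕ} {𝕜 : Type*} [RCLike 𝕜]
    (T : Lp 𝕜 2 (volume : Measure (EuclideanSpace ℝ (Fin d))) →L[𝕜]
      Lp 𝕜 2 (volume : Measure (EuclideanSpace ℝ (Fin d))))
    (K : EuclideanSpace ℝ (Fin d) → EuclideanSpace ℝ (Fin d) → 𝕜) : Prop :=
  ∀ (f : EuclideanSpace ℝ (Fin d) → 𝕜) (hf : MemLp f 2 volume),
    MemLp f ∞ volume → HasCompactSupport f →
      ∀ᵐ x ∂volume, x ∉ tsupport f → T (hf.toLp f) x = ∫ y, K x y * f y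

/-- `T₁` is a linear extension of `T` to `L¹` that is of weak type `(1, 1)`. -/
structure IsWeakTypeExtension {d : ℕ} {𝕜 : Type*} [RCLike 𝕜]
    (T : Lp 𝕜 2 (volume : Measure (EuclideanSpace ℝ (Fin d))) →L[𝕜]
      Lp 𝕜 2 (volume : Measure (EuclideanSpace ℝ (Fin d))))
    (T₁ : Lp 𝕜 1 (volume : Measure (EuclideanSpace ℝ (Fin d))) →ₗ[𝕜]
      (EuclideanSpace ℝ (Fin d) →ₘ[volume] 𝕜)) : Prop where
  agree : ∀ (f : EuclideanSpace ℝ (Fin d) → 𝕜) (h₁ : MemLp f 1 volume) (h₂ : MemLp f 2 volume),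
    T₁ (h₁.toLp f) =ᵐ[volume] T (h₂.toLp f)
  weak : ∃ A : ℝ, ∀ (f : Lp 𝕜 1 (volume : Measure (EuclideanSpace ℝ (Fin d)))) (t : ℝ), 0 < t →
    volume {x | t < ‖T₁ f x‖} ≤ ENNReal.ofReal (A * ‖f‖ / t)

/-- The maximal truncated operator
`T^* f (x) = sup_{ε > 0} |∫_{|x - y| > ε} K(x, y) f(y) dy|`, with values in `[0, ∞]`. -/
noncomputable def maximalTruncation {d : ℕ} {𝕜 : Type*} [RCLike 𝕜]
    (K : EuclideanSpace ℝ (Fin d) → EuclideanSpace ℝ (Fin d) → 𝕜)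
    (f : EuclideanSpace ℝ (Fin d) → 𝕜) (x : EuclideanSpace ℝ (Fin d)) : ℝ≥0∞ :=
  ⨆ (ε : ℝ) (_ : 0 < ε), ‖∫ y in {y | ε < ‖x - y‖}, K x y * f y‖ₑ

end SparseCZ

namespace SparseCZ

open Set Filter Topology Metric

/-! Weak type and extension. For bounded integrable `f`, a Calderón–Zygmund decomposition reduces
the weak (1,1) inequality to the L² bound (good part) and to the integrated oscillation of the
kernel (bad part), with a constant controlled by `[ω]_Dini + ‖T‖` (`weakType_of_bounded`).
Approximating an integrable function by truncations in L¹ then makes the images converge in measure.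
This produces the extension. Conversely, every weak type extension is such a limit, so it is unique
and inherits the same quantitative bound, whatever constant `A` it came with
(`existsUnique_isWeakTypeExtension`, `IsL1Limit.measure_le`).

Sparse bounds. For a dyadic cube Q let Q* = `dil Q` and F_Q = T(f χ_{Q*}). By the weak type
inequalities for T and for the maximal function, both F_Q and the maximal function of f χ_{Q*} are
controlled by the average of |f| over Q* outside an open set O(Q) with |O(Q)| ≤ 2^{-d-2}|Q|. The
children of Q are the maximal dyadic cubes of which O(Q) fills more than the fraction 2^{-d-1}. They
lie in Q and cover at most half of it. Iterating from root cubes whose dilates contain the support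
of f gives a tree. The part of each tree cube outside its children keeps half of the measure, and
these parts are pairwise disjoint; passing to dilates costs the factor (4√d+2)^d, which gives η_d.

The decisive estimate is `IsLocalFamily.step`. If P ⊆ Q is not strictly inside a child of Q, then
O(Q) fills at most half of P and F_P is large on at most a quarter of it. So some z in P is good for
F_Q, for F_P and for the maximal function at once. At z the integral of K(z,·)f over Q* \ P* equals
F_Q(z) − F_P(z), hence is bounded by averages. The Dini condition then moves z to an arbitrary x in
P. The outcome holds at every x, so no maximal truncation has to be estimated beforehand.

Telescoping this along the tree (`IsLocalFamily.chain`) bounds the integral over Q* \ P* by averages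
over the tree cubes between P and Q. For T one stops at the smallest tree cube containing x; for T^*
one stops at the dyadic cube containing x of side comparable to ε, and the remaining part of the
integral is handled by the size bound. -/

/-- The underlying Euclidean space. -/
abbrev Euc (d : ℕ) : Type := EuclideanSpace ℝ (Fin d)

variable {d : ℕ} {𝕜 : Type*} [RCLike 𝕜]

/-! ### Dini moduli -/

namespace IsDiniModulus

variable {ω : ℝ → ℝ}

theorem nonneg (hω : IsDiniModulus ω) {t : ℝ} (h0 : 0 ≤ t) (h1 : t ≤ 1) : 0 ≤ ω t := by
  rw [← hω.zero]
  exact hω.mono ⟨le_rfl, zero_le_one⟩ ⟨h0, h1⟩ h0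

theorem div_nonneg_ae (hω : IsDiniModulus ω) :
    ∀ᵐ t ∂(volume.restrict (Ioc (0 : ℝ) 1)), 0 ≤ ω t / t := by
  filter_upwards [ae_restrict_mem measurableSet_Ioc] with t ht
  exact div_nonneg (hω.nonneg ht.1.le ht.2) ht.1.le

theorem diniConst_nonneg (hω : IsDiniModulus ω) : 0 ≤ diniConst ω :=
  integral_nonneg_of_ae hω.div_nonneg_ae

/-- Integral test over dyadic intervals: on (2^{-k-1}, 2^{-k}] monotonicity gives ω(t)/t ≥
ω(2^{-k-1})/2^{-k}, and the interval has length half of 2^{-k}, whence the factor 2. -/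
theorem tsum_le (hω : IsDiniModulus ω) :
    ∑' k : ℕ, ENNReal.ofReal (ω ((1 / 2 : ℝ) ^ (k + 1))) ≤ 2 * ENNReal.ofReal (diniConst ω) := by
  set A : ℕ → Set ℝ := fun k => Ioc ((1 / 2 : ℝ) ^ (k + 1)) ((1 / 2 : ℝ) ^ k) with hA
  have hdisj : Pairwise (Function.onFun Disjoint A) := by
    refine (pairwise_disjoint_on A).2 fun m n hmn => ?_
    refine Set.disjoint_left.2 fun x hx hy => ?_
    have : (1 / 2 : ℝ) ^ n ≤ (1 / 2 : ℝ) ^ (m + 1) :=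
      pow_le_pow_of_le_one (by norm_num) (by norm_num) hmn
    exact absurd (hy.2.trans this) (not_le.2 hx.1)
  have hsub : (⋃ k, A k) ⊆ Ioc 0 1 := by
    refine iUnion_subset fun k x hx => ⟨lt_trans (by positivity) hx.1, hx.2.trans ?_⟩
    exact pow_le_one₀ (by norm_num) (by norm_num)
  have h1 : ENNReal.ofReal (diniConst ω) =
      ∫⁻ t in Ioc (0 : ℝ) 1, ENNReal.ofReal (ω t / t) :=
    ofReal_integral_eq_lintegral_ofReal hω.dini hω.div_nonneg_ae
  have h2 : ∑' k, ∫⁻ t in A k, ENNReal.ofReal (ω t / t) ≤ ENNReal.ofReal (diniConst ω) := by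
    rw [h1, ← lintegral_iUnion (fun k => measurableSet_Ioc) hdisj]
    exact lintegral_mono_set hsub
  refine le_trans ?_ (mul_le_mul_right h2 2)
  rw [← ENNReal.tsum_mul_left]
  refine ENNReal.tsum_le_tsum fun k => ?_
  have hk : (0 : ℝ) < (1 / 2) ^ k := by positivity
  have hk1 : (1 / 2 : ℝ) ^ k ≤ 1 := pow_le_one₀ (by norm_num) (by norm_num)
  have hk2 : (1 / 2 : ℝ) ^ (k + 1) = (1 / 2) ^ k / 2 := by rw [pow_succ]; ring
  have hω0 : 0 ≤ ω ((1 / 2 : ℝ) ^ (k + 1)) := hω.nonneg (by positivity) (by rw [hk2]; linarith)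
  have h3 : ∫⁻ _ in A k, ENNReal.ofReal (ω ((1 / 2 : ℝ) ^ (k + 1)) / (1 / 2) ^ k) ≤
      ∫⁻ t in A k, ENNReal.ofReal (ω t / t) := by
    refine setLIntegral_mono' measurableSet_Ioc fun t ht => ENNReal.ofReal_le_ofReal ?_
    have ht0 : 0 < t := lt_trans (by positivity) ht.1
    have : ω ((1 / 2 : ℝ) ^ (k + 1)) ≤ ω t :=
      hω.mono ⟨by positivity, by rw [hk2]; linarith⟩ ⟨ht0.le, ht.2.trans hk1⟩ ht.1.le
    exact div_le_div₀ (hω0.trans this) this ht0 ht.2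
  refine le_trans (le_of_eq ?_) (mul_le_mul_right h3 2)
  rw [setLIntegral_const, Real.volume_Ioc, ← ENNReal.ofReal_mul (by positivity)]
  have : (2 : ℝ≥0∞) = ENNReal.ofReal 2 := by simp
  rw [this, ← ENNReal.ofReal_mul (by norm_num)]
  congr 1
  rw [hk2] at *
  field_simp
  ring

theorem tendsto_zero (hω : IsDiniModulus ω) : Tendsto ω (𝓝[≥] 0) (𝓝 0) := by
  have h1 : Tendsto (fun k : ℕ => ENNReal.ofReal (ω ((1 / 2 : ℝ) ^ (k + 1)))) atTop (𝓝 0) := by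
    apply ENNReal.tendsto_atTop_zero_of_tsum_ne_top
    exact ne_top_of_le_ne_top (by finiteness) hω.tsum_le
  rw [Metric.tendsto_nhds]
  intro ε hε
  have h2 : ∀ᶠ k : ℕ in atTop, ENNReal.ofReal (ω ((1 / 2 : ℝ) ^ (k + 1))) < ENNReal.ofReal ε :=
    h1.eventually_lt_const (by simpa using hε)
  obtain ⟨k, hk⟩ := h2.exists
  have hk := (ENNReal.ofReal_lt_ofReal_iff hε).1 hk
  have hp : (0 : ℝ) < (1 / 2) ^ (k + 1) := by positivity
  have hp1 : (1 / 2 : ℝ) ^ (k + 1) ≤ 1 := pow_le_one₀ (by norm_num) (by norm_num)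
  filter_upwards [Ico_mem_nhdsGE hp] with t ht
  have h0 := hω.nonneg ht.1 (ht.2.le.trans hp1)
  rw [dist_zero_right, Real.norm_of_nonneg h0]
  exact (hω.mono ⟨ht.1, ht.2.le.trans hp1⟩ ⟨hp.le, hp1⟩ ht.2.le).trans_lt hk

end IsDiniModulus

/-! ### Kernels -/

/-- Smoothness of a kernel in its first variable. -/
def IsSmoothFst (K : Euc d → Euc d → 𝕜) (ω : ℝ → ℝ) : Prop :=
  ∀ x x' y, 2 * ‖x - x'‖ < ‖x - y‖ →
    ‖K x y - K x' y‖ ≤ ω (‖x - x'‖ / ‖x - y‖) * (1 / ‖x - y‖ ^ d)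

namespace IsCZKernel

variable {K : Euc d → Euc d → 𝕜} {C : ℝ} {ω : ℝ → ℝ}

theorem isSmoothFst (hK : IsCZKernel K C ω) : IsSmoothFst K ω := fun x x' y h =>
  le_trans (le_add_of_nonneg_right (norm_nonneg _)) (hK.smooth x x' y h)

theorem isSmoothFst_swap (hK : IsCZKernel K C ω) : IsSmoothFst (fun x y => K y x) ω :=
  fun x x' y h => le_trans (le_add_of_nonneg_left (norm_nonneg _)) (hK.smooth x x' y h)

theorem const_nonneg (hK : IsCZKernel K C ω) (hd : 1 ≤ d) : 0 ≤ C := by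
  have h0 : (EuclideanSpace.single (⟨0, hd⟩ : Fin d) (1 : ℝ)) ≠ 0 := by
    simp
  have h := (norm_nonneg _).trans (hK.size _ 0 h0)
  by_contra hC
  refine absurd h (not_le.2 (div_neg_of_neg_of_pos (not_le.1 hC) ?_))
  simp

end IsCZKernel

/-- The kernel is not assumed measurable. Smoothness makes it continuous in each variable off the
diagonal, and all measurability below comes from this. -/
theorem IsSmoothFst.continuousAt {K : Euc d → Euc d → 𝕜} {ω : ℝ → ℝ} (hω : IsDiniModulus ω)
    (hK : IsSmoothFst K ω) {x y : Euc d} (hxy : x ≠ y) : ContinuousAt (fun z => K z y) x := by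
  have hpos : 0 < ‖x - y‖ := norm_pos_iff.2 (sub_ne_zero.2 hxy)
  rw [ContinuousAt, tendsto_iff_norm_sub_tendsto_zero]
  have h1 : Tendsto (fun z => ‖x - z‖ / ‖x - y‖) (𝓝 x) (𝓝[≥] 0) := by
    refine tendsto_nhdsWithin_iff.2 ⟨?_, Eventually.of_forall fun z => ?_⟩
    · have : ContinuousAt (fun z => ‖x - z‖ / ‖x - y‖) x := by fun_prop
      simpa [ContinuousAt] using this
    · exact mem_Ici.2 (by positivity)
  have h2 := (hω.tendsto_zero.comp h1).mul_const (1 / ‖x - y‖ ^ d)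
  rw [zero_mul] at h2
  refine squeeze_zero' (Eventually.of_forall fun _ => norm_nonneg _) ?_ h2
  have h3 : ∀ᶠ z in 𝓝 x, 2 * ‖x - z‖ < ‖x - y‖ := by
    have : ContinuousAt (fun z => 2 * ‖x - z‖) x := by fun_prop
    have := this.tendsto
    simp only [sub_self, norm_zero, mul_zero] at this
    exact this.eventually_lt_const hpos
  filter_upwards [h3] with z hz
  rw [norm_sub_rev]
  exact hK x z y hz

/-- The basic oscillation estimate for a Dini-smooth kernel, with sources controlled by a bound
on averages over balls. -/
theorem IsSmoothFst.lintegral_sub_le {K : Euc d → Euc d → 𝕜} {ω : ℝ → ℝ} (hω : IsDiniModulus ω)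
    (hK : IsSmoothFst K ω) {x x' : Euc d} {δ : ℝ} (hδ : 0 < δ) (hxx : ‖x - x'‖ ≤ δ)
    {g : Euc d → ℝ≥0∞} {s : ℝ≥0∞}
    (hg : ∀ r : ℝ, 0 < r → ∫⁻ y in closedBall x r, g y ≤ s * ENNReal.ofReal (r ^ d)) :
    ∫⁻ y in {y | 2 * δ < ‖x - y‖}, ‖K x y - K x' y‖ₑ * g y ≤
      2 ^ (d + 1) * s * ENNReal.ofReal (diniConst ω) := by
  -- The strict bound `2 * δ < ‖x - y‖` is kept inside each annulus because for `k = 0` the annulus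
  -- alone gives only `≤`, while smoothness needs the strict inequality.
  set A : ℕ → Set (Euc d) := fun k =>
    {y | 2 * δ < ‖x - y‖ ∧ 2 ^ (k + 1) * δ ≤ ‖x - y‖ ∧ ‖x - y‖ < 2 ^ (k + 2) * δ} with hA
  have hAm : ∀ k, MeasurableSet (A k) := fun k => by
    have hm : Measurable fun y : Euc d => ‖x - y‖ := by fun_prop
    exact (measurableSet_lt measurable_const hm).inter
      ((measurableSet_le measurable_const hm).inter (measurableSet_lt hm measurable_const))
  have hcov : {y | 2 * δ < ‖x - y‖} ⊆ ⋃ k, A k := by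
    intro y hy
    have hy : 2 * δ < ‖x - y‖ := hy
    obtain ⟨n, h1, h2⟩ := exists_nat_pow_near (x := ‖x - y‖ / δ) (y := 2)
      ((one_le_div hδ).2 (by linarith)) one_lt_two
    have hn : n ≠ 0 := by
      rintro rfl
      rw [zero_add, pow_one, div_lt_iff₀ hδ] at h2
      linarith
    obtain ⟨k, rfl⟩ := Nat.exists_eq_succ_of_ne_zero hn
    refine mem_iUnion.2 ⟨k, hy, ?_, ?_⟩
    · exact (le_div_iff₀ hδ).1 h1
    · exact (div_lt_iff₀ hδ).1 h2
  calc ∫⁻ y in {y | 2 * δ < ‖x - y‖}, ‖K x y - K x' y‖ₑ * g y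
      ≤ ∫⁻ y in ⋃ k, A k, ‖K x y - K x' y‖ₑ * g y := lintegral_mono_set hcov
    _ ≤ ∑' k, ∫⁻ y in A k, ‖K x y - K x' y‖ₑ * g y := lintegral_iUnion_le _ _
    _ ≤ ∑' k : ℕ, (2 ^ d * s) * ENNReal.ofReal (ω ((1 / 2 : ℝ) ^ (k + 1))) := by
        refine ENNReal.tsum_le_tsum fun k => ?_
        have hp : (0 : ℝ) < 2 ^ (k + 1) * δ := by positivity
        set c : ℝ := ω ((1 / 2 : ℝ) ^ (k + 1)) with hc
        have hc0 : 0 ≤ c := hω.nonneg (by positivity) (pow_le_one₀ (by norm_num) (by norm_num))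
        have hb : ∀ y ∈ A k, ‖K x y - K x' y‖ₑ * g y ≤
            ENNReal.ofReal (c * (1 / (2 ^ (k + 1) * δ) ^ d)) * g y := by
          intro y hy
          refine mul_le_mul_left ?_ _
          rw [← ofReal_norm]
          refine ENNReal.ofReal_le_ofReal ?_
          have hpos : 0 < ‖x - y‖ := lt_of_lt_of_le hp hy.2.1
          refine (hK x x' y (by linarith [hy.1])).trans ?_
          have hle : ‖x - x'‖ / ‖x - y‖ ≤ (1 / 2 : ℝ) ^ (k + 1) := by
            rw [div_le_iff₀ hpos, div_pow, one_pow, div_mul_eq_mul_div, one_mul,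
              le_div_iff₀ (by positivity)]
            nlinarith [hy.2.1, mul_le_mul_of_nonneg_left hxx
              (by positivity : (0 : ℝ) ≤ 2 ^ (k + 1))]
          have h1 : ω (‖x - x'‖ / ‖x - y‖) ≤ c :=
            hω.mono ⟨by positivity, hle.trans (pow_le_one₀ (by norm_num) (by norm_num))⟩
              ⟨by positivity, pow_le_one₀ (by norm_num) (by norm_num)⟩ hle
          refine mul_le_mul h1 ?_ (by positivity) hc0
          exact one_div_le_one_div_of_le (by positivity) (pow_le_pow_left₀ hp.le hy.2.1 d)
        calc ∫⁻ y in A k, ‖K x y - K x' y‖ₑ * g y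
            ≤ ∫⁻ y in A k, ENNReal.ofReal (c * (1 / (2 ^ (k + 1) * δ) ^ d)) * g y :=
              setLIntegral_mono' (hAm k) hb
          _ = ENNReal.ofReal (c * (1 / (2 ^ (k + 1) * δ) ^ d)) * ∫⁻ y in A k, g y :=
              lintegral_const_mul' _ _ ENNReal.ofReal_ne_top
          _ ≤ ENNReal.ofReal (c * (1 / (2 ^ (k + 1) * δ) ^ d)) *
                (s * ENNReal.ofReal ((2 ^ (k + 2) * δ) ^ d)) := by
              refine mul_le_mul_right ?_ _
              refine (lintegral_mono_set fun y hy => ?_).trans (hg _ (by positivity))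
              rw [mem_closedBall, dist_comm, dist_eq_norm]
              exact hy.2.2.le
          _ = 2 ^ d * s * ENNReal.ofReal c := by
              rw [mul_left_comm, ← ENNReal.ofReal_mul (by positivity)]
              -- The ratio of the outer to the inner radius of an annulus is 2, which costs `2 ^ d`.
              have : c * (1 / (2 ^ (k + 1) * δ) ^ d) * (2 ^ (k + 2) * δ) ^ d = 2 ^ d * c := by
                have h2 : (2 ^ (k + 2) * δ) ^ d = 2 ^ d * (2 ^ (k + 1) * δ) ^ d := by
                  rw [← mul_pow]; ring
                rw [h2]
                field_simp
              rw [this, ENNReal.ofReal_mul (by positivity), ENNReal.ofReal_pow (by norm_num)]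
              simp only [ENNReal.ofReal_ofNat]
              ring
    _ = (2 ^ d * s) * ∑' k : ℕ, ENNReal.ofReal (ω ((1 / 2 : ℝ) ^ (k + 1))) :=
        ENNReal.tsum_mul_left
    _ ≤ (2 ^ d * s) * (2 * ENNReal.ofReal (diniConst ω)) := mul_le_mul_right hω.tsum_le _
    _ = 2 ^ (d + 1) * s * ENNReal.ofReal (diniConst ω) := by ring

/-! ### The Hardy–Littlewood level sets -/

/-- The set where some average of `g` over a centred ball (with unnormalised weight `r ^ d`)
exceeds `s`. -/
def maximalSet (g : Euc d → ℝ≥0∞) (s : ℝ≥0∞) : Set (Euc d) :=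
  {x | ∃ r : ℝ, 0 < r ∧ s * ENNReal.ofReal (r ^ d) < ∫⁻ y in closedBall x r, g y}

theorem lintegral_closedBall_le_of_notMem_maximalSet {g : Euc d → ℝ≥0∞} {s : ℝ≥0∞} {x : Euc d}
    (hx : x ∉ maximalSet g s) (r : ℝ) (hr : 0 < r) :
    ∫⁻ y in closedBall x r, g y ≤ s * ENNReal.ofReal (r ^ d) :=
  not_lt.1 fun h => hx ⟨r, hr, h⟩

/-- The constant in the weak type inequality for the maximal function. -/
noncomputable def maximalConst (d : ℕ) : ℝ≥0∞ := 5 ^ d * volume (ball (0 : Euc d) 1)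

theorem maximalConst_ne_top : maximalConst d ≠ ∞ :=
  ENNReal.mul_ne_top (by finiteness) measure_ball_lt_top.ne

/-- Vitali covering: disjoint balls on which the average is large, enlarged five times, cover the
level set. -/
theorem volume_maximalSet_le (hd : 1 ≤ d) {g : Euc d → ℝ≥0∞} (hg : ∫⁻ y, g y ≠ ∞)
    {s : ℝ≥0∞} (hs : s ≠ 0) (hs' : s ≠ ∞) :
    volume (maximalSet g s) ≤ maximalConst d * ((∫⁻ y, g y) / s) := by
  classical
  have hsel : ∀ x : Euc d, ∃ r : ℝ, x ∈ maximalSet g s →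
      0 < r ∧ s * ENNReal.ofReal (r ^ d) < ∫⁻ y in closedBall x r, g y := fun x => by
    by_cases hx : x ∈ maximalSet g s
    · obtain ⟨r, hr⟩ := hx
      exact ⟨r, fun _ => hr⟩
    · exact ⟨0, fun h => absurd h hx⟩
  choose r hr using hsel
  -- Vitali's lemma needs bounded radii: s·r^d is less than the total integral, and r ≤ r^d as soon
  -- as r ≥ 1.
  have hbound : ∀ x ∈ maximalSet g s, r x ≤ max 1 ((∫⁻ y, g y) / s).toReal := by
    intro x hx
    rcases le_total (r x) 1 with h | h
    · exact h.trans (le_max_left _ _)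
    refine le_trans ?_ (le_max_right _ _)
    have h1 : ENNReal.ofReal (r x ^ d) ≤ (∫⁻ y, g y) / s := by
      rw [ENNReal.le_div_iff_mul_le (Or.inl hs) (Or.inl hs'), mul_comm]
      exact (hr x hx).2.le.trans (setLIntegral_le_lintegral _ _)
    have h2 := (ENNReal.ofReal_le_iff_le_toReal (ENNReal.div_ne_top hg hs)).1 h1
    exact (le_self_pow₀ h (by omega)).trans h2
  obtain ⟨u, hu, hdisj, hcov⟩ := Vitali.exists_disjoint_subfamily_covering_enlargement_closedBall
    (maximalSet g s) (fun x => x) r _ hbound 5 (by norm_num)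
  have hcount : u.Countable := by
    refine hdisj.countable_of_nonempty_interior fun x hx => ?_
    exact ⟨x, ball_subset_interior_closedBall (mem_ball_self (hr x (hu hx)).1)⟩
  have hsub : maximalSet g s ⊆ ⋃ x ∈ u, closedBall x (5 * r x) := by
    intro x hx
    obtain ⟨b, hb, hxb⟩ := hcov x hx
    exact mem_iUnion₂.2 ⟨b, hb, hxb (mem_closedBall_self (hr x hx).1.le)⟩
  have := hcount.to_subtype
  calc volume (maximalSet g s) ≤ volume (⋃ x ∈ u, closedBall x (5 * r x)) := measure_mono hsub
    _ ≤ ∑' x : u, volume (closedBall (x : Euc d) (5 * r x)) := measure_biUnion_le _ hcount _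
    _ ≤ ∑' x : u, maximalConst d * ((∫⁻ y in closedBall (x : Euc d) (r x), g y) / s) := by
        refine ENNReal.tsum_le_tsum fun x => ?_
        have hx := hr x (hu x.2)
        rw [Measure.addHaar_closedBall _ _ (by linarith [hx.1]), finrank_euclideanSpace_fin,
          mul_pow, ENNReal.ofReal_mul (by positivity), ENNReal.ofReal_pow (by norm_num),
          ENNReal.ofReal_ofNat, maximalConst, mul_assoc, mul_assoc, mul_comm (ENNReal.ofReal _)]
        refine mul_le_mul_right (mul_le_mul_right ?_ _) _
        rw [ENNReal.le_div_iff_mul_le (Or.inl hs) (Or.inl hs'), mul_comm]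
        exact hx.2.le
    _ = maximalConst d * ((∑' x : u, ∫⁻ y in closedBall (x : Euc d) (r x), g y) / s) := by
        simp only [div_eq_mul_inv, ENNReal.tsum_mul_left, ENNReal.tsum_mul_right]
    _ ≤ maximalConst d * ((∫⁻ y, g y) / s) := by
        gcongr
        rw [← lintegral_iUnion (s := fun x : u => closedBall (x : Euc d) (r x))
          (fun x => measurableSet_closedBall)
          (fun x y hxy => hdisj x.2 y.2 (Subtype.coe_injective.ne hxy))]
        exact setLIntegral_le_lintegral _ _

end SparseCZ

namespace SparseCZ

open Set Filter Topology Metric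

variable {d : ℕ} {𝕜 : Type*} [RCLike 𝕜]

/-! ### Dyadic cubes -/

/-- The half-open box with lower corner `a` and side length `l`. -/
def box (a : Euc d) (l : ℝ) : Set (Euc d) := {x | ∀ i, a i ≤ x i ∧ x i < a i + l}

theorem box_eq_preimage (a : Euc d) (l : ℝ) :
    box a l = WithLp.ofLp ⁻¹' (univ.pi fun i => Ico (a i) (a i + l)) := by
  ext x
  simp [box]

theorem measurableSet_box (a : Euc d) (l : ℝ) : MeasurableSet (box a l) := by
  rw [box_eq_preimage]
  exact (PiLp.volume_preserving_ofLp (Fin d)).measurable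
    (MeasurableSet.univ_pi fun i => measurableSet_Ico)

theorem volume_box (a : Euc d) (l : ℝ) : volume (box a l) = ENNReal.ofReal l ^ d := by
  rw [box_eq_preimage, (PiLp.volume_preserving_ofLp (Fin d)).measure_preimage
    (MeasurableSet.univ_pi fun i => measurableSet_Ico).nullMeasurableSet,
    volume_pi_pi]
  simp

/-- Indices of dyadic cubes: generation and position. -/
abbrev DyadicIndex (d : ℕ) : Type := ℤ × (Fin d → ℤ)

/-- The side length of a dyadic cube. -/
noncomputable def side (Q : DyadicIndex d) : ℝ := 2 ^ Q.1

theorem side_pos (Q : DyadicIndex d) : 0 < side Q := by unfold side; positivity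

/-- The index of the dyadic cube of generation `n` containing `x`. -/
noncomputable def dyadicIndex (n : ℤ) (x : Euc d) : DyadicIndex d :=
  (n, fun i => ⌊x i / 2 ^ n⌋)

/-- The dyadic cube with a given index. -/
def cube (Q : DyadicIndex d) : Set (Euc d) := {x | dyadicIndex Q.1 x = Q}

theorem mem_cube_dyadicIndex (n : ℤ) (x : Euc d) : x ∈ cube (dyadicIndex n x) := rfl

theorem mem_cube_iff {Q : DyadicIndex d} {x : Euc d} :
    x ∈ cube Q ↔ ∀ i, Q.2 i * side Q ≤ x i ∧ x i < (Q.2 i + 1) * side Q := by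
  have h : x ∈ cube Q ↔ ∀ i, ⌊x i / 2 ^ Q.1⌋ = Q.2 i := by
    simp only [cube, dyadicIndex, mem_ofPred_eq]
    constructor
    · intro h i
      exact congr_fun (congr_arg Prod.snd h) i
    · intro h
      exact Prod.ext rfl (funext h)
  rw [h]
  refine forall_congr' fun i => ?_
  rw [Int.floor_eq_iff, show (2 : ℝ) ^ Q.1 = side Q from rfl, le_div_iff₀ (side_pos Q),
    div_lt_iff₀ (side_pos Q)]

theorem cube_eq_box (Q : DyadicIndex d) :
    cube Q = box (WithLp.toLp 2 fun i => Q.2 i * side Q) (side Q) := by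
  ext x
  rw [mem_cube_iff]
  simp only [box, mem_ofPred_eq, add_mul, one_mul]

/-- The factor by which cubes are dilated. -/
noncomputable def dilFactor (d : ℕ) : ℝ := 4 * Real.sqrt d + 2

theorem two_le_dilFactor : 2 ≤ dilFactor d := by
  have := Real.sqrt_nonneg d
  unfold dilFactor
  linarith

theorem dilFactor_pos : 0 < dilFactor d := two_pos.trans_le two_le_dilFactor

/-- The lower corner of the dilate of a dyadic cube. -/
noncomputable def dilCorner (Q : DyadicIndex d) : Euc d :=
  WithLp.toLp 2 fun i => (Q.2 i + 1 / 2 - dilFactor d / 2) * side Q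

/-- The concentric dilate of a dyadic cube by the factor `4 √d + 2`. -/
noncomputable def dil (Q : DyadicIndex d) : Set (Euc d) :=
  box (dilCorner Q) (dilFactor d * side Q)

theorem mem_dil_iff {Q : DyadicIndex d} {x : Euc d} :
    x ∈ dil Q ↔ ∀ i, (Q.2 i + 1 / 2 - dilFactor d / 2) * side Q ≤ x i ∧
      x i < (Q.2 i + 1 / 2 + dilFactor d / 2) * side Q := by
  have h : ∀ i, (Q.2 i + 1 / 2 - dilFactor d / 2) * side Q + dilFactor d * side Q =
    (Q.2 i + 1 / 2 + dilFactor d / 2) * side Q := fun i => by ring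
  simp only [dil, box, dilCorner, mem_ofPred_eq, h]

theorem isCube_dil (Q : DyadicIndex d) : IsCube (dil Q) :=
  ⟨dilCorner Q, dilFactor d * side Q, mul_pos dilFactor_pos (side_pos Q), rfl⟩

theorem measurableSet_cube (Q : DyadicIndex d) : MeasurableSet (cube Q) := by
  rw [cube_eq_box]; exact measurableSet_box _ _

theorem measurableSet_dil (Q : DyadicIndex d) : MeasurableSet (dil Q) := measurableSet_box _ _

theorem volume_cube (Q : DyadicIndex d) : volume (cube Q) = ENNReal.ofReal (side Q) ^ d := by
  rw [cube_eq_box, volume_box]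

theorem volume_cube_ne_zero (Q : DyadicIndex d) : volume (cube Q) ≠ 0 := by
  rw [volume_cube]
  exact pow_ne_zero _ (by simpa using side_pos Q)

theorem volume_cube_ne_top (Q : DyadicIndex d) : volume (cube Q) ≠ ∞ := by
  rw [volume_cube]
  finiteness

theorem volume_dil (Q : DyadicIndex d) :
    volume (dil Q) = ENNReal.ofReal (dilFactor d) ^ d * volume (cube Q) := by
  rw [dil, volume_box, volume_cube, ENNReal.ofReal_mul dilFactor_pos.le, mul_pow]

theorem volume_dil_ne_zero (Q : DyadicIndex d) : volume (dil Q) ≠ 0 := by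
  rw [dil, volume_box]
  exact pow_ne_zero _ (by simpa using mul_pos dilFactor_pos (side_pos Q))

theorem volume_dil_ne_top (Q : DyadicIndex d) : volume (dil Q) ≠ ∞ := by
  rw [dil, volume_box]
  finiteness

/-! #### Nesting -/

/-- The position of the coarser cube is the integer quotient by 2^k of the position of the finer
one, because floors commute with division by a natural number. -/
theorem nested_aux {P Q : DyadicIndex d} (h : P.1 ≤ Q.1) {x : Euc d} (hP : x ∈ cube P)
    (hQ : x ∈ cube Q) (i : Fin d) :
    Q.2 i * side Q ≤ P.2 i * side P ∧ (P.2 i + 1) * side P ≤ (Q.2 i + 1) * side Q := by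
  obtain ⟨k, hk⟩ := Int.eq_ofNat_of_zero_le (sub_nonneg.2 h)
  have hQ1 : Q.1 = P.1 + k := by linarith
  have hside : side Q = 2 ^ k * side P := by
    rw [side, side, hQ1, zpow_add₀ two_ne_zero, zpow_natCast, mul_comm]
  have hP2 : P.2 i = ⌊x i / 2 ^ P.1⌋ := by rw [← (show dyadicIndex P.1 x = P from hP)]; rfl
  have hQ2 : Q.2 i = ⌊x i / 2 ^ Q.1⌋ := by rw [← (show dyadicIndex Q.1 x = Q from hQ)]; rfl
  have hdiv : Q.2 i = P.2 i / (2 ^ k : ℕ) := by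
    rw [hP2, hQ2, ← Int.floor_div_natCast, hQ1, zpow_add₀ two_ne_zero, div_div]
    norm_num
  have hp : (0 : ℤ) < (2 ^ k : ℕ) := by positivity
  have h1 : Q.2 i * (2 ^ k : ℕ) ≤ P.2 i := by
    rw [hdiv]; exact Int.ediv_mul_le _ hp.ne'
  have h2 : P.2 i + 1 ≤ (Q.2 i + 1) * (2 ^ k : ℕ) := by
    rw [hdiv]; exact Int.lt_ediv_add_one_mul_self _ hp
  have h1' : (Q.2 i : ℝ) * 2 ^ k ≤ P.2 i := by exact_mod_cast h1
  have h2' : (P.2 i : ℝ) + 1 ≤ (Q.2 i + 1) * 2 ^ k := by exact_mod_cast h2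
  have hs := (side_pos P).le
  rw [hside, ← mul_assoc, ← mul_assoc]
  exact ⟨mul_le_mul_of_nonneg_right h1' hs, mul_le_mul_of_nonneg_right h2' hs⟩

theorem cube_subset_cube {P Q : DyadicIndex d} (h : P.1 ≤ Q.1) {x : Euc d} (hP : x ∈ cube P)
    (hQ : x ∈ cube Q) : cube P ⊆ cube Q := by
  intro y hy
  rw [mem_cube_iff] at hy ⊢
  intro i
  have := nested_aux h hP hQ i
  exact ⟨this.1.trans (hy i).1, (hy i).2.trans_le this.2⟩

theorem side_le_side {P Q : DyadicIndex d} (h : P.1 ≤ Q.1) : side P ≤ side Q :=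
  zpow_le_zpow_right₀ one_le_two h

/-- The margin added on each side is proportional to the side length, so it is larger for the larger
cube. -/
theorem dil_subset_dil_of_mem {P Q : DyadicIndex d} (h : P.1 ≤ Q.1) {x : Euc d}
    (hP : x ∈ cube P) (hQ : x ∈ cube Q) : dil P ⊆ dil Q := by
  intro y hy
  rw [mem_dil_iff] at hy ⊢
  intro i
  have h1 := nested_aux h hP hQ i
  have h2 := mul_le_mul_of_nonneg_left (side_le_side h)
    (by linarith [two_le_dilFactor (d := d)] : 0 ≤ dilFactor d / 2 - 1 / 2)
  constructor
  · refine le_trans ?_ (hy i).1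
    linarith [h1.1]
  · refine (hy i).2.trans_le ?_
    linarith [h1.2]

theorem cube_nonempty (Q : DyadicIndex d) : (cube Q).Nonempty :=
  nonempty_of_measure_ne_zero (volume_cube_ne_zero Q)

theorem generation_le_of_subset (hd : 1 ≤ d) {P Q : DyadicIndex d} (h : cube P ⊆ cube Q) :
    P.1 ≤ Q.1 := by
  have h1 := measure_mono (μ := volume) h
  rw [volume_cube, volume_cube, ENNReal.pow_le_pow_left_iff (by omega),
    ENNReal.ofReal_le_ofReal_iff (side_pos Q).le] at h1
  exact (zpow_le_zpow_iff_right₀ one_lt_two).1 h1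

theorem dil_subset_dil (hd : 1 ≤ d) {P Q : DyadicIndex d} (h : cube P ⊆ cube Q) :
    dil P ⊆ dil Q := by
  obtain ⟨x, hx⟩ := cube_nonempty P
  exact dil_subset_dil_of_mem (generation_le_of_subset hd h) hx (h hx)

theorem eq_of_mem_of_generation_eq {P Q : DyadicIndex d} {x : Euc d} (hP : x ∈ cube P)
    (hQ : x ∈ cube Q) (h : P.1 = Q.1) : P = Q := by
  rw [← (show dyadicIndex P.1 x = P from hP), ← (show dyadicIndex Q.1 x = Q from hQ), h]

theorem subset_or_subset {P Q : DyadicIndex d} {x : Euc d} (hP : x ∈ cube P) (hQ : x ∈ cube Q) :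
    cube P ⊆ cube Q ∨ cube Q ⊆ cube P :=
  (le_total P.1 Q.1).imp (cube_subset_cube · hP hQ) (cube_subset_cube · hQ hP)

/-- The sparse family is a set of sets. Injectivity lets a sum over it be read as a sum over dyadic
indices, with no dilate lost or counted twice. -/
theorem dil_injective (hd : 1 ≤ d) : Function.Injective (dil : DyadicIndex d → Set (Euc d)) := by
  intro P Q h
  have h1 := congr_arg (volume : Measure (Euc d)) h
  rw [dil, dil, volume_box, volume_box] at h1
  have hpos : 0 < dilFactor d := dilFactor_pos
  have h2 := (ENNReal.pow_right_strictMono (n := d) (by omega)).injective h1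
  rw [ENNReal.ofReal_eq_ofReal_iff (mul_pos hpos (side_pos P)).le (mul_pos hpos (side_pos Q)).le]
    at h2
  have hs : side P = side Q := mul_left_cancel₀ hpos.ne' h2
  have hgen : P.1 = Q.1 := zpow_right_injective₀ two_pos (by norm_num) hs
  -- A half-open box contains its lower corner, so equal boxes have corners comparable in both
  -- directions.
  have hcorner : ∀ R R' : DyadicIndex d, dil R = dil R' → ∀ i, dilCorner R' i ≤ dilCorner R i := by
    intro R R' hR i
    have : dilCorner R ∈ dil R' := by
      rw [← hR]
      exact fun j => ⟨le_rfl, lt_add_of_pos_right _ (mul_pos hpos (side_pos R))⟩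
    exact (this i).1
  refine Prod.ext hgen (funext fun i => ?_)
  have h3 := le_antisymm (hcorner Q P h.symm i) (hcorner P Q h i)
  simp only [dilCorner, hs] at h3
  have h4 := mul_right_cancel₀ (side_pos Q).ne' h3
  have h5 : (P.2 i : ℝ) = Q.2 i := by linarith
  exact_mod_cast h5

/-! #### Distances -/

theorem norm_le_sqrt_mul {x : Euc d} {r : ℝ} (hr : 0 ≤ r) (h : ∀ i, |x i| ≤ r) :
    ‖x‖ ≤ Real.sqrt d * r := by
  rw [EuclideanSpace.norm_eq, ← Real.sqrt_sq hr, ← Real.sqrt_mul (Nat.cast_nonneg d)]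
  refine Real.sqrt_le_sqrt ?_
  calc ∑ i, ‖x i‖ ^ 2 ≤ ∑ _i : Fin d, r ^ 2 :=
        Finset.sum_le_sum fun i _ => by
          rw [Real.norm_eq_abs]; exact pow_le_pow_left₀ (abs_nonneg _) (h i) 2
    _ = d * r ^ 2 := by simp

theorem norm_sub_le_of_mem_cube {Q : DyadicIndex d} {x y : Euc d} (hx : x ∈ cube Q)
    (hy : y ∈ cube Q) : ‖x - y‖ ≤ Real.sqrt d * side Q := by
  refine norm_le_sqrt_mul (side_pos Q).le fun i => ?_
  have h1 := mem_cube_iff.1 hx i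
  have h2 := mem_cube_iff.1 hy i
  rw [PiLp.sub_apply, abs_le]
  constructor <;> linarith

theorem norm_sub_le_of_mem_dil {Q : DyadicIndex d} {x y : Euc d} (hx : x ∈ cube Q)
    (hy : y ∈ dil Q) : ‖x - y‖ ≤ Real.sqrt d * (dilFactor d * side Q) := by
  have hpos := mul_pos (dilFactor_pos (d := d)) (side_pos Q)
  refine norm_le_sqrt_mul hpos.le fun i => ?_
  have h1 := mem_cube_iff.1 hx i
  have h2 := mem_dil_iff.1 hy i
  have h3 := mul_le_mul_of_nonneg_right (two_le_dilFactor (d := d)) (side_pos Q).le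
  rw [PiLp.sub_apply, abs_le]
  constructor <;> linarith

/-- The dilate leaves a margin of `(dilFactor d - 1) / 2 = 2√d + 1/2` side lengths around the cube.
This is more than twice the diameter of the cube, which is what the smoothness condition asks for.
-/
theorem le_norm_sub_of_notMem_dil {Q : DyadicIndex d} {x y : Euc d} (hx : x ∈ cube Q)
    (hy : y ∉ dil Q) : (2 * Real.sqrt d + 1 / 2) * side Q ≤ ‖x - y‖ := by
  rw [mem_dil_iff] at hy
  push Not at hy
  obtain ⟨i, hi⟩ := hy
  have h1 := mem_cube_iff.1 hx i
  refine le_trans ?_ (PiLp.norm_apply_le (x - y) i)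
  rw [PiLp.sub_apply, Real.norm_eq_abs, le_abs]
  rcases lt_or_ge (y i) ((Q.2 i + 1 / 2 - dilFactor d / 2) * side Q) with h | h
  · left
    unfold dilFactor at h
    linarith
  · right
    have := hi h
    unfold dilFactor at this
    linarith

theorem sqrt_lt_norm_sub_of_notMem_dil {Q : DyadicIndex d} {x y : Euc d} (hx : x ∈ cube Q)
    (hy : y ∉ dil Q) : 2 * (Real.sqrt d * side Q) < ‖x - y‖ := by
  refine lt_of_lt_of_le ?_ (le_norm_sub_of_notMem_dil hx hy)
  linarith [side_pos Q]

theorem closedBall_subset_dil (hd : 1 ≤ d) {Q : DyadicIndex d} {x : Euc d} (hx : x ∈ cube Q)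
    {r : ℝ} (hr : r < 2 * side Q) : closedBall x r ⊆ dil Q := by
  intro y hy
  by_contra hn
  have h := sqrt_lt_norm_sub_of_notMem_dil hx hn
  rw [mem_closedBall, dist_comm, dist_eq_norm] at hy
  have h1 : (1 : ℝ) ≤ Real.sqrt d := Real.one_le_sqrt.2 (by exact_mod_cast hd)
  nlinarith [mul_le_mul_of_nonneg_right h1 (side_pos Q).le]

theorem cube_subset_dil (hd : 1 ≤ d) (Q : DyadicIndex d) : cube Q ⊆ dil Q := fun _ hx =>
  closedBall_subset_dil hd hx (r := 0) (by linarith [side_pos Q]) (mem_closedBall_self le_rfl)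

theorem dil_mem_nhds (hd : 1 ≤ d) {Q : DyadicIndex d} {x : Euc d} (hx : x ∈ cube Q) :
    dil Q ∈ 𝓝 x :=
  mem_of_superset (closedBall_mem_nhds x (side_pos Q))
    (closedBall_subset_dil hd hx (by linarith [side_pos Q]))

theorem closure_cube_subset_dil (hd : 1 ≤ d) (Q : DyadicIndex d) : closure (cube Q) ⊆ dil Q := by
  intro x hx
  obtain ⟨y, hy, hxy⟩ := Metric.mem_closure_iff.1 hx (side Q) (side_pos Q)
  exact closedBall_subset_dil hd hy (r := side Q) (by linarith [side_pos Q])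
    (mem_closedBall.2 hxy.le)

/-! ### Stopping cubes of an open set -/

/-- `O` fills a substantial proportion of the dyadic cube `P`. -/
def IsHeavy (O : Set (Euc d)) (P : DyadicIndex d) : Prop :=
  volume (cube P) < 2 ^ (d + 1) * volume (cube P ∩ O)

/-- The maximal dyadic cubes among those heavily filled by `O`. -/
def stopping (O : Set (Euc d)) : Set (DyadicIndex d) :=
  {P | IsHeavy O P ∧ ∀ P', IsHeavy O P' → cube P ⊆ cube P' → P' = P}

/-- A heavy cube has measure at most `2 ^ (d + 1) * volume O`, so generations of heavy cubes
containing `x` are bounded above and a largest one exists. -/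
theorem exists_mem_stopping (hd : 1 ≤ d) {O : Set (Euc d)} (hO : volume O ≠ ∞) {n : ℤ}
    {x : Euc d} (h : IsHeavy O (dyadicIndex n x)) :
    ∃ P ∈ stopping O, cube (dyadicIndex n x) ⊆ cube P := by
  obtain ⟨b, hb⟩ : ∃ b : ℤ, ∀ m, IsHeavy O (dyadicIndex m x) → m ≤ b := by
    have hfin : (2 : ℝ≥0∞) ^ (d + 1) * volume O ≠ ∞ := by finiteness
    obtain ⟨b, hb⟩ := pow_unbounded_of_one_lt ((2 : ℝ≥0∞) ^ (d + 1) * volume O).toReal one_lt_two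
    refine ⟨b, fun m hm => ?_⟩
    by_contra hmb
    push Not at hmb
    have h1 : volume (cube (dyadicIndex m x)) ≤ 2 ^ (d + 1) * volume O :=
      hm.le.trans (mul_le_mul_right (measure_mono inter_subset_right) _)
    have h2 : (2 : ℝ) ^ b ≤ side (dyadicIndex m x) := by
      rw [← zpow_natCast]
      exact zpow_le_zpow_right₀ one_le_two hmb.le
    have h3 : side (dyadicIndex m x) ≤ side (dyadicIndex m x) ^ d :=
      le_self_pow₀ ((one_le_pow₀ one_le_two).trans h2) (by omega)
    rw [volume_cube, ← ENNReal.ofReal_pow (side_pos _).le,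
      ENNReal.ofReal_le_iff_le_toReal hfin] at h1
    linarith
  obtain ⟨m, hm, hmax⟩ := Int.exists_greatest_of_bdd ⟨b, hb⟩ ⟨n, h⟩
  refine ⟨dyadicIndex m x, ⟨hm, fun P' hP' hsub => ?_⟩,
    cube_subset_cube (hmax n h) (mem_cube_dyadicIndex n x) (mem_cube_dyadicIndex m x)⟩
  have hx : dyadicIndex P'.1 x = P' := hsub (mem_cube_dyadicIndex m x)
  have h1 : P'.1 ≤ m := hmax _ (hx.symm ▸ hP')
  have h2 : m ≤ P'.1 := generation_le_of_subset hd hsub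
  rw [← hx, le_antisymm h1 h2]

theorem exists_small_cube (hd : 1 ≤ d) {U : Set (Euc d)} {x : Euc d} (hU : U ∈ 𝓝 x) :
    ∃ n, cube (dyadicIndex n x) ⊆ U := by
  obtain ⟨r, hr, hrU⟩ := Metric.mem_nhds_iff.1 hU
  have h1 : (0 : ℝ) < Real.sqrt d := Real.sqrt_pos.2 (by exact_mod_cast hd)
  obtain ⟨n, hn⟩ := exists_pow_lt_of_lt_one (div_pos hr h1) (by norm_num : (1 / 2 : ℝ) < 1)
  refine ⟨-n, fun y hy => hrU ?_⟩
  rw [mem_ball, dist_eq_norm]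
  refine (norm_sub_le_of_mem_cube hy (mem_cube_dyadicIndex _ x)).trans_lt ?_
  rw [mul_comm, ← lt_div_iff₀ h1]
  simpa [side, dyadicIndex] using hn

theorem isHeavy_of_subset {O : Set (Euc d)} {P : DyadicIndex d} (h : cube P ⊆ O) :
    IsHeavy O P := by
  rw [IsHeavy, inter_eq_left.2 h]
  conv_lhs => rw [← one_mul (volume (cube P))]
  exact ENNReal.mul_lt_mul_left (volume_cube_ne_zero P) (volume_cube_ne_top P)
    (one_lt_pow₀ (by norm_num) (by omega))

theorem exists_mem_stopping_of_mem (hd : 1 ≤ d) {O : Set (Euc d)} (hO : IsOpen O)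
    (hfin : volume O ≠ ∞) {x : Euc d} (hx : x ∈ O) : ∃ P ∈ stopping O, x ∈ cube P := by
  obtain ⟨n, hn⟩ := exists_small_cube hd (hO.mem_nhds hx)
  obtain ⟨P, hP, hsub⟩ := exists_mem_stopping hd hfin (isHeavy_of_subset hn)
  exact ⟨P, hP, hsub (mem_cube_dyadicIndex n x)⟩

theorem stopping_eq_of_subset {O : Set (Euc d)} {P P' : DyadicIndex d}
    (hP : P ∈ stopping O) (hP' : P' ∈ stopping O) (h : cube P ⊆ cube P') : P' = P :=
  hP.2 P' hP'.1 h

theorem stopping_eq_of_mem {O : Set (Euc d)} {P P' : DyadicIndex d}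
    (hP : P ∈ stopping O) (hP' : P' ∈ stopping O) {x : Euc d} (hx : x ∈ cube P)
    (hx' : x ∈ cube P') : P = P' := by
  rcases subset_or_subset hx hx' with h | h
  · exact (stopping_eq_of_subset hP hP' h).symm
  · exact stopping_eq_of_subset hP' hP h

theorem stopping_pairwiseDisjoint (O : Set (Euc d)) :
    (stopping O).PairwiseDisjoint cube := fun _ hP _ hP' hne =>
  Set.disjoint_left.2 fun _ hx hx' => hne (stopping_eq_of_mem hP hP' hx hx')

/-- Each stopping cube has more than the fraction 2^{-d-1} of its measure in `O`, and stopping cubes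
are disjoint. -/
theorem tsum_volume_stopping_le {O : Set (Euc d)} (hO : MeasurableSet O) :
    ∑' P : stopping O, volume (cube (P : DyadicIndex d)) ≤ 2 ^ (d + 1) * volume O := by
  calc ∑' P : stopping O, volume (cube (P : DyadicIndex d))
      ≤ ∑' P : stopping O, 2 ^ (d + 1) * volume (cube (P : DyadicIndex d) ∩ O) :=
        ENNReal.tsum_le_tsum fun P => P.2.1.le
    _ = 2 ^ (d + 1) * volume (⋃ P : stopping O, cube (P : DyadicIndex d) ∩ O) := by
        rw [ENNReal.tsum_mul_left, measure_iUnion]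
        · intro P P' hne
          exact (stopping_pairwiseDisjoint O P.2 P'.2 (Subtype.coe_injective.ne hne)).mono
            inter_subset_left inter_subset_left
        · exact fun P => (measurableSet_cube _).inter hO
    _ ≤ 2 ^ (d + 1) * volume O :=
        mul_le_mul_right (measure_mono (iUnion_subset fun _ => inter_subset_right)) _

/-- The dyadic parent. -/
def parent (Q : DyadicIndex d) : DyadicIndex d := (Q.1 + 1, fun i => Q.2 i / 2)

theorem cube_subset_cube_parent (Q : DyadicIndex d) : cube Q ⊆ cube (parent Q) := by
  intro x hx
  have hx' : ∀ i, ⌊x i / 2 ^ Q.1⌋ = Q.2 i := fun i =>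
    congr_fun (congr_arg Prod.snd (show dyadicIndex Q.1 x = Q from hx)) i
  refine Prod.ext rfl (funext fun i => ?_)
  change ⌊x i / 2 ^ (Q.1 + 1)⌋ = Q.2 i / 2
  have h2 := Int.floor_div_natCast (x i / 2 ^ Q.1) 2
  rw [hx' i] at h2
  rw [zpow_add_one₀ two_ne_zero, ← div_div]
  exact_mod_cast h2

theorem side_parent (Q : DyadicIndex d) : side (parent Q) = 2 * side Q := by
  rw [side, side, parent, zpow_add_one₀ two_ne_zero, mul_comm]

theorem volume_cube_parent (Q : DyadicIndex d) :
    volume (cube (parent Q)) = 2 ^ d * volume (cube Q) := by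
  rw [volume_cube, volume_cube, side_parent, ENNReal.ofReal_mul two_pos.le, mul_pow,
    ENNReal.ofReal_ofNat]

theorem not_isHeavy_parent {O : Set (Euc d)} {P : DyadicIndex d} (hP : P ∈ stopping O) :
    ¬ IsHeavy O (parent P) := fun h => by
  have := congr_arg Prod.fst (hP.2 _ h (cube_subset_cube_parent P))
  simp [parent] at this

/-- This is why the threshold is 2^{-d-1}. If `P` is heavy, the hypothesis makes it a stopping cube,
so its parent is not heavy, and since the parent is 2^d times larger `O` fills at most half of `P`.
If `P` is not heavy, the bound is immediate. -/
theorem two_mul_volume_inter_le (hd : 1 ≤ d) {O : Set (Euc d)} (hO : volume O ≠ ∞)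
    {P : DyadicIndex d} (hP : ∀ P' ∈ stopping O, cube P ⊆ cube P' → P' = P) :
    2 * volume (cube P ∩ O) ≤ volume (cube P) := by
  by_cases h : IsHeavy O P
  · obtain ⟨x, hx⟩ := cube_nonempty P
    have hx' : dyadicIndex P.1 x = P := hx
    obtain ⟨P', hP', hsub⟩ := exists_mem_stopping hd hO (n := P.1) (x := x) (hx'.symm ▸ h)
    rw [hx'] at hsub
    have hPs : P ∈ stopping O := hP P' hP' hsub ▸ hP'
    have h1 := not_lt.1 (not_isHeavy_parent hPs)
    have h2 : 2 ^ (d + 1) * volume (cube P ∩ O) ≤ 2 ^ d * volume (cube P) := by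
      rw [← volume_cube_parent]
      exact (mul_le_mul_right (measure_mono
        (inter_subset_inter_left _ (cube_subset_cube_parent P))) _).trans h1
    rw [pow_succ, mul_assoc] at h2
    exact (ENNReal.mul_le_mul_iff_right (by simp) (by finiteness)).1 h2
  · refine le_trans (mul_le_mul_left ?_ _) (not_lt.1 h)
    exact le_self_pow₀ (by norm_num) (by omega)

end SparseCZ

namespace SparseCZ

open Set Filter Topology Metric

variable {d : ℕ} {𝕜 : Type*} [RCLike 𝕜]

/-! ### Measurability and integrability of the kernel off the diagonal -/

section Kernel

variable {K : Euc d → Euc d → 𝕜} {C : ℝ} {ω : ℝ → ℝ}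

/-- A continuous truncation of a kernel near the diagonal. -/
noncomputable def cutoffKernel (K : Euc d → Euc d → 𝕜) (r : ℝ) (x y : Euc d) : 𝕜 :=
  ((max 0 (min 1 (‖x - y‖ / r - 1)) : ℝ) : 𝕜) * K x y

theorem cutoffKernel_eq {r : ℝ} (hr : 0 < r) {x y : Euc d} (h : 2 * r ≤ ‖x - y‖) :
    cutoffKernel K r x y = K x y := by
  have h1 : 1 ≤ ‖x - y‖ / r - 1 := by
    rw [le_sub_iff_add_le, le_div_iff₀ hr]
    linarith
  simp [cutoffKernel, min_eq_left h1]

theorem cutoffKernel_eq_zero {r : ℝ} (hr : 0 < r) {x y : Euc d} (h : ‖x - y‖ < r) :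
    cutoffKernel K r x y = 0 := by
  have h1 : ‖x - y‖ / r - 1 ≤ 0 := by
    rw [sub_nonpos, div_le_one hr]
    exact h.le
  simp [cutoffKernel, max_eq_left ((min_le_right _ _).trans h1)]

theorem continuous_cutoffKernel (hω : IsDiniModulus ω) (hK : IsSmoothFst K ω) {r : ℝ}
    (hr : 0 < r) (y : Euc d) : Continuous fun x => cutoffKernel K r x y := by
  refine continuous_iff_continuousAt.2 fun x => ?_
  by_cases hxy : x = y
  · have : (fun x => cutoffKernel K r x y) =ᶠ[𝓝 x] fun _ => 0 := by
      have h1 : ∀ᶠ z in 𝓝 x, z ∈ ball y r := (isOpen_ball.mem_nhds (by simpa [hxy] using hr))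
      filter_upwards [h1] with z hz
      exact cutoffKernel_eq_zero hr (by rwa [mem_ball, dist_eq_norm] at hz)
    exact (continuousAt_congr this).2 continuousAt_const
  · refine ContinuousAt.mul ?_ (hK.continuousAt hω hxy)
    have : Continuous fun x => ((max 0 (min 1 (‖x - y‖ / r - 1)) : ℝ) : 𝕜) :=
      RCLike.continuous_ofReal.comp (by fun_prop)
    exact this.continuousAt

/-- Separate continuity implies joint measurability. The cutoff is needed because the kernel is
arbitrary on the diagonal and may blow up near it. -/
theorem measurable_cutoffKernel (hω : IsDiniModulus ω) (hK : IsSmoothFst K ω)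
    (hK' : IsSmoothFst (fun x y => K y x) ω) {r : ℝ} (hr : 0 < r) :
    Measurable (Function.uncurry (cutoffKernel K r)) := by
  refine measurable_uncurry_of_continuous_of_measurable
    (fun y => continuous_cutoffKernel hω hK hr y) fun x => ?_
  have h := (continuous_cutoffKernel hω hK' hr x).measurable
  have h1 : (fun y => cutoffKernel (fun x y => K y x) r y x) = cutoffKernel K r x := by
    ext y
    simp only [cutoffKernel, norm_sub_rev y x]
  rwa [h1] at h

theorem IsCZKernel.continuousOn_snd (hω : IsDiniModulus ω) (hK : IsCZKernel K C ω) {x : Euc d}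
    {S : Set (Euc d)} (hS : x ∉ S) : ContinuousOn (K x) S := fun _ hy =>
  (hK.isSmoothFst_swap.continuousAt hω (ne_of_mem_of_not_mem hy hS)).continuousWithinAt

theorem IsCZKernel.enorm_le (hd : 1 ≤ d) (hK : IsCZKernel K C ω) {r : ℝ} (hr : 0 < r)
    {x y : Euc d} (h : r ≤ ‖x - y‖) : ‖K x y‖ₑ ≤ ENNReal.ofReal (C / r ^ d) := by
  rw [← ofReal_norm]
  refine ENNReal.ofReal_le_ofReal ((hK.size x y ?_).trans ?_)
  · rintro rfl
    rw [sub_self, norm_zero] at h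
    linarith
  · exact div_le_div_of_nonneg_left (hK.const_nonneg hd) (by positivity)
      (pow_le_pow_left₀ hr.le h d)

theorem IsCZKernel.lintegral_le (hd : 1 ≤ d) (hK : IsCZKernel K C ω) {r : ℝ} (hr : 0 < r)
    {x : Euc d} {S : Set (Euc d)} (hS : MeasurableSet S) (h : ∀ y ∈ S, r ≤ ‖x - y‖)
    (f : Euc d → 𝕜) :
    ∫⁻ y in S, ‖K x y * f y‖ₑ ≤ ENNReal.ofReal (C / r ^ d) * ∫⁻ y in S, ‖f y‖ₑ := by
  rw [← lintegral_const_mul' _ _ ENNReal.ofReal_ne_top]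
  refine setLIntegral_mono' hS fun y hy => ?_
  rw [enorm_mul]
  exact mul_le_mul_left (hK.enorm_le hd hr (h y hy)) _

theorem IsCZKernel.integrableOn (hd : 1 ≤ d) (hω : IsDiniModulus ω) (hK : IsCZKernel K C ω)
    {r : ℝ} (hr : 0 < r) {x : Euc d} {S : Set (Euc d)} (hS : MeasurableSet S)
    (h : ∀ y ∈ S, r ≤ ‖x - y‖) {f : Euc d → 𝕜} (hf : IntegrableOn f S) :
    IntegrableOn (fun y => K x y * f y) S := by
  have hx : x ∉ S := fun hx => by
    have := h x hx
    rw [sub_self, norm_zero] at this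
    linarith
  refine ⟨((hK.continuousOn_snd hω hx).aestronglyMeasurable hS).mul hf.aestronglyMeasurable, ?_⟩
  refine (hK.lintegral_le hd hr hS h f).trans_lt ?_
  exact ENNReal.mul_lt_top ENNReal.ofReal_lt_top hf.hasFiniteIntegral

end Kernel

/-! ### Chebyshev-type bounds -/

theorem measure_lt_le_of_lintegral_le {α : Type*} [MeasurableSpace α] {μ : Measure α}
    {F : α → ℝ≥0∞} (hF : AEMeasurable F μ) {B M s : ℝ≥0∞} (hB : B ≠ ∞) (hs : s ≠ 0)
    (hs' : s ≠ ∞) (h : ∫⁻ x, F x ∂μ ≤ B * M) : μ {x | B * s < F x} ≤ M / s := by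
  -- The constant `B` may vanish; then `F = 0` almost everywhere, and the strict inequality makes
  -- the level set null.
  rcases eq_or_ne B 0 with rfl | hB0
  · rw [zero_mul, nonpos_iff_eq_zero, lintegral_eq_zero_iff' hF] at h
    have : μ {x | 0 * s < F x} = 0 := by
      refine measure_mono_null (fun x hx => ?_) (ae_iff.1 h)
      simp only [zero_mul, mem_ofPred_eq] at hx
      exact hx.ne'
    rw [this]
    exact zero_le
  · have h1 := (mul_meas_ge_le_lintegral₀ hF (B * s)).trans h
    rw [mul_assoc] at h1
    have h2 := (ENNReal.mul_le_mul_iff_right hB0 hB).1 h1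
    rw [ENNReal.le_div_iff_mul_le (Or.inl hs) (Or.inl hs'), mul_comm _ s]
    refine (mul_le_mul_right (measure_mono fun x hx => ?_) _).trans h2
    exact le_of_lt (show B * s < F x from hx)

theorem lintegral_sq_apply_le
    (T : Lp 𝕜 2 (volume : Measure (Euc d)) →L[𝕜] Lp 𝕜 2 (volume : Measure (Euc d)))
    {g : Euc d → 𝕜} (hg : MemLp g 2 volume) :
    ∫⁻ x, ‖T (hg.toLp g) x‖ₑ ^ 2 ≤ ‖T‖ₑ ^ 2 * ∫⁻ x, ‖g x‖ₑ ^ 2 := by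
  have key : ∀ h : Euc d → 𝕜, ∫⁻ x, ‖h x‖ₑ ^ 2 = eLpNorm h 2 volume ^ 2 := fun h => by
    have := eLpNorm_nnreal_pow_eq_lintegral (μ := volume) (f := h) (p := 2) two_ne_zero
    simpa using this.symm
  rw [key, key, ← mul_pow]
  refine pow_le_pow_left' ?_ 2
  rw [← Lp.enorm_def, ← Lp.enorm_toLp hg]
  exact T.le_opENorm _

end SparseCZ

namespace SparseCZ

open Set Filter Topology Metric

variable {d : ℕ} {𝕜 : Type*} [RCLike 𝕜]

/-! ### The Calderón–Zygmund decomposition and the weak type inequality for bounded functions -/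

theorem volume_closedBall_eq (x : Euc d) {r : ℝ} (hr : 0 < r) :
    volume (closedBall x r) = volume (ball (0 : Euc d) 1) * ENNReal.ofReal (r ^ d) := by
  rw [Measure.addHaar_closedBall _ _ hr.le, finrank_euclideanSpace_fin, mul_comm]

theorem sqrt_mul_side_pos (hd : 1 ≤ d) (P : DyadicIndex d) : 0 < Real.sqrt d * side P :=
  mul_pos (Real.sqrt_pos.2 (by exact_mod_cast hd)) (side_pos P)

/-! ### Cancellation away from the dilated cubes -/

section Bad

variable {K : Euc d → Euc d → 𝕜} {C : ℝ} {ω : ℝ → ℝ}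

theorem kernel_eq_cutoffKernel (hd : 1 ≤ d) {P : DyadicIndex d} {x y : Euc d} (hx : x ∈ (dil P)ᶜ)
    (hy : y ∈ cube P) : K x y = cutoffKernel K (side P) x y := by
  refine (cutoffKernel_eq (side_pos P) ?_).symm
  have h := sqrt_lt_norm_sub_of_notMem_dil hy hx
  have h1 : (1 : ℝ) ≤ Real.sqrt d := Real.one_le_sqrt.2 (by exact_mod_cast hd)
  rw [norm_sub_rev]
  nlinarith [mul_le_mul_of_nonneg_right h1 (side_pos P).le]

/-- Hörmander's condition: the oscillation estimate with source `g = 1`, whose integrals over balls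
are exactly the unit ball volume times r^d. -/
theorem lintegral_compl_dil_sub_le (hd : 1 ≤ d) (hω : IsDiniModulus ω) (hK : IsCZKernel K C ω)
    {P : DyadicIndex d} {c y : Euc d} (hc : c ∈ cube P) (hy : y ∈ cube P) :
    ∫⁻ x in (dil P)ᶜ, ‖K x y - K x c‖ₑ ≤
      2 ^ (d + 1) * volume (ball (0 : Euc d) 1) * ENNReal.ofReal (diniConst ω) := by
  have hosc := hK.isSmoothFst_swap.lintegral_sub_le hω (sqrt_mul_side_pos hd P)
    (norm_sub_le_of_mem_cube hy hc) (g := fun _ => 1)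
    (s := volume (ball (0 : Euc d) 1)) (fun ρ hρ => by
      rw [setLIntegral_one, volume_closedBall_eq _ hρ])
  simp only [mul_one] at hosc
  exact (lintegral_mono_set fun x hx => sqrt_lt_norm_sub_of_notMem_dil hy hx).trans hosc

theorem aemeasurable_cutoffKernel_sub_mul (hω : IsDiniModulus ω) (hK : IsCZKernel K C ω)
    (P : DyadicIndex d) (c : Euc d) {φ : Euc d → 𝕜} (hφ : AEStronglyMeasurable φ volume) :
    AEMeasurable (fun z : Euc d × Euc d =>
      ‖cutoffKernel K (side P) z.1 z.2 - cutoffKernel K (side P) z.1 c‖ₑ * ‖φ z.2‖ₑ)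
      ((volume.restrict (dil P)ᶜ).prod (volume.restrict (cube P))) := by
  have hmeas : Measurable (Function.uncurry (cutoffKernel K (side P))) :=
    measurable_cutoffKernel hω hK.isSmoothFst hK.isSmoothFst_swap (side_pos P)
  have hmeas_c : Measurable fun x => cutoffKernel K (side P) x c := hmeas.of_uncurry_right
  have m1 : AEMeasurable (fun z : Euc d × Euc d =>
      ‖cutoffKernel K (side P) z.1 z.2 - cutoffKernel K (side P) z.1 c‖ₑ)
      ((volume.restrict (dil P)ᶜ).prod (volume.restrict (cube P))) :=
    (hmeas.sub (hmeas_c.comp measurable_fst)).enorm.aemeasurable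
  exact m1.mul hφ.restrict.comp_snd.enorm

theorem kernel_sub_mul_eq (hd : 1 ≤ d) {P : DyadicIndex d} {c : Euc d} (hc : c ∈ cube P)
    (φ : Euc d → 𝕜) {x y : Euc d} (hy : y ∈ cube P) (hx : x ∈ (dil P)ᶜ) :
    ‖K x y - K x c‖ₑ * ‖φ y‖ₑ =
      ‖cutoffKernel K (side P) x y - cutoffKernel K (side P) x c‖ₑ * ‖φ y‖ₑ := by
  rw [kernel_eq_cutoffKernel (K := K) hd hx hy, kernel_eq_cutoffKernel (K := K) hd hx hc]

theorem aemeasurable_lintegral_kernel_sub (hd : 1 ≤ d) (hω : IsDiniModulus ω)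
    (hK : IsCZKernel K C ω) {P : DyadicIndex d} {c : Euc d} (hc : c ∈ cube P) {φ : Euc d → 𝕜}
    (hφ : AEStronglyMeasurable φ volume) :
    AEMeasurable (fun x => ∫⁻ y in cube P, ‖K x y - K x c‖ₑ * ‖φ y‖ₑ)
      (volume.restrict (dil P)ᶜ) := by
  refine (aemeasurable_cutoffKernel_sub_mul hω hK P c hφ).lintegral_prod_right'.congr ?_
  filter_upwards [ae_restrict_mem (measurableSet_dil P).compl] with x hx
  exact (setLIntegral_congr_fun (measurableSet_cube P)
    fun y hy => kernel_sub_mul_eq hd hc φ hy hx).symm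

/-- Tonelli and Hörmander's condition. For joint measurability the kernel is replaced by its cutoff,
which coincides with it on the product of `(dil P)ᶜ` and `cube P`. -/
theorem lintegral_compl_dil_le (hd : 1 ≤ d) (hω : IsDiniModulus ω) (hK : IsCZKernel K C ω)
    {P : DyadicIndex d} {c : Euc d} (hc : c ∈ cube P) {φ : Euc d → 𝕜}
    (hφ : AEStronglyMeasurable φ volume) :
    ∫⁻ x in (dil P)ᶜ, ∫⁻ y in cube P, ‖K x y - K x c‖ₑ * ‖φ y‖ₑ ≤
      2 ^ (d + 1) * volume (ball (0 : Euc d) 1) * ENNReal.ofReal (diniConst ω) *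
        ∫⁻ y in cube P, ‖φ y‖ₑ := by
  have e2 : ∫⁻ x in (dil P)ᶜ, ∫⁻ y in cube P, ‖K x y - K x c‖ₑ * ‖φ y‖ₑ =
      ∫⁻ x in (dil P)ᶜ, ∫⁻ y in cube P,
        ‖cutoffKernel K (side P) x y - cutoffKernel K (side P) x c‖ₑ * ‖φ y‖ₑ :=
    setLIntegral_congr_fun (measurableSet_dil P).compl fun x hx =>
      setLIntegral_congr_fun (measurableSet_cube P) fun y hy => kernel_sub_mul_eq hd hc φ hy hx
  rw [e2, lintegral_lintegral_swap (aemeasurable_cutoffKernel_sub_mul hω hK P c hφ),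
    ← lintegral_const_mul' _ _ (ENNReal.mul_ne_top
      (ENNReal.mul_ne_top (by finiteness) measure_ball_lt_top.ne) ENNReal.ofReal_ne_top)]
  refine setLIntegral_mono' (measurableSet_cube P) fun y hy => ?_
  rw [← setLIntegral_congr_fun (measurableSet_dil P).compl
    fun x hx => kernel_sub_mul_eq (K := K) hd hc φ hy hx, lintegral_mul_const' _ _ enorm_ne_top]
  exact mul_le_mul_left (lintegral_compl_dil_sub_le hd hω hK hc hy) _

theorem side_le_norm_sub (hd : 1 ≤ d) {P : DyadicIndex d} {x y : Euc d} (hx : x ∉ dil P)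
    (hy : y ∈ cube P) : side P ≤ ‖x - y‖ := by
  by_contra h
  push Not at h
  refine hx (closedBall_subset_dil hd hy (r := side P) (by linarith [side_pos P]) ?_)
  rw [mem_closedBall, dist_eq_norm]
  exact h.le

/-- As `φ` has mean zero on the cube, the constant `K x c` may be subtracted from the kernel. -/
theorem enorm_integral_kernel_le (hd : 1 ≤ d) (hω : IsDiniModulus ω) (hK : IsCZKernel K C ω)
    {P : DyadicIndex d} {c x : Euc d} (hx : x ∉ dil P) {φ : Euc d → 𝕜}
    (hφ : IntegrableOn φ (cube P)) (h0 : ∫ y in cube P, φ y = 0) :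
    ‖∫ y in cube P, K x y * φ y‖ₑ ≤ ∫⁻ y in cube P, ‖K x y - K x c‖ₑ * ‖φ y‖ₑ := by
  have h1 : IntegrableOn (fun y => K x y * φ y) (cube P) :=
    hK.integrableOn hd hω (side_pos P) (measurableSet_cube P)
      (fun y hy => side_le_norm_sub hd hx hy) hφ
  have h2 : ∫ y in cube P, K x y * φ y = ∫ y in cube P, (K x y - K x c) * φ y := by
    simp_rw [sub_mul]
    rw [integral_sub h1 (hφ.const_mul _), integral_const_mul, h0, mul_zero, sub_zero]
  rw [h2]
  refine (enorm_integral_le_lintegral_enorm _).trans (le_of_eq ?_)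
  simp_rw [enorm_mul]

end Bad

/-- The bad part of a Calderón–Zygmund decomposition over finitely many dyadic cubes. -/
noncomputable def badPart (f : Euc d → 𝕜) (t : Finset (DyadicIndex d)) (x : Euc d) : 𝕜 :=
  ∑ P ∈ t, (cube P).indicator (fun y => f y - ⨍ z in cube P, f z) x

/-- The comparability constant between a dyadic cube and a ball containing its parent. -/
noncomputable def ballConst (d : ℕ) : ℝ≥0∞ := ENNReal.ofReal (2 * Real.sqrt d) ^ d

/-- The parent of a stopping cube is not heavy, so it contains a point outside `O`. The ball around
that point whose radius is the diameter of the parent contains the cube, and its average is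
controlled. -/
theorem lintegral_cube_le_of_mem_stopping (hd : 1 ≤ d) {O : Set (Euc d)}
    {P : DyadicIndex d} (hP : P ∈ stopping O) {g : Euc d → ℝ≥0∞} {s : ℝ≥0∞}
    (hO : maximalSet g s ⊆ O) : ∫⁻ y in cube P, g y ≤ ballConst d * s * volume (cube P) := by
  have hex : ∃ x ∈ cube (parent P), x ∉ O := by
    by_contra hn
    push Not at hn
    exact not_isHeavy_parent hP (isHeavy_of_subset hn)
  obtain ⟨x, hx, hxO⟩ := hex
  have h1 := lintegral_closedBall_le_of_notMem_maximalSet (fun h => hxO (hO h))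
    (Real.sqrt d * side (parent P)) (sqrt_mul_side_pos hd _)
  refine le_trans (lintegral_mono_set fun y hy => ?_) (h1.trans (le_of_eq ?_))
  · rw [mem_closedBall, dist_eq_norm]
    exact norm_sub_le_of_mem_cube (cube_subset_cube_parent P hy) hx
  · rw [side_parent, volume_cube, ballConst, mul_comm s, mul_right_comm, ← mul_pow,
      ← ENNReal.ofReal_mul (by positivity), ENNReal.ofReal_pow (by
        have := side_pos P
        positivity)]
    congr 3
    ring

theorem enorm_setAverage_cube_le (f : Euc d → 𝕜) (P : DyadicIndex d) {a : ℝ≥0∞}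
    (h : ∫⁻ y in cube P, ‖f y‖ₑ ≤ a * volume (cube P)) : ‖⨍ y in cube P, f y‖ₑ ≤ a := by
  have hv0 := volume_cube_ne_zero P
  have hv := volume_cube_ne_top P
  have h1 := enorm_integral_le_lintegral_enorm (μ := volume.restrict (cube P)) f
  rw [setAverage_eq, enorm_smul]
  have h2 : ‖(volume.real (cube P))⁻¹‖ₑ = (volume (cube P))⁻¹ := by
    rw [Real.enorm_eq_ofReal (by positivity), measureReal_def,
      ENNReal.ofReal_inv_of_pos (ENNReal.toReal_pos hv0 hv), ENNReal.ofReal_toReal hv]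
  rw [h2, mul_comm, ← div_eq_mul_inv, ENNReal.div_le_iff hv0 hv]
  exact h1.trans h

theorem badPart_of_mem {f : Euc d → 𝕜} {t : Finset (DyadicIndex d)}
    (ht : (t : Set (DyadicIndex d)).PairwiseDisjoint cube) {P : DyadicIndex d} (hP : P ∈ t)
    {x : Euc d} (hx : x ∈ cube P) : badPart f t x = f x - ⨍ z in cube P, f z := by
  rw [badPart, Finset.sum_eq_single_of_mem P hP, indicator_of_mem hx]
  intro R hR hne
  exact indicator_of_notMem (fun hxR => Set.disjoint_left.1 (ht hR hP hne) hxR hx) _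

theorem badPart_of_notMem {f : Euc d → 𝕜} {t : Finset (DyadicIndex d)} {x : Euc d}
    (hx : ∀ P ∈ t, x ∉ cube P) : badPart f t x = 0 :=
  Finset.sum_eq_zero fun P hP => indicator_of_notMem (hx P hP) _

/-- Only finitely many stopping cubes are used, so that the bad part is a finite sum with compact
support. On the discarded cubes `f` stays in the good part; their total L² mass is made smaller than
`s * N`. -/
theorem exists_decomposition (hd : 1 ≤ d) {f : Euc d → 𝕜} (hf1 : MemLp f 1 volume)
    (hf2 : MemLp f 2 volume) {s : ℝ≥0∞} (hs : s ≠ 0) (hs' : s ≠ ∞)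
    (hN : ∫⁻ x, ‖f x‖ₑ ≠ 0) :
    ∃ t : Finset (DyadicIndex d), (t : Set (DyadicIndex d)).PairwiseDisjoint cube ∧
      ∑ P ∈ t, volume (cube P) ≤ 2 ^ (d + 1) * (2 + maximalConst d) * ((∫⁻ x, ‖f x‖ₑ) / s) ∧
      ∫⁻ x, ‖f x - badPart f t x‖ₑ ^ 2 ≤
        s * (∫⁻ x, ‖f x‖ₑ) * (ballConst d ^ 2 * (2 ^ (d + 1) * (2 + maximalConst d)) + 2) := by
  classical
  set N := ∫⁻ x, ‖f x‖ₑ with hNdef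
  have hNtop : N ≠ ∞ := (memLp_one_iff_integrable.1 hf1).hasFiniteIntegral.ne
  -- Including the level set of `f` itself gives `|f| ≤ s` off the cubes without Lebesgue
  -- differentiation.
  set E : Set (Euc d) := {x | s < ‖f x‖ₑ} ∪ maximalSet (fun x => ‖f x‖ₑ) s with hE
  have hNs : N / s ≠ 0 := (ENNReal.div_pos hN hs').ne'
  have hNs' : N / s ≠ ∞ := ENNReal.div_ne_top hNtop hs
  have hEvol : volume E ≤ (1 + maximalConst d) * (N / s) := by
    refine (measure_union_le _ _).trans ?_
    rw [add_mul, one_mul]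
    refine add_le_add ?_ (volume_maximalSet_le hd hNtop hs hs')
    have := measure_lt_le_of_lintegral_le (μ := volume) hf1.aestronglyMeasurable.enorm
      ENNReal.one_ne_top hs hs' (one_mul N).ge
    simpa using this
  obtain ⟨O, hEO, hOo, hOvol⟩ := E.exists_isOpen_le_add volume hNs
  have hOvol' : volume O ≤ (2 + maximalConst d) * (N / s) := by
    refine hOvol.trans ((add_le_add_left hEvol _).trans (le_of_eq ?_))
    ring
  have hOtop : volume O ≠ ∞ := ne_top_of_le_ne_top (ENNReal.mul_ne_top
    (by simp [maximalConst_ne_top]) hNs') hOvol'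
  have hsum : ∑' P : stopping O, volume (cube (P : DyadicIndex d)) ≤
      2 ^ (d + 1) * (2 + maximalConst d) * (N / s) := by
    refine (tsum_volume_stopping_le hOo.measurableSet).trans ?_
    rw [mul_assoc]
    exact mul_le_mul_right hOvol' _
  have hsq : ∫⁻ x, ‖f x‖ₑ ^ 2 ≠ ∞ := by
    have := (lintegral_rpow_enorm_lt_top_of_eLpNorm_lt_top two_ne_zero ENNReal.ofNat_ne_top
      hf2.eLpNorm_lt_top).ne
    simpa using this
  have hsumsq : ∑' P : stopping O, ∫⁻ x in cube (P : DyadicIndex d), ‖f x‖ₑ ^ 2 ≠ ∞ := by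
    rw [← lintegral_iUnion (s := fun P : stopping O => cube (P : DyadicIndex d))
      (fun P => measurableSet_cube _)
      (fun P P' hne => stopping_pairwiseDisjoint O P.2 P'.2 (Subtype.coe_injective.ne hne))]
    exact ne_top_of_le_ne_top hsq (setLIntegral_le_lintegral _ _)
  have hsN : s * N ≠ 0 := mul_ne_zero hs hN
  -- This uses `f ∈ L²`: the tail of the convergent sum of local L² masses tends to zero.
  obtain ⟨t, ht⟩ := ((ENNReal.tendsto_tsum_compl_atTop_zero hsumsq).eventually_lt_const
    (pos_iff_ne_zero.2 hsN)).exists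
  set t' : Finset (DyadicIndex d) := t.map (Function.Embedding.subtype _) with ht'
  have hmem : ∀ P ∈ t', P ∈ stopping O := fun P hP => by
    obtain ⟨R, -, rfl⟩ := Finset.mem_map.1 hP
    exact R.2
  have hdisj : (t' : Set (DyadicIndex d)).PairwiseDisjoint cube :=
    (stopping_pairwiseDisjoint O).subset fun P hP => hmem P hP
  have htsum : ∑ P ∈ t', volume (cube P) ≤ 2 ^ (d + 1) * (2 + maximalConst d) * (N / s) := by
    rw [ht', Finset.sum_map]
    exact (ENNReal.sum_le_tsum t).trans hsum
  refine ⟨t', hdisj, htsum, ?_⟩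
  have havg : ∀ P ∈ t', ‖⨍ y in cube P, f y‖ₑ ≤ ballConst d * s := fun P hP =>
    enorm_setAverage_cube_le f P (lintegral_cube_le_of_mem_stopping hd (hmem P hP)
      (subset_union_right.trans hEO))
  set U : Set (Euc d) := ⋃ P ∈ t', cube P with hU
  have hUm : MeasurableSet U := Finset.measurableSet_biUnion _ fun P _ => measurableSet_cube P
  have hin : ∫⁻ x in U, ‖f x - badPart f t' x‖ₑ ^ 2 ≤
      s * N * (ballConst d ^ 2 * (2 ^ (d + 1) * (2 + maximalConst d))) := by
    calc ∫⁻ x in U, ‖f x - badPart f t' x‖ₑ ^ 2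
        ≤ ∫⁻ _ in U, (ballConst d * s) ^ 2 := by
          refine setLIntegral_mono' hUm fun x hx => pow_le_pow_left' ?_ 2
          obtain ⟨P, hP, hxP⟩ := mem_iUnion₂.1 hx
          rw [badPart_of_mem hdisj hP hxP, sub_sub_cancel]
          exact havg P hP
      _ = (ballConst d * s) ^ 2 * volume U := setLIntegral_const _ _
      _ ≤ (ballConst d * s) ^ 2 * (2 ^ (d + 1) * (2 + maximalConst d) * (N / s)) :=
          mul_le_mul_right ((measure_biUnion_finset_le _ _).trans htsum) _
      _ = s * (N / s) * s * (ballConst d ^ 2 * (2 ^ (d + 1) * (2 + maximalConst d))) := by ring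
      _ = _ := by rw [ENNReal.mul_div_cancel hs hs', mul_comm N]
  have hout : ∫⁻ x in Uᶜ, ‖f x - badPart f t' x‖ₑ ^ 2 ≤ s * N * 2 := by
    have hcov : Uᶜ ⊆ (⋃ P : {P // P ∉ t}, cube ((P : stopping O) : DyadicIndex d)) ∪ Oᶜ := by
      intro x hx
      by_cases hxO : x ∈ O
      · left
        obtain ⟨P, hP, hxP⟩ := exists_mem_stopping_of_mem hd hOo hOtop hxO
        refine mem_iUnion.2 ⟨⟨⟨P, hP⟩, fun hPt => hx (mem_iUnion₂.2 ⟨P, ?_, hxP⟩)⟩, hxP⟩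
        exact Finset.mem_map.2 ⟨⟨P, hP⟩, hPt, rfl⟩
      · exact Or.inr hxO
    calc ∫⁻ x in Uᶜ, ‖f x - badPart f t' x‖ₑ ^ 2 = ∫⁻ x in Uᶜ, ‖f x‖ₑ ^ 2 := by
          refine setLIntegral_congr_fun hUm.compl fun x hx => ?_
          have hx' : ∀ P ∈ t', x ∉ cube P := fun P hP hxP => hx (mem_iUnion₂.2 ⟨P, hP, hxP⟩)
          simp only [badPart_of_notMem hx', sub_zero]
      _ ≤ ∫⁻ x in (⋃ P : {P // P ∉ t}, cube ((P : stopping O) : DyadicIndex d)) ∪ Oᶜ,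
            ‖f x‖ₑ ^ 2 := lintegral_mono_set hcov
      _ ≤ (∫⁻ x in ⋃ P : {P // P ∉ t}, cube ((P : stopping O) : DyadicIndex d), ‖f x‖ₑ ^ 2) +
            ∫⁻ x in Oᶜ, ‖f x‖ₑ ^ 2 := lintegral_union_le _ _ _
      _ ≤ s * N + s * N := by
          refine add_le_add ((lintegral_iUnion_le _ _).trans ht.le) ?_
          rw [hNdef, ← lintegral_const_mul' _ _ hs']
          refine le_trans ?_ (setLIntegral_le_lintegral Oᶜ _)
          refine setLIntegral_mono' hOo.measurableSet.compl fun x hx => ?_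
          rw [pow_two]
          refine mul_le_mul_left ?_ _
          exact not_lt.1 fun h => hx (hEO (Or.inl h))
      _ = s * N * 2 := by ring
  rw [← lintegral_add_compl _ hUm, mul_add]
  exact add_le_add hin hout

end SparseCZ

namespace SparseCZ

open Set Filter Topology Metric

variable {d : ℕ} {𝕜 : Type*} [RCLike 𝕜]

/-! ### The weak type inequality on bounded functions -/

theorem isBounded_cube (P : DyadicIndex d) : Bornology.IsBounded (cube P) := by
  obtain ⟨x, hx⟩ := cube_nonempty P
  refine (isBounded_iff_subset_closedBall x).2 ⟨Real.sqrt d * side P, fun y hy => ?_⟩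
  rw [mem_closedBall, dist_eq_norm]
  exact norm_sub_le_of_mem_cube hy hx

theorem memLp_badPart {f : Euc d → 𝕜} {p : ℝ≥0∞} (hf : MemLp f p volume)
    (t : Finset (DyadicIndex d)) : MemLp (badPart f t) p volume := by
  unfold badPart
  refine memLp_finsetSum t fun P _ => ?_
  have h := (hf.indicator (measurableSet_cube P)).sub (memLp_indicator_const p
    (measurableSet_cube P) (⨍ z in cube P, f z) (Or.inr (volume_cube_ne_top P)))
  rwa [← indicator_sub'] at h

theorem tsupport_badPart_subset (f : Euc d → 𝕜) (t : Finset (DyadicIndex d)) :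
    tsupport (badPart f t) ⊆ ⋃ P ∈ t, closure (cube P) := by
  refine closure_minimal (fun x hx => ?_)
    (t.finite_toSet.isClosed_biUnion fun P _ => isClosed_closure)
  by_contra hn
  refine hx (badPart_of_notMem fun P hP hxP => hn ?_)
  exact mem_iUnion₂.2 ⟨P, hP, subset_closure hxP⟩

theorem hasCompactSupport_badPart (f : Euc d → 𝕜) (t : Finset (DyadicIndex d)) :
    HasCompactSupport (badPart f t) :=
  (t.finite_toSet.isCompact_biUnion fun P _ =>
    (isBounded_cube P).isCompact_closure).of_isClosed_subset (isClosed_tsupport _)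
    (tsupport_badPart_subset f t)

section

variable {K : Euc d → Euc d → 𝕜} {C : ℝ} {ω : ℝ → ℝ}

theorem enorm_integral_badPart_le (hd : 1 ≤ d) (hω : IsDiniModulus ω) (hK : IsCZKernel K C ω)
    {f : Euc d → 𝕜} (hf : MemLp f 1 volume) (t : Finset (DyadicIndex d))
    {c : DyadicIndex d → Euc d} {x : Euc d} (hx : ∀ P ∈ t, x ∉ dil P) :
    ‖∫ y, K x y * badPart f t y‖ₑ ≤
      ∑ P ∈ t, ∫⁻ y in cube P, ‖K x y - K x (c P)‖ₑ * ‖f y - ⨍ z in cube P, f z‖ₑ := by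
  have hφ : ∀ P : DyadicIndex d, IntegrableOn (fun y => f y - ⨍ z in cube P, f z) (cube P) :=
    fun P => (memLp_one_iff_integrable.1 hf).integrableOn.sub
      (integrableOn_const (volume_cube_ne_top P))
  have h1 : ∀ y, K x y * badPart f t y =
      ∑ P ∈ t, (cube P).indicator (fun y => K x y * (f y - ⨍ z in cube P, f z)) y := fun y => by
    rw [badPart, Finset.mul_sum]
    refine Finset.sum_congr rfl fun P _ => ?_
    by_cases hy : y ∈ cube P <;> simp [hy]
  have h2 : ∫ y, K x y * badPart f t y =
      ∑ P ∈ t, ∫ y in cube P, K x y * (f y - ⨍ z in cube P, f z) := by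
    simp_rw [h1]
    rw [integral_finsetSum]
    · exact Finset.sum_congr rfl fun P _ => integral_indicator (measurableSet_cube P)
    · intro P hP
      rw [integrable_indicator_iff (measurableSet_cube P)]
      exact hK.integrableOn hd hω (side_pos P) (measurableSet_cube P)
        (fun y hy => side_le_norm_sub hd (hx P hP) hy) (hφ P)
  rw [h2]
  refine (enorm_sum_le _ _).trans (Finset.sum_le_sum fun P hP => ?_)
  exact enorm_integral_kernel_le hd hω hK (hx P hP) (hφ P)
    (setAverage_sub_setAverage (volume_cube_ne_top P) f)

theorem lintegral_sub_setAverage_le (f : Euc d → 𝕜) (P : DyadicIndex d) :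
    ∫⁻ y in cube P, ‖f y - ⨍ z in cube P, f z‖ₑ ≤ 2 * ∫⁻ y in cube P, ‖f y‖ₑ := by
  have hv0 := volume_cube_ne_zero P
  have hv := volume_cube_ne_top P
  have havg := enorm_setAverage_cube_le f P (a := (∫⁻ y in cube P, ‖f y‖ₑ) / volume (cube P))
    (by rw [ENNReal.div_mul_cancel hv0 hv])
  calc ∫⁻ y in cube P, ‖f y - ⨍ z in cube P, f z‖ₑ
      ≤ ∫⁻ y in cube P, (‖f y‖ₑ + ‖⨍ z in cube P, f z‖ₑ) :=
        lintegral_mono fun y => enorm_sub_le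
    _ = (∫⁻ y in cube P, ‖f y‖ₑ) + ‖⨍ z in cube P, f z‖ₑ * volume (cube P) := by
        rw [lintegral_add_right _ measurable_const, setLIntegral_const]
    _ ≤ (∫⁻ y in cube P, ‖f y‖ₑ) + ∫⁻ y in cube P, ‖f y‖ₑ := by
        refine add_le_add_right ((mul_le_mul_left havg _).trans ?_) _
        rw [ENNReal.div_mul_cancel hv0 hv]
    _ = _ := (two_mul _).symm

/-- The constant in the weak type inequality. -/
noncomputable def weakConst (d : ℕ) : ℝ≥0∞ :=
  (ballConst d ^ 2 * (2 ^ (d + 1) * (2 + maximalConst d)) + 2) +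
    (ENNReal.ofReal (dilFactor d) ^ d * (2 ^ (d + 1) * (2 + maximalConst d)) +
      2 ^ (d + 2) * volume (ball (0 : Euc d) 1))

theorem weakConst_ne_top : weakConst d ≠ ∞ := by
  have h1 := maximalConst_ne_top (d := d)
  have h2 : volume (ball (0 : Euc d) 1) ≠ ∞ := measure_ball_lt_top.ne
  unfold weakConst ballConst
  finiteness

/-- The good part is estimated by the L² bound and Chebyshev at level `(B * s) ^ 2`, the bad part by
cancellation outside the dilates, and the dilates by their measure. Boundedness of `f` makes the bad
part bounded, so the kernel representation applies to it. The representation holds off the dilates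
because closures of the cubes lie inside them. -/
theorem weakType_of_bounded (hd : 1 ≤ d)
    {T : Lp 𝕜 2 (volume : Measure (Euc d)) →L[𝕜] Lp 𝕜 2 (volume : Measure (Euc d))}
    (hω : IsDiniModulus ω) (hK : IsCZKernel K C ω) (hT : HasKernel T K) {B : ℝ≥0∞}
    (hBtop : B ≠ ∞) (hBω : ENNReal.ofReal (diniConst ω) ≤ B) (hBT : ‖T‖ₑ ≤ B)
    {f : Euc d → 𝕜} (hfb : MemLp f ∞ volume) (hf1 : MemLp f 1 volume)
    (hf2 : MemLp f 2 volume) {s : ℝ≥0∞} (hs : s ≠ 0) (hs' : s ≠ ∞) :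
    volume {x | 2 * B * s < ‖T (hf2.toLp f) x‖ₑ} ≤ weakConst d * ((∫⁻ x, ‖f x‖ₑ) / s) := by
  set N := ∫⁻ x, ‖f x‖ₑ with hNdef
  have hNtop : N ≠ ∞ := (memLp_one_iff_integrable.1 hf1).hasFiniteIntegral.ne
  by_cases hN : N = 0
  · have hf0 : f =ᵐ[volume] 0 := by
      rw [hNdef, lintegral_eq_zero_iff' hf1.aestronglyMeasurable.enorm] at hN
      filter_upwards [hN] with x hx
      simpa using hx
    have h0 : hf2.toLp f = 0 := (MemLp.toLp_eq_toLp_iff hf2 MemLp.zero).2 hf0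
    have : volume {x | 2 * B * s < ‖T (hf2.toLp f) x‖ₑ} = 0 := by
      rw [h0, map_zero]
      refine measure_mono_null (fun x hx => ?_) (ae_iff.1 (Lp.coeFn_zero 𝕜 2 volume))
      intro h
      simp only [mem_ofPred_eq] at hx
      rw [h] at hx
      simp at hx
    rw [this]
    exact zero_le
  obtain ⟨t, hdisj, hvol, hgood⟩ := exists_decomposition hd hf1 hf2 hs hs' hN
  set b := badPart f t with hb
  have hb2 : MemLp b 2 volume := memLp_badPart hf2 t
  have hg2 : MemLp (f - b) 2 volume := hf2.sub hb2
  have hsplit : T (hf2.toLp f) = T (hg2.toLp (f - b)) + T (hb2.toLp b) := by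
    rw [← map_add, ← MemLp.toLp_add]
    simp
  set U : Set (Euc d) := ⋃ P ∈ t, dil P with hU
  have hUm : MeasurableSet U := Finset.measurableSet_biUnion _ fun P _ => measurableSet_dil P
  have hUvol : volume U ≤
      ENNReal.ofReal (dilFactor d) ^ d * (2 ^ (d + 1) * (2 + maximalConst d)) * (N / s) := by
    refine (measure_biUnion_finset_le _ _).trans ?_
    simp_rw [volume_dil]
    rw [← Finset.mul_sum, mul_assoc]
    exact mul_le_mul_right hvol _
  have hgoodvol : volume {x | B * s < ‖T (hg2.toLp (f - b)) x‖ₑ} ≤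
      (ballConst d ^ 2 * (2 ^ (d + 1) * (2 + maximalConst d)) + 2) * (N / s) := by
    have h1 := (lintegral_sq_apply_le T hg2).trans
      (mul_le_mul' (pow_le_pow_left' hBT 2) hgood)
    have h2 := measure_lt_le_of_lintegral_le (μ := volume) (s := s ^ 2)
      ((Lp.aestronglyMeasurable (T (hg2.toLp (f - b)))).enorm.pow_const 2)
      (ENNReal.pow_ne_top hBtop) (pow_ne_zero 2 hs) (ENNReal.pow_ne_top hs') h1
    refine (measure_mono fun x hx => ?_).trans (h2.trans (le_of_eq ?_))
    · rw [mem_ofPred_eq, ← mul_pow]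
      exact (ENNReal.pow_right_strictMono two_ne_zero) hx
    · rw [pow_two s, mul_assoc s N, ENNReal.mul_div_mul_left _ _ hs hs', mul_comm N, mul_div_assoc]
  have hbad : ∀ᵐ x ∂(volume : Measure (Euc d)), x ∉ U → ‖T (hb2.toLp b) x‖ₑ ≤
      ∑ P ∈ t, ∫⁻ y in cube P,
        ‖K x y - K x (cube_nonempty P).some‖ₑ * ‖f y - ⨍ z in cube P, f z‖ₑ := by
    filter_upwards [hT b hb2 (memLp_badPart hfb t) (hasCompactSupport_badPart f t)] with x hx hxU
    have hxP : ∀ P ∈ t, x ∉ dil P := fun P hP hxP => hxU (mem_iUnion₂.2 ⟨P, hP, hxP⟩)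
    rw [hx fun h => ?_]
    · exact enorm_integral_badPart_le hd hω hK hf1 t hxP
    · obtain ⟨P, hP, hxP'⟩ := mem_iUnion₂.1 (tsupport_badPart_subset f t h)
      exact hxP P hP (closure_cube_subset_dil hd P hxP')
  have hbadint : ∫⁻ x in Uᶜ, ‖T (hb2.toLp b) x‖ₑ ≤
      B * (2 ^ (d + 2) * volume (ball (0 : Euc d) 1) * N) := by
    calc ∫⁻ x in Uᶜ, ‖T (hb2.toLp b) x‖ₑ
        ≤ ∫⁻ x in Uᶜ, ∑ P ∈ t, ∫⁻ y in cube P,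
            ‖K x y - K x (cube_nonempty P).some‖ₑ * ‖f y - ⨍ z in cube P, f z‖ₑ :=
          setLIntegral_mono_ae' hUm.compl hbad
      _ ≤ ∑ P ∈ t, ∫⁻ x in Uᶜ, ∫⁻ y in cube P,
            ‖K x y - K x (cube_nonempty P).some‖ₑ * ‖f y - ⨍ z in cube P, f z‖ₑ := by
          rw [lintegral_finsetSum']
          intro P hP
          exact (aemeasurable_lintegral_kernel_sub hd hω hK (cube_nonempty P).some_mem
            (hf1.aestronglyMeasurable.sub aestronglyMeasurable_const)).mono_measure
            (Measure.restrict_mono (compl_subset_compl.2 (subset_biUnion_of_mem hP)) le_rfl)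
      _ ≤ ∑ P ∈ t, (2 ^ (d + 1) * volume (ball (0 : Euc d) 1) * B) *
            (2 * ∫⁻ y in cube P, ‖f y‖ₑ) := by
          refine Finset.sum_le_sum fun P hP => ?_
          refine (lintegral_mono_set (t := (dil P)ᶜ)
            (compl_subset_compl.2 (subset_biUnion_of_mem hP))).trans ?_
          refine (lintegral_compl_dil_le hd hω hK (cube_nonempty P).some_mem
            (hf1.aestronglyMeasurable.sub aestronglyMeasurable_const)).trans ?_
          exact mul_le_mul' (mul_le_mul_right hBω _) (lintegral_sub_setAverage_le f P)
      _ = B * (2 ^ (d + 2) * volume (ball (0 : Euc d) 1) * ∑ P ∈ t, ∫⁻ y in cube P, ‖f y‖ₑ) := by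
          rw [← Finset.mul_sum, ← Finset.mul_sum]
          ring
      _ ≤ _ := by
          refine mul_le_mul_right (mul_le_mul_right ?_ _) _
          rw [← lintegral_biUnion_finset hdisj fun P _ => measurableSet_cube P]
          exact setLIntegral_le_lintegral _ _
  have hbadvol : volume ({x | B * s < ‖T (hb2.toLp b) x‖ₑ} ∩ Uᶜ) ≤
      2 ^ (d + 2) * volume (ball (0 : Euc d) 1) * (N / s) := by
    have h1 := measure_lt_le_of_lintegral_le
      (Lp.aestronglyMeasurable (T (hb2.toLp b))).enorm.restrict hBtop hs hs' hbadint
    rw [Measure.restrict_apply' hUm.compl, mul_div_assoc] at h1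
    exact h1
  have hcov : {x | 2 * B * s < ‖T (hf2.toLp f) x‖ₑ} ≤ᵐ[volume]
      ({x | B * s < ‖T (hg2.toLp (f - b)) x‖ₑ} ∪
        (U ∪ ({x | B * s < ‖T (hb2.toLp b) x‖ₑ} ∩ Uᶜ)) : Set (Euc d)) := by
    filter_upwards [Lp.coeFn_add (T (hg2.toLp (f - b))) (T (hb2.toLp b))] with x hx hx2
    have hx2 : 2 * B * s < ‖T (hf2.toLp f) x‖ₑ := hx2
    rw [hsplit, hx, Pi.add_apply] at hx2
    change _ ∨ _ ∨ _ ∧ _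
    by_contra hn
    push Not at hn
    obtain ⟨h1, h2, h3⟩ := hn
    have h3' : ¬ B * s < ‖T (hb2.toLp b) x‖ₑ := fun h => h3 h h2
    refine absurd hx2 (not_lt.2 ((enorm_add_le _ _).trans ?_))
    refine (add_le_add (not_lt.1 h1) (not_lt.1 h3')).trans (le_of_eq ?_)
    ring
  refine (measure_mono_ae hcov).trans ((measure_union_le _ _).trans ?_)
  rw [weakConst, add_mul _ (_ + _) (N / s), add_mul (ENNReal.ofReal _ ^ d * _)]
  exact add_le_add hgoodvol ((measure_union_le _ _).trans (add_le_add hUvol hbadvol))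

end

end SparseCZ

namespace SparseCZ

open Set Filter Topology Metric

variable {d : ℕ} {𝕜 : Type*} [RCLike 𝕜]

/-! ### Truncations -/

/-- The restriction of `f` to the set where `|x| ≤ n` and `|f x| ≤ n`. -/
noncomputable def trunc (f : Euc d → 𝕜) (n : ℕ) : Euc d → 𝕜 :=
  (closedBall (0 : Euc d) n).indicator fun x => if ‖f x‖ ≤ n then f x else 0

theorem norm_trunc_le (f : Euc d → 𝕜) (n : ℕ) (x : Euc d) : ‖trunc f n x‖ ≤ ‖f x‖ := by
  unfold trunc
  refine (norm_indicator_le_norm_self _ _).trans ?_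
  split_ifs <;> simp

theorem trunc_eq_zero {f : Euc d → 𝕜} {x : Euc d} (hx : f x = 0) (n : ℕ) : trunc f n x = 0 := by
  have := norm_trunc_le f n x
  rw [hx, norm_zero] at this
  exact norm_le_zero_iff.1 this

theorem aestronglyMeasurable_trunc {f : Euc d → 𝕜} (hf : AEStronglyMeasurable f volume) (n : ℕ) :
    AEStronglyMeasurable (trunc f n) volume := by
  refine AEStronglyMeasurable.indicator ?_ measurableSet_closedBall
  have hφ : Measurable fun z : 𝕜 => if ‖z‖ ≤ (n : ℝ) then z else 0 :=
    Measurable.ite (measurableSet_le measurable_norm measurable_const) measurable_id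
      measurable_const
  exact (hφ.comp_aemeasurable hf.aemeasurable).aestronglyMeasurable

theorem memLp_trunc {f : Euc d → 𝕜} (hf : AEStronglyMeasurable f volume) (n : ℕ) (p : ℝ≥0∞) :
    MemLp (trunc f n) p volume := by
  refine MemLp.mono (memLp_indicator_const p (s := closedBall (0 : Euc d) n)
    measurableSet_closedBall (n : ℝ) (Or.inr measure_closedBall_lt_top.ne))
    (aestronglyMeasurable_trunc hf n) (ae_of_all _ fun x => ?_)
  by_cases hx : x ∈ closedBall (0 : Euc d) n
  · rw [trunc, indicator_of_mem hx, indicator_of_mem hx]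
    split_ifs with h
    · simpa using h
    · simp
  · rw [trunc, indicator_of_notMem hx]
    simp

theorem hasCompactSupport_trunc (f : Euc d → 𝕜) (n : ℕ) : HasCompactSupport (trunc f n) :=
  HasCompactSupport.intro (isCompact_closedBall (0 : Euc d) n) fun _ hx =>
    indicator_of_notMem hx _

theorem eventually_trunc_eq (f : Euc d → 𝕜) (x : Euc d) : ∀ᶠ n in atTop, trunc f n x = f x := by
  filter_upwards [eventually_ge_atTop ⌈max ‖x‖ ‖f x‖⌉₊] with n hn
  have h := Nat.ceil_le.1 hn
  rw [trunc, indicator_of_mem (by simpa using (le_max_left _ _).trans h),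
    if_pos ((le_max_right _ _).trans h)]

theorem tendsto_trunc (f : Euc d → 𝕜) (x : Euc d) :
    Tendsto (fun n => trunc f n x) atTop (𝓝 (f x)) :=
  tendsto_const_nhds.congr' ((eventually_trunc_eq f x).mono fun _ h => h.symm)

theorem tendsto_eLpNorm_trunc {f : Euc d → 𝕜} {p : ℝ≥0∞} (hp : p ≠ 0) (hp' : p ≠ ∞)
    (hf : MemLp f p volume) : Tendsto (fun n => eLpNorm (trunc f n - f) p volume) atTop (𝓝 0) := by
  have hpos : 0 < p.toReal := ENNReal.toReal_pos hp hp'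
  have h1 : Tendsto (fun n => ∫⁻ x, ‖(trunc f n - f) x‖ₑ ^ p.toReal) atTop
      (𝓝 (∫⁻ _ : Euc d, 0)) := by
    refine tendsto_lintegral_of_dominated_convergence' (fun x => ‖f x‖ₑ ^ p.toReal)
      (fun n => ((aestronglyMeasurable_trunc hf.1 n).sub hf.1).enorm.pow_const _)
      (fun n => ae_of_all _ fun x => ?_)
      (lintegral_rpow_enorm_lt_top_of_eLpNorm_lt_top hp hp' hf.2).ne (ae_of_all _ fun x => ?_)
    · refine ENNReal.rpow_le_rpow ?_ hpos.le
      rw [Pi.sub_apply, trunc]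
      by_cases hx : x ∈ closedBall (0 : Euc d) n
      · rw [indicator_of_mem hx]
        split_ifs <;> simp
      · rw [indicator_of_notMem hx]
        simp
    · refine tendsto_const_nhds.congr' ?_
      filter_upwards [eventually_trunc_eq f x] with n hn
      rw [Pi.sub_apply, hn, sub_self, enorm_zero, ENNReal.zero_rpow_of_pos hpos]
  simp only [eLpNorm_eq_lintegral_rpow_enorm_toReal hp hp']
  rw [lintegral_zero] at h1
  have h2 := ((ENNReal.continuous_rpow_const (y := 1 / p.toReal)).tendsto 0).comp h1
  rwa [ENNReal.zero_rpow_of_pos (by positivity)] at h2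

/-! ### Convergence in measure -/

section Measure

variable {α : Type*} [MeasurableSpace α] {μ : Measure α}

/-- The condition `a < ‖·‖` is open, so at a point of convergence it holds from some index on. The
sets where it holds from `N` on increase with `N`, and the measure is continuous along them. -/
theorem measure_lt_enorm_le_of_tendsto {h : ℕ → α → 𝕜} {g : α → 𝕜}
    (hlim : ∀ᵐ x ∂μ, Tendsto (fun n => h n x) atTop (𝓝 (g x))) {a M : ℝ≥0∞} {m : ℕ → ℝ≥0∞}
    (hm : ∀ᶠ n in atTop, μ {x | a < ‖h n x‖ₑ} ≤ m n) (hM : Tendsto m atTop (𝓝 M)) :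
    μ {x | a < ‖g x‖ₑ} ≤ M := by
  set s : ℕ → Set α := fun N => {x | ∀ n ≥ N, a < ‖h n x‖ₑ} with hs
  have hmono : Monotone s := fun N N' hN x hx n hn => hx n (hN.trans hn)
  have h1 : {x | a < ‖g x‖ₑ} ≤ᵐ[μ] (⋃ N, s N : Set α) := by
    filter_upwards [hlim] with x hx hxa
    have := (hx.enorm.eventually_const_lt hxa)
    obtain ⟨N, hN⟩ := eventually_atTop.1 this
    exact mem_iUnion.2 ⟨N, hN⟩
  refine (measure_mono_ae h1).trans ?_
  rw [hmono.measure_iUnion]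
  refine iSup_le fun N => ge_of_tendsto hM ?_
  filter_upwards [hm, eventually_ge_atTop N] with n hn hnN
  exact (measure_mono fun x (hx : x ∈ s N) => hx n hnN).trans hn

theorem TendstoInMeasure.add' {u v : ℕ → α → 𝕜} {g h : α → 𝕜}
    (hu : TendstoInMeasure μ u atTop g) (hv : TendstoInMeasure μ v atTop h) :
    TendstoInMeasure μ (fun n => u n + v n) atTop (g + h) := by
  rw [tendstoInMeasure_iff_norm] at *
  intro ε hε
  have h1 := (hu (ε / 2) (half_pos hε)).add (hv (ε / 2) (half_pos hε))
  rw [add_zero] at h1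
  refine tendsto_of_tendsto_of_tendsto_of_le_of_le tendsto_const_nhds h1 (fun _ => zero_le)
    fun n => ?_
  refine (measure_mono fun x hx => ?_).trans (measure_union_le _ _)
  have hx : ε ≤ ‖(u n + v n) x - (g + h) x‖ := hx
  change _ ∨ _
  by_contra hn
  push Not at hn
  have e : (u n + v n) x - (g + h) x = (u n x - g x) + (v n x - h x) := by
    simp only [Pi.add_apply]; ring
  rw [e] at hx
  have h3 : ‖u n x - g x‖ < ε / 2 := lt_of_not_ge hn.1
  have h4 : ‖v n x - h x‖ < ε / 2 := lt_of_not_ge hn.2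
  linarith [norm_add_le (u n x - g x) (v n x - h x)]

theorem TendstoInMeasure.const_smul' {u : ℕ → α → 𝕜} {g : α → 𝕜}
    (hu : TendstoInMeasure μ u atTop g) (c : 𝕜) :
    TendstoInMeasure μ (fun n => c • u n) atTop (c • g) := by
  rw [tendstoInMeasure_iff_norm] at *
  intro ε hε
  have hc : 0 < ‖c‖ + 1 := by positivity
  refine tendsto_of_tendsto_of_tendsto_of_le_of_le tendsto_const_nhds
    (hu (ε / (‖c‖ + 1)) (by positivity)) (fun _ => zero_le) fun n => measure_mono fun x hx => ?_
  have hx : ε ≤ ‖(c • u n) x - (c • g) x‖ := hx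
  change ε / (‖c‖ + 1) ≤ ‖u n x - g x‖
  rw [Pi.smul_apply, Pi.smul_apply, ← smul_sub, norm_smul] at hx
  rw [div_le_iff₀ hc]
  nlinarith [norm_nonneg (u n x - g x)]

theorem ae_eq_zero_of_measure_lt {g : α → 𝕜}
    (h : ∀ a : ℝ≥0∞, a ≠ 0 → a ≠ ∞ → μ {x | a < ‖g x‖ₑ} = 0) : g =ᵐ[μ] 0 := by
  have h1 : ∀ᵐ x ∂μ, ∀ n : ℕ, ¬ ((n : ℝ≥0∞) + 1)⁻¹ < ‖g x‖ₑ :=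
    ae_all_iff.2 fun n => by
      refine ae_iff.2 ?_
      simp_rw [not_not]
      exact h ((n : ℝ≥0∞) + 1)⁻¹ (by simp) (by simp)
  filter_upwards [h1] with x hx
  by_contra hne
  obtain ⟨n, hn⟩ := ENNReal.exists_inv_nat_lt (enorm_ne_zero.2 hne)
  exact hx n (lt_of_le_of_lt (ENNReal.inv_le_inv.2 (le_self_add)) hn)

end Measure

end SparseCZ

namespace SparseCZ

open Set Filter Topology Metric

variable {d : ℕ} {𝕜 : Type*} [RCLike 𝕜]

/-! ### The extension to integrable functions -/

section Extension

variable {T : Lp 𝕜 2 (volume : Measure (Euc d)) →L[𝕜] Lp 𝕜 2 (volume : Measure (Euc d))}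

/-- The weak type inequality on bounded functions. -/
def HasWeakBound (T : Lp 𝕜 2 (volume : Measure (Euc d)) →L[𝕜] Lp 𝕜 2 (volume : Measure (Euc d)))
    (B : ℝ≥0∞) : Prop :=
  ∀ f : Euc d → 𝕜, MemLp f ∞ volume → MemLp f 1 volume → ∀ (hf : MemLp f 2 volume) (s : ℝ≥0∞),
    s ≠ 0 → s ≠ ∞ →
      volume {x | 2 * B * s < ‖T (hf.toLp f) x‖ₑ} ≤ weakConst d * (eLpNorm f 1 volume / s)

/-- `h` is the limit in measure of `T u` for bounded functions `u` converging to `f` in `L¹`. -/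
def IsL1Limit (T : Lp 𝕜 2 (volume : Measure (Euc d)) →L[𝕜] Lp 𝕜 2 (volume : Measure (Euc d)))
    (f h : Euc d → 𝕜) : Prop :=
  ∃ (u : ℕ → Euc d → 𝕜) (_ : ∀ n, MemLp (u n) ∞ volume) (_ : ∀ n, MemLp (u n) 1 volume)
    (h2 : ∀ n, MemLp (u n) 2 volume),
    Tendsto (fun n => eLpNorm (u n - f) 1 volume) atTop (𝓝 0) ∧
      TendstoInMeasure volume (fun n => ⇑(T ((h2 n).toLp (u n)))) atTop h

theorem IsL1Limit.measure_le {f h : Euc d → 𝕜} (hf : MemLp f 1 volume) (hR : IsL1Limit T f h)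
    {B : ℝ≥0∞} (hB : HasWeakBound T B) {s : ℝ≥0∞} (hs : s ≠ 0) (hs' : s ≠ ∞) :
    volume {x | 2 * B * s < ‖h x‖ₑ} ≤ weakConst d * (eLpNorm f 1 volume / s) := by
  obtain ⟨u, ub, u1, u2, hu, hTu⟩ := hR
  obtain ⟨ns, hns, hlim⟩ := hTu.exists_seq_tendsto_ae
  refine measure_lt_enorm_le_of_tendsto hlim
    (m := fun n => weakConst d * ((eLpNorm f 1 volume + eLpNorm (u (ns n) - f) 1 volume) / s))
    (Eventually.of_forall fun n => ?_) ?_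
  · refine (hB _ (ub (ns n)) (u1 (ns n)) (u2 (ns n)) s hs hs').trans ?_
    refine mul_le_mul_right (ENNReal.div_le_div_right ?_ _) _
    have := eLpNorm_add_le hf.1 ((u1 (ns n)).1.sub hf.1) (le_refl (1 : ℝ≥0∞))
    rwa [add_sub_cancel] at this
  · refine ENNReal.Tendsto.const_mul ?_ (Or.inr weakConst_ne_top)
    refine ENNReal.Tendsto.div_const ?_ (Or.inr hs)
    have := (hu.comp hns.tendsto_atTop).const_add (eLpNorm f 1 volume)
    rwa [add_zero] at this

theorem IsL1Limit.add {f f' h h' : Euc d → 𝕜} (hf : MemLp f 1 volume) (hf' : MemLp f' 1 volume)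
    (hR : IsL1Limit T f h) (hR' : IsL1Limit T f' h') : IsL1Limit T (f + f') (h + h') := by
  obtain ⟨u, ub, u1, u2, hu, hTu⟩ := hR
  obtain ⟨v, vb, v1, v2, hv, hTv⟩ := hR'
  refine ⟨fun n => u n + v n, fun n => (ub n).add (vb n), fun n => (u1 n).add (v1 n),
    fun n => (u2 n).add (v2 n), ?_, ?_⟩
  · have h0 := hu.add hv
    rw [add_zero] at h0
    refine tendsto_of_tendsto_of_tendsto_of_le_of_le tendsto_const_nhds h0 (fun _ => zero_le)
      fun n => ?_
    have := eLpNorm_add_le ((u1 n).1.sub hf.1) ((v1 n).1.sub hf'.1) (le_refl (1 : ℝ≥0∞))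
    dsimp only
    rwa [add_sub_add_comm]
  · refine (TendstoInMeasure.add' hTu hTv).congr_left fun n => ?_
    rw [MemLp.toLp_add, map_add]
    exact (Lp.coeFn_add _ _).symm

theorem IsL1Limit.const_smul {f h : Euc d → 𝕜} (hR : IsL1Limit T f h) (c : 𝕜) :
    IsL1Limit T (c • f) (c • h) := by
  obtain ⟨u, ub, u1, u2, hu, hTu⟩ := hR
  refine ⟨fun n => c • u n, fun n => (ub n).const_smul c, fun n => (u1 n).const_smul c,
    fun n => (u2 n).const_smul c, ?_, ?_⟩
  · have h0 := ENNReal.Tendsto.const_mul (a := ‖c‖ₑ) hu (Or.inr enorm_ne_top)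
    rw [mul_zero] at h0
    refine h0.congr fun n => ?_
    rw [← smul_sub, eLpNorm_const_smul]
  · refine (TendstoInMeasure.const_smul' hTu c).congr_left fun n => ?_
    rw [MemLp.toLp_const_smul, map_smul]
    exact (Lp.coeFn_smul _ _).symm

theorem IsL1Limit.congr {f f' h h' : Euc d → 𝕜} (hR : IsL1Limit T f h) (hf : f =ᵐ[volume] f')
    (hh : h =ᵐ[volume] h') : IsL1Limit T f' h' := by
  obtain ⟨u, ub, u1, u2, hu, hTu⟩ := hR
  refine ⟨u, ub, u1, u2, hu.congr fun n => ?_, hTu.congr_right hh⟩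
  exact eLpNorm_congr_ae ((ae_eq_refl _).sub hf)

/-- The difference `h - h'` is a limit attached to `f - f = 0`, and the weak bound with source zero
makes it vanish almost everywhere. -/
theorem IsL1Limit.unique {f h h' : Euc d → 𝕜} (hf : MemLp f 1 volume) (hR : IsL1Limit T f h)
    (hR' : IsL1Limit T f h') {B : ℝ≥0∞} (hB : HasWeakBound T B) (hB0 : B ≠ 0) (hBtop : B ≠ ∞) :
    h =ᵐ[volume] h' := by
  have h1 := hR.add hf (hf.const_smul (-1 : 𝕜)) (hR'.const_smul (-1))
  have h2 : h + (-1 : 𝕜) • h' =ᵐ[volume] 0 := by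
    refine ae_eq_zero_of_measure_lt fun a ha ha' => ?_
    have hB2 : 2 * B ≠ 0 := mul_ne_zero two_ne_zero hB0
    have hB2' : 2 * B ≠ ∞ := by finiteness
    have h3 := h1.measure_le (hf.add (hf.const_smul (-1 : 𝕜))) hB (s := a / (2 * B))
      (ENNReal.div_pos ha hB2').ne' (ENNReal.div_ne_top ha' hB2)
    rw [ENNReal.mul_div_cancel hB2 hB2'] at h3
    have h4 : f + (-1 : 𝕜) • f = 0 := by simp
    simpa [h4] using h3
  filter_upwards [h2] with x hx
  simp only [Pi.add_apply, Pi.smul_apply, smul_eq_mul, Pi.zero_apply] at hx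
  linear_combination hx

theorem isL1Limit_self {f : Euc d → 𝕜} (h1 : MemLp f 1 volume) (h2 : MemLp f 2 volume) :
    IsL1Limit T f (T (h2.toLp f)) := by
  refine ⟨trunc f, fun n => memLp_trunc h1.1 n _, fun n => memLp_trunc h1.1 n _,
    fun n => memLp_trunc h1.1 n _, tendsto_eLpNorm_trunc one_ne_zero ENNReal.one_ne_top h1, ?_⟩
  refine tendstoInMeasure_of_tendsto_Lp ((T.continuous.tendsto _).comp ?_)
  rw [Lp.tendsto_Lp_iff_tendsto_eLpNorm'']
  exact tendsto_eLpNorm_trunc two_ne_zero ENNReal.ofNat_ne_top h2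

/-- Borel–Cantelli: truncations with L¹ error at most 4^{-k} are compared at heights of order
2^{-k}. The exceptional measures are then of order 2^{-k}, hence summable, and outside them the
images form a geometric Cauchy sequence. -/
theorem exists_isL1Limit {f : Euc d → 𝕜} (hf : MemLp f 1 volume) {B : ℝ≥0∞}
    (hB : HasWeakBound T B) (hB0 : B ≠ 0) (hBtop : B ≠ ∞) :
    ∃ h : Euc d → 𝕜, StronglyMeasurable h ∧ IsL1Limit T f h := by
  have hB2 : 2 * B ≠ 0 := mul_ne_zero two_ne_zero hB0
  have hB2' : 2 * B ≠ ∞ := by finiteness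
  have hsel : ∀ k : ℕ, ∃ n, eLpNorm (trunc f n - f) 1 volume ≤ (2⁻¹ * 2⁻¹) ^ k := fun k => by
    have hpos : (0 : ℝ≥0∞) < (2⁻¹ * 2⁻¹) ^ k :=
      pos_iff_ne_zero.2 (pow_ne_zero k (mul_ne_zero (by simp) (by simp)))
    exact ((tendsto_eLpNorm_trunc one_ne_zero ENNReal.one_ne_top hf).eventually_le_const
      hpos).exists
  choose n hn using hsel
  set v : ℕ → Euc d → 𝕜 := fun k => trunc f (n k) with hv
  have vp : ∀ k p, MemLp (v k) p volume := fun k p => memLp_trunc hf.1 _ p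
  have hle : (2⁻¹ : ℝ≥0∞) * 2⁻¹ ≤ 1 := by
    refine mul_le_one' ?_ ?_ <;> simp
  have hdiff : ∀ k m, k ≤ m → eLpNorm (v m - v k) 1 volume ≤ 2 * (2⁻¹ * 2⁻¹) ^ k := by
    intro k m hkm
    have h1 := eLpNorm_sub_le ((vp m 1).1.sub hf.1) ((vp k 1).1.sub hf.1) (le_refl (1 : ℝ≥0∞))
    rw [sub_sub_sub_cancel_right] at h1
    refine h1.trans ?_
    rw [two_mul]
    exact add_le_add ((hn m).trans (pow_le_pow_right_of_le_one' hle hkm)) (hn k)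
  have hTsub : ∀ k m, ⇑(T (((vp m 2).sub (vp k 2)).toLp (v m - v k))) =ᵐ[volume]
      ⇑(T ((vp m 2).toLp (v m))) - ⇑(T ((vp k 2).toLp (v k))) := fun k m => by
    rw [MemLp.toLp_sub, map_sub]
    exact Lp.coeFn_sub _ _
  have hweak : ∀ k m, k ≤ m → ∀ s : ℝ≥0∞, s ≠ 0 → s ≠ ∞ →
      volume {x | 2 * B * s < ‖T ((vp m 2).toLp (v m)) x - T ((vp k 2).toLp (v k)) x‖ₑ} ≤
        weakConst d * (2 * (2⁻¹ * 2⁻¹) ^ k / s) := by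
    intro k m hkm s hs hs'
    have h1 := hB _ ((vp m _).sub (vp k _)) ((vp m _).sub (vp k _)) ((vp m 2).sub (vp k 2)) s hs hs'
    refine le_trans (measure_mono_ae ?_)
      (h1.trans (mul_le_mul_right (ENNReal.div_le_div_right (hdiff k m hkm) _) _))
    filter_upwards [hTsub k m] with x hx hx2
    change 2 * B * s < ‖T (((vp m 2).sub (vp k 2)).toLp (v m - v k)) x‖ₑ
    rw [hx]
    exact hx2
  have hae : ∀ᵐ x ∂(volume : Measure (Euc d)), ∃ l,
      Tendsto (fun k => T ((vp k 2).toLp (v k)) x) atTop (𝓝 l) := by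
    have hsum : ∑' k : ℕ, volume {x | 2 * B * 2⁻¹ ^ k <
        ‖T ((vp (k + 1) 2).toLp (v (k + 1))) x - T ((vp k 2).toLp (v k)) x‖ₑ} ≠ ∞ := by
      refine ne_top_of_le_ne_top (b := ∑' k : ℕ, weakConst d * 2 * 2⁻¹ ^ k) ?_
        (ENNReal.tsum_le_tsum fun k => ?_)
      · rw [ENNReal.tsum_mul_left, ENNReal.tsum_geometric]
        have := weakConst_ne_top (d := d)
        simp only [ENNReal.one_sub_inv_two, inv_inv]
        finiteness
      · refine (hweak k (k + 1) k.le_succ (2⁻¹ ^ k) (by simp) (by simp)).trans (le_of_eq ?_)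
        rw [mul_pow, ← mul_assoc, ENNReal.mul_div_cancel_right (by simp) (by simp), mul_assoc]
    filter_upwards [ae_eventually_notMem hsum] with x hx
    obtain ⟨N, hN⟩ := eventually_atTop.1 hx
    have hc : CauchySeq fun k => T ((vp (k + N) 2).toLp (v (k + N))) x := by
      refine cauchySeq_of_edist_le_geometric 2⁻¹ (2 * B) (by simp) hB2' fun k => ?_
      have h1 := not_lt.1 (hN (k + N) (Nat.le_add_left _ _))
      rw [edist_comm, edist_eq_enorm_sub]
      have h2 : k + 1 + N = k + N + 1 := by ring
      rw [h2]
      refine h1.trans (mul_le_mul_right ?_ _)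
      exact pow_le_pow_right_of_le_one' (by simp) (Nat.le_add_right _ _)
    obtain ⟨l, hl⟩ := cauchySeq_tendsto_of_complete hc
    exact ⟨l, (tendsto_add_atTop_iff_nat N).1 hl⟩
  obtain ⟨h, hmeas, hlim⟩ := exists_stronglyMeasurable_limit_of_tendsto_ae
    (fun k => Lp.aestronglyMeasurable (T ((vp k 2).toLp (v k)))) hae
  have h4 : Tendsto (fun k : ℕ => ((2⁻¹ : ℝ≥0∞) * 2⁻¹) ^ k) atTop (𝓝 0) := by
    refine ENNReal.tendsto_pow_atTop_nhds_zero_of_lt_one ?_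
    exact (mul_le_of_le_one_right' (by simp)).trans_lt ENNReal.one_half_lt_one
  refine ⟨h, hmeas, v, fun k => vp k _, fun k => vp k _, fun k => vp k 2,
    tendsto_of_tendsto_of_tendsto_of_le_of_le tendsto_const_nhds h4 (fun _ => zero_le) hn, ?_⟩
  -- The whole space has infinite measure, so almost everywhere convergence alone would not suffice;
  -- the weak bound for `v m - v k` passes to the limit in `m`. The height satisfies `2 * B * s = ε
  -- / 2`, which turns `ε ≤` into a strict inequality.
  refine tendstoInMeasure_of_ne_top fun ε hε hεtop => ?_
  set s := ε / 2 / (2 * B) with hs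
  have hε2 : ε / 2 ≠ 0 := (ENNReal.half_pos hε.ne').ne'
  have hε2' : ε / 2 ≠ ∞ := ENNReal.div_ne_top hεtop two_ne_zero
  have hs0 : s ≠ 0 := (ENNReal.div_pos hε2 hB2').ne'
  have hsfin : s ≠ ∞ := ENNReal.div_ne_top hε2' hB2
  have h5 : Tendsto (fun k : ℕ => weakConst d * (2 * (2⁻¹ * 2⁻¹) ^ k / s)) atTop (𝓝 0) := by
    have := ENNReal.Tendsto.const_mul (a := weakConst d) (ENNReal.Tendsto.div_const
      (ENNReal.Tendsto.const_mul (a := 2) h4 (Or.inr (by simp))) (Or.inr hs0))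
      (Or.inr weakConst_ne_top)
    simpa using this
  refine tendsto_of_tendsto_of_tendsto_of_le_of_le tendsto_const_nhds h5 (fun _ => zero_le)
    fun k => ?_
  have h6 := measure_lt_enorm_le_of_tendsto (μ := volume) (a := 2 * B * s)
    (h := fun m x => T ((vp m 2).toLp (v m)) x - T ((vp k 2).toLp (v k)) x)
    (g := fun x => h x - T ((vp k 2).toLp (v k)) x)
    (hlim.mono fun x hx => hx.sub_const _)
    ((eventually_ge_atTop k).mono fun m hm => hweak k m hm s hs0 hsfin) tendsto_const_nhds
  refine (measure_mono fun x hx => ?_).trans h6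
  have hx : ε ≤ edist (T ((vp k 2).toLp (v k)) x) (h x) := hx
  rw [edist_comm, edist_eq_enorm_sub] at hx
  change 2 * B * s < _
  rw [hs, ENNReal.mul_div_cancel hB2 hB2']
  exact (ENNReal.half_lt_self hε.ne' hεtop).trans_le hx

/-- The unspecified constant of the extension is used only for continuity from L¹ into convergence
in measure; afterwards the explicit bound of `IsL1Limit.measure_le` takes over. -/
theorem IsWeakTypeExtension.tendstoInMeasure_trunc
    {T₁ : Lp 𝕜 1 (volume : Measure (Euc d)) →ₗ[𝕜] (Euc d →ₘ[volume] 𝕜)}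
    (hT₁ : IsWeakTypeExtension T T₁) {f : Euc d → 𝕜} (hf : MemLp f 1 volume) :
    TendstoInMeasure volume (fun n => ⇑(T ((memLp_trunc hf.1 n 2).toLp (trunc f n)))) atTop
      (T₁ (hf.toLp f)) := by
  obtain ⟨A, hA⟩ := hT₁.weak
  rw [tendstoInMeasure_iff_norm]
  intro ε hε
  have h1 : Tendsto (fun n => ENNReal.ofReal
      (A * (eLpNorm (trunc f n - f) 1 volume).toReal / (ε / 2))) atTop (𝓝 0) := by
    have := (ENNReal.tendsto_toReal ENNReal.zero_ne_top).comp
      (tendsto_eLpNorm_trunc one_ne_zero ENNReal.one_ne_top hf)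
    have h2 := ENNReal.tendsto_ofReal ((this.const_mul A).div_const (ε / 2))
    simpa using h2
  refine tendsto_of_tendsto_of_tendsto_of_le_of_le tendsto_const_nhds h1 (fun _ => zero_le)
    fun n => ?_
  have hn1 := memLp_trunc hf.1 n 1
  have h2 := hA ((hn1.sub hf).toLp (trunc f n - f)) (ε / 2) (half_pos hε)
  rw [Lp.norm_toLp] at h2
  refine le_trans (measure_mono_ae ?_) h2
  have h3 : T₁ ((hn1.sub hf).toLp (trunc f n - f)) =
      T₁ (hn1.toLp (trunc f n)) - T₁ (hf.toLp f) := by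
    rw [MemLp.toLp_sub, map_sub]
  filter_upwards [hT₁.agree _ hn1 (memLp_trunc hf.1 n 2),
    AEEqFun.coeFn_sub (T₁ (hn1.toLp (trunc f n))) (T₁ (hf.toLp f))] with x hx hx2 hx3
  have hx3 : ε ≤ ‖T ((memLp_trunc hf.1 n 2).toLp (trunc f n)) x - T₁ (hf.toLp f) x‖ := hx3
  change ε / 2 < _
  rw [h3, hx2, Pi.sub_apply, hx]
  linarith

theorem IsWeakTypeExtension.isL1Limit
    {T₁ : Lp 𝕜 1 (volume : Measure (Euc d)) →ₗ[𝕜] (Euc d →ₘ[volume] 𝕜)}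
    (hT₁ : IsWeakTypeExtension T T₁) {f : Euc d → 𝕜} (hf : MemLp f 1 volume) :
    IsL1Limit T f (T₁ (hf.toLp f)) :=
  ⟨trunc f, fun n => memLp_trunc hf.1 n _, fun n => memLp_trunc hf.1 n _,
    fun n => memLp_trunc hf.1 n _, tendsto_eLpNorm_trunc one_ne_zero ENNReal.one_ne_top hf,
    hT₁.tendstoInMeasure_trunc hf⟩

/-- Linearity, agreement with `T` on L² functions and uniqueness all follow from uniqueness of the
limit attached to an integrable function. -/
theorem existsUnique_isWeakTypeExtension {B : ℝ≥0∞} (hB : HasWeakBound T B) (hB0 : B ≠ 0)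
    (hBtop : B ≠ ∞) :
    ∃! T₁ : Lp 𝕜 1 (volume : Measure (Euc d)) →ₗ[𝕜] (Euc d →ₘ[volume] 𝕜),
      IsWeakTypeExtension T T₁ := by
  have hex : ∀ f : Lp 𝕜 1 (volume : Measure (Euc d)), ∃ h : Euc d →ₘ[volume] 𝕜,
      IsL1Limit T f h := fun f => by
    obtain ⟨h, hm, hR⟩ := exists_isL1Limit (Lp.memLp f) hB hB0 hBtop
    exact ⟨AEEqFun.mk h hm.aestronglyMeasurable,
      hR.congr (ae_eq_refl _) (AEEqFun.coeFn_mk h hm.aestronglyMeasurable).symm⟩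
  choose Φ hΦ using hex
  have huniq : ∀ (f : Lp 𝕜 1 (volume : Measure (Euc d))) (h : Euc d →ₘ[volume] 𝕜),
      IsL1Limit T f h → Φ f = h := fun f h hR =>
    AEEqFun.ext ((hΦ f).unique (Lp.memLp f) hR hB hB0 hBtop)
  let T₁ : Lp 𝕜 1 (volume : Measure (Euc d)) →ₗ[𝕜] (Euc d →ₘ[volume] 𝕜) :=
    { toFun := Φ
      map_add' := fun f g => huniq _ _ (((hΦ f).add (Lp.memLp f) (Lp.memLp g) (hΦ g)).congr
        (Lp.coeFn_add f g).symm (AEEqFun.coeFn_add _ _).symm)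
      map_smul' := fun c f => huniq _ _ (((hΦ f).const_smul c).congr
        (Lp.coeFn_smul c f).symm (AEEqFun.coeFn_smul _ _).symm) }
  refine ⟨T₁, ⟨fun f h1 h2 => ?_, 2 * B.toReal * (weakConst d).toReal, fun f t ht => ?_⟩,
    fun T₂ hT₂ => ?_⟩
  · exact (hΦ (h1.toLp f)).unique (Lp.memLp _) ((isL1Limit_self h1 h2).congr
      (MemLp.coeFn_toLp h1).symm (ae_eq_refl _)) hB hB0 hBtop
  · have hB2 : 2 * B ≠ 0 := mul_ne_zero two_ne_zero hB0
    have hB2' : 2 * B ≠ ∞ := by finiteness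
    have ht0 : ENNReal.ofReal t ≠ 0 := by simpa using ht
    have h1 := (hΦ f).measure_le (Lp.memLp f) hB (s := ENNReal.ofReal t / (2 * B))
      (ENNReal.div_pos ht0 hB2').ne' (ENNReal.div_ne_top ENNReal.ofReal_ne_top hB2)
    rw [ENNReal.mul_div_cancel hB2 hB2'] at h1
    have h2 : {x | t < ‖T₁ f x‖} = {x | ENNReal.ofReal t < ‖Φ f x‖ₑ} := by
      ext x
      change t < ‖Φ f x‖ ↔ ENNReal.ofReal t < ‖Φ f x‖ₑ
      rw [← ofReal_norm, ENNReal.ofReal_lt_ofReal_iff_of_nonneg ht.le]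
    rw [h2]
    refine h1.trans (le_of_eq ?_)
    rw [ENNReal.ofReal_div_of_pos ht, ENNReal.ofReal_mul (by positivity),
      ENNReal.ofReal_mul (by positivity), ENNReal.ofReal_mul (by positivity),
      ENNReal.ofReal_toReal hBtop, ENNReal.ofReal_toReal weakConst_ne_top, ENNReal.ofReal_ofNat,
      ofReal_norm, Lp.enorm_def]
    rw [div_eq_mul_inv, ENNReal.inv_div (Or.inl hB2') (Or.inl hB2), div_eq_mul_inv, div_eq_mul_inv]
    ring
  · refine LinearMap.ext fun f => (huniq f _ ?_).symm
    have := hT₂.isL1Limit (Lp.memLp f)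
    rw [Lp.toLp_coeFn] at this
    exact this

end Extension

end SparseCZ

namespace SparseCZ

open Set Filter Topology Metric

variable {d : ℕ}

/-! ### The roots: a partition of the space adapted to a bounded set -/

/-- All dyadic children of `Q` have dilates containing `A`. -/
def IsSplit (A : Set (Euc d)) (Q : DyadicIndex d) : Prop :=
  1 ≤ Q.1 ∧ ∀ Q', parent Q' = Q → A ⊆ dil Q'

/-- The maximal dyadic cubes which are not split. -/
def roots (A : Set (Euc d)) : Set (DyadicIndex d) :=
  {Q | ¬ IsSplit A Q ∧ ∀ Q', cube Q ⊆ cube Q' → Q' ≠ Q → IsSplit A Q'}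

theorem subset_dil_of_mem_roots {A : Set (Euc d)} {Q : DyadicIndex d} (hQ : Q ∈ roots A) :
    A ⊆ dil Q := by
  refine (hQ.2 (parent Q) (cube_subset_cube_parent Q) fun h => ?_).2 Q rfl
  have := congr_arg Prod.fst h
  simp [parent] at this

theorem roots_pairwiseDisjoint (A : Set (Euc d)) : (roots A).PairwiseDisjoint cube := by
  intro Q hQ Q' hQ' hne
  refine Set.disjoint_left.2 fun x hx hx' => ?_
  rcases subset_or_subset hx hx' with h | h
  · exact hQ'.1 (hQ.2 Q' h hne.symm)
  · exact hQ.1 (hQ'.2 Q h hne)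

/-- Large cubes around `x` are split, since `A` is bounded; cubes of generation at most 0 are not,
by the clause `1 ≤ Q.1`, which matters when `A` is so small that every dilate at `x` contains it.
The largest cube around `x` that is not split is a root. -/
theorem exists_mem_roots (hd : 1 ≤ d) {A : Set (Euc d)} (hA : Bornology.IsBounded A) (x : Euc d) :
    ∃ Q ∈ roots A, x ∈ cube Q := by
  obtain ⟨r, hr⟩ := (isBounded_iff_subset_closedBall x).1 hA
  obtain ⟨N, hN⟩ := pow_unbounded_of_one_lt (4 * max r 1) one_lt_two
  have hsplit : ∀ m : ℤ, (N : ℤ) + 1 ≤ m → IsSplit A (dyadicIndex m x) := by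
    intro m hm
    refine ⟨by change 1 ≤ m; omega, fun Q' hQ' z hz => ?_⟩
    by_contra hn
    obtain ⟨y, hy⟩ := cube_nonempty Q'
    have h1 := le_norm_sub_of_notMem_dil hy hn
    have hyp : y ∈ cube (dyadicIndex m x) := hQ' ▸ cube_subset_cube_parent Q' hy
    have h2 := norm_sub_le_of_mem_cube hyp (mem_cube_dyadicIndex m x)
    have h3 := side_parent Q'
    rw [hQ'] at h3
    have h4 : ‖x - z‖ ≤ r := by
      have := hr hz
      rwa [mem_closedBall, dist_comm, dist_eq_norm] at this
    have h5 := norm_sub_le_norm_sub_add_norm_sub y x z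
    have h6 : (2 : ℝ) ^ N ≤ side Q' := by
      have h7 : (2 : ℝ) ^ ((N : ℤ) + 1) ≤ side (dyadicIndex m x) :=
        zpow_le_zpow_right₀ one_le_two hm
      rw [h3, zpow_add_one₀ two_ne_zero, zpow_natCast] at h7
      linarith
    rw [h3] at h2
    -- The distance from `y` to `x` is at most the diameter of the parent, `2√d` sides of `Q'`. The
    -- margin exceeds this by half a side, which is more than `r`.
    linarith [le_max_left r 1, le_max_right r 1]
  obtain ⟨n, hn, hmax⟩ := Int.exists_greatest_of_bdd
    (P := fun n => ¬ IsSplit A (dyadicIndex n x))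
    ⟨N, fun m hm => by
      by_contra hlt
      exact hm (hsplit m (by omega))⟩ ⟨0, fun h => by
      have := h.1
      simp [dyadicIndex] at this⟩
  refine ⟨dyadicIndex n x, ⟨hn, fun Q' hsub hne => ?_⟩, mem_cube_dyadicIndex n x⟩
  by_contra hns
  have hx : dyadicIndex Q'.1 x = Q' := hsub (mem_cube_dyadicIndex n x)
  have h1 : Q'.1 ≤ n := hmax _ (hx.symm ▸ hns)
  have h2 : n ≤ Q'.1 := generation_le_of_subset hd hsub
  exact hne (by rw [← hx, le_antisymm h1 h2])

/-! ### The tree of stopping cubes -/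

/-- A choice of small open exceptional sets, one for each dyadic cube. -/
structure IsExceptional (O : DyadicIndex d → Set (Euc d)) : Prop where
  isOpen : ∀ Q, IsOpen (O Q)
  small : ∀ Q, 2 ^ (d + 2) * volume (O Q) ≤ volume (cube Q)

/-- The stopping children of `Q`. -/
def children (O : DyadicIndex d → Set (Euc d)) (Q : DyadicIndex d) : Set (DyadicIndex d) :=
  {P ∈ stopping (O Q) | cube P ⊆ cube Q}

/-- The levels of the stopping tree. -/
def level (O : DyadicIndex d → Set (Euc d)) (A : Set (Euc d)) : ℕ → Set (DyadicIndex d)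
  | 0 => roots A
  | k + 1 => {P | ∃ Q ∈ level O A k, P ∈ children O Q}

/-- The stopping tree. -/
def tree (O : DyadicIndex d → Set (Euc d)) (A : Set (Euc d)) : Set (DyadicIndex d) :=
  {Q | ∃ k, Q ∈ level O A k}

/-- The part of `Q` that is not covered by its stopping children. -/
def core (O : DyadicIndex d → Set (Euc d)) (Q : DyadicIndex d) : Set (Euc d) :=
  cube Q \ ⋃ P ∈ children O Q, cube P

section Tree

variable {O : DyadicIndex d → Set (Euc d)} {A : Set (Euc d)}

theorem IsExceptional.volume_ne_top (hO : IsExceptional O) (Q : DyadicIndex d) :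
    volume (O Q) ≠ ∞ := by
  refine ne_top_of_le_ne_top (volume_cube_ne_top Q) (le_trans ?_ (hO.small Q))
  exact le_mul_of_one_le_left' (one_le_pow₀ one_le_two)

/-- No cube containing `Q` is heavy for `O Q`. Hence stopping cubes of `O Q` that meet `Q` lie
strictly inside it. -/
theorem IsExceptional.not_isHeavy (hO : IsExceptional O) {P Q : DyadicIndex d}
    (h : cube Q ⊆ cube P) : ¬ IsHeavy (O Q) P := by
  refine not_lt.2 (le_trans ?_ (measure_mono (μ := volume) h))
  refine le_trans ?_ (hO.small Q)
  exact mul_le_mul' (pow_le_pow_right₀ one_le_two (Nat.le_succ _)) (measure_mono inter_subset_right)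

theorem IsExceptional.mem_children (hO : IsExceptional O) {P Q : DyadicIndex d}
    (hP : P ∈ stopping (O Q)) {x : Euc d} (hxP : x ∈ cube P) (hxQ : x ∈ cube Q) :
    P ∈ children O Q := by
  refine ⟨hP, (subset_or_subset hxP hxQ).resolve_right fun h => ?_⟩
  exact hO.not_isHeavy h hP.1

theorem IsExceptional.generation_lt (hd : 1 ≤ d) (hO : IsExceptional O) {P Q : DyadicIndex d}
    (hP : P ∈ children O Q) : P.1 < Q.1 := by
  refine lt_of_le_of_ne (generation_le_of_subset hd hP.2) fun h => ?_
  obtain ⟨x, hx⟩ := cube_nonempty P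
  have := eq_of_mem_of_generation_eq hx (hP.2 hx) h
  subst this
  exact hO.not_isHeavy subset_rfl hP.1.1

theorem children_mem_tree {P Q : DyadicIndex d} (hQ : Q ∈ tree O A) (hP : P ∈ children O Q) :
    P ∈ tree O A := by
  obtain ⟨k, hk⟩ := hQ
  exact ⟨k + 1, Q, hk, hP⟩

theorem level_pairwiseDisjoint (k : ℕ) : (level O A k).PairwiseDisjoint cube := by
  induction k with
  | zero => exact roots_pairwiseDisjoint A
  | succ k ih =>
    rintro P ⟨Q, hQ, hP⟩ P' ⟨Q', hQ', hP'⟩ hne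
    by_cases h : Q = Q'
    · subst h
      exact stopping_pairwiseDisjoint _ hP.1 hP'.1 hne
    · exact (ih hQ hQ' h).mono hP.2 hP'.2

theorem exists_level_superset {j k : ℕ} (hjk : j ≤ k) {Q : DyadicIndex d}
    (hQ : Q ∈ level O A k) : ∃ P ∈ level O A j, cube Q ⊆ cube P := by
  induction k, hjk using Nat.le_induction generalizing Q with
  | base => exact ⟨Q, hQ, subset_rfl⟩
  | succ k hk ih =>
    obtain ⟨R, hR, hQR⟩ := hQ
    obtain ⟨P, hP, hRP⟩ := ih hR
    exact ⟨P, hP, hQR.2.trans hRP⟩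

/-- The deeper cube lies in a cube of level `j + 1`, a child of some cube of level `j`. A common
point forces that parent to be `Q`, and the core of `Q` omits its children. -/
theorem core_disjoint_of_level_lt {j k : ℕ} (hjk : j < k) {Q Q' : DyadicIndex d}
    (hQ : Q ∈ level O A j) (hQ' : Q' ∈ level O A k) : Disjoint (core O Q) (core O Q') := by
  refine Set.disjoint_left.2 fun y hy hy' => ?_
  obtain ⟨P, ⟨R, hR, hP⟩, hsub⟩ := exists_level_superset (Nat.succ_le_of_lt hjk) hQ'
  have hyP : y ∈ cube P := hsub hy'.1
  have hRQ : R = Q := by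
    by_contra hne
    exact Set.disjoint_left.1 (level_pairwiseDisjoint j hR hQ hne) (hP.2 hyP) hy.1
  subst hRQ
  exact hy.2 (mem_iUnion₂.2 ⟨P, hP, hyP⟩)

theorem core_pairwiseDisjoint : (tree O A).PairwiseDisjoint (core O) := by
  rintro Q ⟨j, hj⟩ Q' ⟨k, hk⟩ hne
  rcases lt_trichotomy j k with h | rfl | h
  · exact core_disjoint_of_level_lt h hj hk
  · exact (level_pairwiseDisjoint j hj hk hne).mono sdiff_subset sdiff_subset
  · exact (core_disjoint_of_level_lt h hk hj).symm

theorem measurableSet_core (O : DyadicIndex d → Set (Euc d)) (Q : DyadicIndex d) :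
    MeasurableSet (core O Q) :=
  (measurableSet_cube Q).diff (MeasurableSet.biUnion (to_countable _) fun P _ =>
    measurableSet_cube P)

theorem IsExceptional.two_mul_volume_children_le (hO : IsExceptional O) (Q : DyadicIndex d) :
    2 * volume (⋃ P ∈ children O Q, cube P) ≤ volume (cube Q) := by
  have h1 : volume (⋃ P ∈ children O Q, cube P) ≤ 2 ^ (d + 1) * volume (O Q) := by
    calc volume (⋃ P ∈ children O Q, cube P) ≤ volume (⋃ P ∈ stopping (O Q), cube P) :=
          measure_mono (biUnion_subset_biUnion_left fun P hP => hP.1)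
      _ ≤ ∑' P : stopping (O Q), volume (cube (P : DyadicIndex d)) :=
          measure_biUnion_le _ (to_countable _) _
      _ ≤ _ := tsum_volume_stopping_le (hO.isOpen Q).measurableSet
  refine (mul_le_mul_right h1 _).trans (le_trans (le_of_eq ?_) (hO.small Q))
  ring

theorem IsExceptional.volume_le_two_mul_core (hO : IsExceptional O) (Q : DyadicIndex d) :
    volume (cube Q) ≤ 2 * volume (core O Q) := by
  have h1 : volume (cube Q) ≤ volume (core O Q) + volume (⋃ P ∈ children O Q, cube P) := by
    refine le_trans (measure_mono fun x hx => ?_) (measure_union_le _ _)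
    by_cases h : x ∈ ⋃ P ∈ children O Q, cube P
    · exact Or.inr h
    · exact Or.inl ⟨hx, h⟩
  have h2 := hO.two_mul_volume_children_le Q
  have h3 : volume (cube Q) + volume (cube Q) ≤ 2 * volume (core O Q) + volume (cube Q) := by
    rw [← two_mul]
    refine (mul_le_mul_right h1 2).trans ?_
    rw [mul_add]
    exact add_le_add_right h2 _
  exact (ENNReal.add_le_add_iff_right (volume_cube_ne_top Q)).1 h3

/-- Borel–Cantelli: each tree cube has at most twice the measure of its core, and disjointness of
the cores inside `Q` makes the measures summable. -/
theorem IsExceptional.ae_finite (hO : IsExceptional O) (Q : DyadicIndex d) :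
    ∀ᵐ x ∂(volume : Measure (Euc d)), {P ∈ tree O A | cube P ⊆ cube Q ∧ x ∈ cube P}.Finite := by
  set S : Set (DyadicIndex d) := {P ∈ tree O A | cube P ⊆ cube Q} with hS
  have hsum : ∑' P : S, volume (cube (P : DyadicIndex d)) ≠ ∞ := by
    refine ne_top_of_le_ne_top (b := 2 * volume (cube Q))
      (ENNReal.mul_ne_top (by simp) (volume_cube_ne_top Q)) ?_
    calc ∑' P : S, volume (cube (P : DyadicIndex d))
        ≤ ∑' P : S, 2 * volume (core O (P : DyadicIndex d)) :=
          ENNReal.tsum_le_tsum fun P => hO.volume_le_two_mul_core _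
      _ = 2 * volume (⋃ P : S, core O (P : DyadicIndex d)) := by
          rw [ENNReal.tsum_mul_left, measure_iUnion]
          · exact fun P P' hne => core_pairwiseDisjoint P.2.1 P'.2.1
              (Subtype.coe_injective.ne hne)
          · exact fun P => measurableSet_core O _
      _ ≤ 2 * volume (cube Q) :=
          mul_le_mul_right (measure_mono (iUnion_subset fun P => sdiff_subset.trans P.2.2)) _
  filter_upwards [ae_finite_setOfPred_mem hsum] with x hx
  refine (hx.image Subtype.val).subset ?_
  rintro P ⟨hP, hPQ, hxP⟩
  exact ⟨⟨P, hP, hPQ⟩, hxP, rfl⟩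

theorem IsExceptional.isSparse_image_dil (hd : 1 ≤ d) (hO : IsExceptional O) :
    IsSparse (1 / (2 * (4 * Real.sqrt d + 2) ^ d)) (dil '' tree O A) := by
  have hα : (2 : ℝ) ≤ dilFactor d := two_le_dilFactor
  have hpow : (1 : ℝ) ≤ dilFactor d ^ d := one_le_pow₀ (by linarith)
  change IsSparse (1 / (2 * dilFactor d ^ d)) _
  refine ⟨by positivity, ?_, ?_, fun R => core O (Function.invFun dil R), ?_, ?_⟩
  · rw [div_lt_one (by positivity)]
    linarith
  · rintro _ ⟨Q, -, rfl⟩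
    exact measurableSet_dil Q
  · rintro _ ⟨Q, -, rfl⟩
    simp only [Function.leftInverse_invFun (dil_injective hd) Q]
    refine ⟨measurableSet_core O Q, sdiff_subset.trans (cube_subset_dil hd Q), ?_⟩
    have h1 : ENNReal.ofReal (1 / (2 * dilFactor d ^ d)) * volume (dil Q) =
        2⁻¹ * volume (cube Q) := by
      rw [volume_dil, ← mul_assoc, ← ENNReal.ofReal_pow dilFactor_pos.le,
        ← ENNReal.ofReal_mul (by positivity)]
      congr 1
      rw [← ENNReal.ofReal_ofNat 2, ← ENNReal.ofReal_inv_of_pos two_pos]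
      congr 1
      field_simp
    rw [h1]
    refine (mul_le_mul_right (hO.volume_le_two_mul_core Q) _).trans (le_of_eq ?_)
    rw [← mul_assoc, ENNReal.inv_mul_cancel two_ne_zero ENNReal.ofNat_ne_top, one_mul]
  · rintro _ ⟨Q, hQ, rfl⟩ _ ⟨Q', hQ', rfl⟩ hne
    simp only [Function.onFun, Function.leftInverse_invFun (dil_injective hd) _]
    exact core_pairwiseDisjoint hQ hQ' fun h => hne (congr_arg dil h)

end Tree

end SparseCZ

namespace SparseCZ

open Set Filter Topology Metric

variable {d : ℕ} {𝕜 : Type*} [RCLike 𝕜]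

/-! ### The localised operators -/

section Local

variable {T : Lp 𝕜 2 (volume : Measure (Euc d)) →L[𝕜] Lp 𝕜 2 (volume : Measure (Euc d))}
  {K : Euc d → Euc d → 𝕜} {C : ℝ} {ω : ℝ → ℝ}

theorem side_le_norm_sub_of_notMem_dil (hd : 1 ≤ d) {P : DyadicIndex d} {x y : Euc d}
    (hx : x ∈ cube P) (hy : y ∉ dil P) : side P ≤ ‖x - y‖ := by
  rw [norm_sub_rev]
  exact side_le_norm_sub hd hy hx

theorem IsCZKernel.integrable_mul (hd : 1 ≤ d) (hω : IsDiniModulus ω) (hK : IsCZKernel K C ω)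
    {f : Euc d → 𝕜} (hf : MemLp f 1 volume) {P : DyadicIndex d} {x : Euc d} (hx : x ∈ cube P)
    (h0 : ∀ y ∈ dil P, f y = 0) : Integrable (fun y => K x y * f y) volume := by
  refine (integrableOn_iff_integrable_of_support_subset (s := (dil P)ᶜ) fun y hy hyP => hy ?_).1
    (hK.integrableOn hd hω (side_pos P) (measurableSet_dil P).compl
      (fun y hy => side_le_norm_sub_of_notMem_dil hd hx hy)
      (memLp_one_iff_integrable.1 hf).integrableOn)
  simp only [h0 y hyP, mul_zero]

/-- The representation is given only for bounded functions, so it is passed to the limit along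
truncations by dominated convergence. Points of `cube P` are interior to `dil P`, hence off the
supports. -/
theorem IsWeakTypeExtension.ae_eq_integral (hd : 1 ≤ d) (hω : IsDiniModulus ω)
    (hK : IsCZKernel K C ω) (hT : HasKernel T K)
    {T₁ : Lp 𝕜 1 (volume : Measure (Euc d)) →ₗ[𝕜] (Euc d →ₘ[volume] 𝕜)}
    (hT₁ : IsWeakTypeExtension T T₁) {f : Euc d → 𝕜} (hf : MemLp f 1 volume) {P : DyadicIndex d}
    (h0 : ∀ y ∈ dil P, f y = 0) :
    ∀ᵐ x ∂(volume : Measure (Euc d)), x ∈ cube P → T₁ (hf.toLp f) x = ∫ y, K x y * f y := by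
  obtain ⟨ns, hns, hlim⟩ := (hT₁.tendstoInMeasure_trunc hf).exists_seq_tendsto_ae
  have hrep : ∀ᵐ x ∂(volume : Measure (Euc d)), ∀ n, x ∉ tsupport (trunc f n) →
      T ((memLp_trunc hf.1 n 2).toLp (trunc f n)) x = ∫ y, K x y * trunc f n y :=
    ae_all_iff.2 fun n => hT _ (memLp_trunc hf.1 n 2) (memLp_trunc hf.1 n ∞)
      (hasCompactSupport_trunc f n)
  filter_upwards [hlim, hrep] with x hx hxrep hxP
  have hsupp : ∀ n, x ∉ tsupport (trunc f n) := fun n => by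
    rw [notMem_tsupport_iff_eventuallyEq]
    filter_upwards [dil_mem_nhds hd hxP] with y hy
    exact trunc_eq_zero (h0 y hy) n
  have h1 : Tendsto (fun n => ∫ y, K x y * trunc f n y) atTop (𝓝 (∫ y, K x y * f y)) := by
    refine tendsto_integral_of_dominated_convergence (fun y => ‖K x y * f y‖) (fun n => ?_)
      (hK.integrable_mul hd hω hf hxP h0).norm (fun n => ae_of_all _ fun y => ?_)
      (ae_of_all _ fun y => (tendsto_trunc f y).const_mul _)
    · exact (hK.integrable_mul hd hω (memLp_trunc hf.1 n 1) hxP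
        fun y hy => trunc_eq_zero (h0 y hy) n).1
    · rw [norm_mul, norm_mul]
      exact mul_le_mul_of_nonneg_left (norm_trunc_le f n y) (norm_nonneg _)
  have h2 := h1.comp hns.tendsto_atTop
  refine tendsto_nhds_unique hx (h2.congr fun n => ?_)
  exact (hxrep _ (hsupp _)).symm

/-- Abstract properties of the functions `T (f χ_{dil Q})`. -/
structure IsLocalFamily (K : Euc d → Euc d → 𝕜) (f : Euc d → 𝕜) (B : ℝ≥0∞)
    (F : DyadicIndex d → Euc d → 𝕜) : Prop where
  weak : ∀ (Q : DyadicIndex d) (s : ℝ≥0∞), s ≠ 0 → s ≠ ∞ →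
    volume {x | 2 * B * s < ‖F Q x‖ₑ} ≤ weakConst d * ((∫⁻ y in dil Q, ‖f y‖ₑ) / s)
  zero : ∀ Q, ∫⁻ y in dil Q, ‖f y‖ₑ = 0 → F Q =ᵐ[volume] 0
  sub : ∀ P Q : DyadicIndex d, cube P ⊆ cube Q → ∀ᵐ x ∂(volume : Measure (Euc d)), x ∈ cube P →
    F Q x = F P x + ∫ y in dil Q \ dil P, K x y * f y

theorem eLpNorm_indicator_dil (f : Euc d → 𝕜) (Q : DyadicIndex d) :
    eLpNorm ((dil Q).indicator f) 1 volume = ∫⁻ y in dil Q, ‖f y‖ₑ := by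
  rw [eLpNorm_indicator_eq_eLpNorm_restrict (measurableSet_dil Q), eLpNorm_one_eq_lintegral_enorm]

/-- The relation `sub` is linearity combined with the integral representation of `T₁` on the part of
`f` living on `dil Q \ dil P`. -/
theorem IsWeakTypeExtension.isLocalFamily (hd : 1 ≤ d) (hω : IsDiniModulus ω)
    (hK : IsCZKernel K C ω) (hT : HasKernel T K)
    {T₁ : Lp 𝕜 1 (volume : Measure (Euc d)) →ₗ[𝕜] (Euc d →ₘ[volume] 𝕜)}
    (hT₁ : IsWeakTypeExtension T T₁) {B : ℝ≥0∞} (hB : HasWeakBound T B) {f : Euc d → 𝕜}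
    (hf : MemLp f 1 volume) :
    IsLocalFamily K f B
      fun Q => T₁ ((hf.indicator (measurableSet_dil Q)).toLp ((dil Q).indicator f)) where
  weak Q s hs hs' := by
    have hfQ : MemLp ((dil Q).indicator f) 1 volume := hf.indicator (measurableSet_dil Q)
    have h := (hT₁.isL1Limit hfQ).measure_le hfQ hB hs hs'
    rw [eLpNorm_indicator_dil] at h
    exact h
  zero Q hQ := by
    have h0 : (hf.indicator (measurableSet_dil Q)).toLp ((dil Q).indicator f) = 0 := by
      rw [← enorm_eq_zero, Lp.enorm_toLp, eLpNorm_indicator_dil, hQ]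
    rw [h0, map_zero]
    exact AEEqFun.coeFn_zero
  sub P Q hPQ := by
    have hQP := hf.indicator ((measurableSet_dil Q).diff (measurableSet_dil P))
    have h1 := hT₁.ae_eq_integral hd hω hK hT hQP (P := P) fun y hy =>
      indicator_of_notMem (fun h => h.2 hy) _
    have h2 : (hf.indicator (measurableSet_dil Q)).toLp ((dil Q).indicator f) =
        (hf.indicator (measurableSet_dil P)).toLp ((dil P).indicator f) +
          hQP.toLp ((dil Q \ dil P).indicator f) := by
      rw [← MemLp.toLp_add]
      congr 1
      ext y
      have hsub := dil_subset_dil hd hPQ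
      by_cases hy : y ∈ dil P
      · simp [hy, hsub hy]
      · by_cases hy' : y ∈ dil Q <;> simp [hy, hy']
    rw [h2, map_add]
    filter_upwards [h1, AEEqFun.coeFn_add
      (T₁ ((hf.indicator (measurableSet_dil P)).toLp ((dil P).indicator f)))
      (T₁ (hQP.toLp ((dil Q \ dil P).indicator f)))] with x hx hx2 hxP
    rw [hx2, Pi.add_apply, hx hxP]
    congr 1
    rw [← integral_indicator ((measurableSet_dil Q).diff (measurableSet_dil P))]
    congr 1
    ext y
    by_cases hy : y ∈ dil Q \ dil P <;> simp [hy]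

/-- The average of `|f|` over the dilate of `Q`. -/
noncomputable def dilAverage (f : Euc d → 𝕜) (Q : DyadicIndex d) : ℝ≥0∞ :=
  (volume (dil Q))⁻¹ * ∫⁻ y in dil Q, ‖f y‖ₑ

theorem lintegral_dil_eq (f : Euc d → 𝕜) (Q : DyadicIndex d) :
    ∫⁻ y in dil Q, ‖f y‖ₑ = dilAverage f Q * volume (dil Q) := by
  rw [dilAverage, mul_comm, ← mul_assoc,
    ENNReal.mul_inv_cancel (volume_dil_ne_zero Q) (volume_dil_ne_top Q), one_mul]

theorem dilAverage_ne_top {f : Euc d → 𝕜} (hf : MemLp f 1 volume) (Q : DyadicIndex d) :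
    dilAverage f Q ≠ ∞ := by
  refine ENNReal.mul_ne_top (ENNReal.inv_ne_top.2 (volume_dil_ne_zero Q)) ?_
  exact ((memLp_one_iff_integrable.1 hf).integrableOn.hasFiniteIntegral).ne

/-- The height at which the stopping sets are chosen, relative to the average. -/
noncomputable def heightConst (d : ℕ) : ℝ≥0∞ :=
  2 ^ (d + 4) * (weakConst d + maximalConst d + 1) * ENNReal.ofReal (dilFactor d) ^ d

theorem heightConst_ne_top : heightConst d ≠ ∞ := by
  have h1 := maximalConst_ne_top (d := d)
  have h2 := weakConst_ne_top (d := d)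
  unfold heightConst
  finiteness

theorem ofReal_dilFactor_pow_ne_zero : ENNReal.ofReal (dilFactor d) ^ d ≠ 0 :=
  pow_ne_zero _ (by simpa using dilFactor_pos)

theorem heightConst_ne_zero : heightConst d ≠ 0 :=
  mul_ne_zero (mul_ne_zero (by simp) (by simp)) ofReal_dilFactor_pow_ne_zero

theorem height_estimate {c lam : ℝ≥0∞} (hc : c ≤ weakConst d + maximalConst d + 1)
    (hlam : lam ≠ 0) (hlam' : lam ≠ ∞) (Q : DyadicIndex d) :
    2 ^ (d + 4) * (c * (lam * volume (dil Q) / (heightConst d * lam))) ≤ volume (cube Q) := by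
  have h0 := heightConst_ne_zero (d := d)
  have h1 := heightConst_ne_top (d := d)
  rw [mul_comm (heightConst d), ENNReal.mul_div_mul_left _ _ hlam hlam', volume_dil,
    ← mul_div_assoc, ← mul_div_assoc]
  refine ENNReal.div_le_of_le_mul ?_
  calc 2 ^ (d + 4) * (c * (ENNReal.ofReal (dilFactor d) ^ d * volume (cube Q)))
      = volume (cube Q) * (2 ^ (d + 4) * c * ENNReal.ofReal (dilFactor d) ^ d) := by ring
    _ ≤ volume (cube Q) * heightConst d :=
        mul_le_mul_right (mul_le_mul_left (mul_le_mul_right hc _) _) _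

/-! ### Exceptional sets and the one-step estimate -/

variable {f : Euc d → 𝕜} {B : ℝ≥0∞} {F : DyadicIndex d → Euc d → 𝕜}

theorem IsLocalFamily.volume_le (hF : IsLocalFamily K f B F) (hf : MemLp f 1 volume)
    (Q : DyadicIndex d) :
    2 ^ (d + 4) * volume {x | 2 * B * (heightConst d * dilAverage f Q) < ‖F Q x‖ₑ} ≤
      volume (cube Q) := by
  by_cases h0 : dilAverage f Q = 0
  · have h1 := hF.zero Q (by rw [lintegral_dil_eq, h0, zero_mul])
    have h2 : volume {x | 2 * B * (heightConst d * dilAverage f Q) < ‖F Q x‖ₑ} = 0 := by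
      refine measure_mono_null (fun x hx => ?_) (ae_iff.1 h1)
      have hx : 2 * B * (heightConst d * dilAverage f Q) < ‖F Q x‖ₑ := hx
      intro h
      rw [h] at hx
      simp at hx
    rw [h2, mul_zero]
    exact zero_le
  · have htop := dilAverage_ne_top hf Q
    refine (mul_le_mul_right (hF.weak Q _ (mul_ne_zero heightConst_ne_zero h0)
      (ENNReal.mul_ne_top heightConst_ne_top htop)) _).trans ?_
    rw [lintegral_dil_eq]
    refine height_estimate ?_ h0 htop Q
    rw [add_assoc]
    exact le_self_add

theorem volume_maximalSet_indicator_le (hd : 1 ≤ d) (hf : MemLp f 1 volume) (Q : DyadicIndex d) :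
    2 ^ (d + 4) * volume (maximalSet (fun y => ‖(dil Q).indicator f y‖ₑ)
      (heightConst d * dilAverage f Q)) ≤ volume (cube Q) := by
  have hint : ∫⁻ y, ‖(dil Q).indicator f y‖ₑ = dilAverage f Q * volume (dil Q) := by
    simp_rw [enorm_indicator_eq_indicator_enorm]
    rw [lintegral_indicator (measurableSet_dil Q), lintegral_dil_eq]
  have htop := dilAverage_ne_top hf Q
  by_cases h0 : dilAverage f Q = 0
  · have h2 : maximalSet (fun y => ‖(dil Q).indicator f y‖ₑ)
        (heightConst d * dilAverage f Q) = ∅ := by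
      refine eq_empty_of_forall_notMem ?_
      rintro x ⟨r, -, hr⟩
      have h3 : ∫⁻ y in closedBall x r, ‖(dil Q).indicator f y‖ₑ ≤ 0 :=
        (setLIntegral_le_lintegral _ _).trans (by rw [hint, h0, zero_mul])
      exact absurd (hr.trans_le h3) not_lt_zero
    rw [h2]
    simp
  · refine (mul_le_mul_right (volume_maximalSet_le hd ?_ (mul_ne_zero heightConst_ne_zero h0)
      (ENNReal.mul_ne_top heightConst_ne_top htop)) _).trans ?_
    · rw [hint]
      exact ENNReal.mul_ne_top htop (volume_dil_ne_top Q)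
    · rw [hint]
      refine height_estimate ?_ h0 htop Q
      rw [add_right_comm]
      exact le_add_self

theorem IsLocalFamily.exists_isExceptional (hd : 1 ≤ d) (hF : IsLocalFamily K f B F)
    (hf : MemLp f 1 volume) :
    ∃ O : DyadicIndex d → Set (Euc d), IsExceptional O ∧ ∀ Q x, x ∉ O Q →
      ‖F Q x‖ₑ ≤ 2 * B * (heightConst d * dilAverage f Q) ∧
        x ∉ maximalSet (fun y => ‖(dil Q).indicator f y‖ₑ) (heightConst d * dilAverage f Q) := by
  have hex : ∀ Q : DyadicIndex d, ∃ U : Set (Euc d), IsOpen U ∧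
      2 ^ (d + 2) * volume U ≤ volume (cube Q) ∧
      ({x | 2 * B * (heightConst d * dilAverage f Q) < ‖F Q x‖ₑ} ∪
        maximalSet (fun y => ‖(dil Q).indicator f y‖ₑ) (heightConst d * dilAverage f Q)) ⊆ U := by
    intro Q
    set E₁ := {x | 2 * B * (heightConst d * dilAverage f Q) < ‖F Q x‖ₑ}
    set E₂ := maximalSet (fun y => ‖(dil Q).indicator f y‖ₑ) (heightConst d * dilAverage f Q)
    have h1 := hF.volume_le hf Q
    have h2 := volume_maximalSet_indicator_le hd hf Q
    have hp : (2 : ℝ≥0∞) ^ (d + 4) ≠ 0 := by simp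
    have hp' : (2 : ℝ≥0∞) ^ (d + 4) ≠ ∞ := by finiteness
    have hε : volume (cube Q) / 2 ^ (d + 4) ≠ 0 :=
      (ENNReal.div_pos (volume_cube_ne_zero Q) hp').ne'
    obtain ⟨U, hEU, hU, hvol⟩ := (E₁ ∪ E₂).exists_isOpen_le_add volume hε
    refine ⟨U, hU, ?_, hEU⟩
    -- The two level sets and the slack of the open enlargement each use `|Q| / 2 ^ (d + 4)`;
    -- rounding three up to four leaves `|Q| / 2 ^ (d + 2)`.
    have h3 : 2 ^ (d + 4) * volume U ≤ 4 * volume (cube Q) := by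
      calc 2 ^ (d + 4) * volume U
          ≤ 2 ^ (d + 4) * (volume E₁ + volume E₂ + volume (cube Q) / 2 ^ (d + 4)) :=
            mul_le_mul_right (hvol.trans (add_le_add_left (measure_union_le _ _) _)) _
        _ = 2 ^ (d + 4) * volume E₁ + 2 ^ (d + 4) * volume E₂ + volume (cube Q) := by
            rw [mul_add, mul_add, ENNReal.mul_div_cancel hp hp']
        _ ≤ volume (cube Q) + volume (cube Q) + volume (cube Q) :=
            add_le_add_left (add_le_add h1 h2) _
        _ = 3 * volume (cube Q) := by ring
        _ ≤ 4 * volume (cube Q) := mul_le_mul_left (by norm_num) _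
    have h4 : (2 : ℝ≥0∞) ^ (d + 4) * volume U = 4 * (2 ^ (d + 2) * volume U) := by ring
    rw [h4] at h3
    exact (ENNReal.mul_le_mul_iff_right (by simp) (by simp)).1 h3
  choose O hO1 hO2 hO3 using hex
  refine ⟨O, ⟨hO1, hO2⟩, fun Q x hx => ⟨?_, fun h => hx (hO3 Q (Or.inr h))⟩⟩
  exact not_lt.1 fun h => hx (hO3 Q (Or.inl h))

/-- The comparison constant for averages. -/
noncomputable def averageConst (d : ℕ) : ℝ≥0∞ := heightConst d * ENNReal.ofReal (Real.sqrt d) ^ d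

/-- The constant in the one-step kernel estimate. -/
noncomputable def stepConst (d : ℕ) : ℝ≥0∞ :=
  2 ^ (d + 1) * heightConst d + 2 * heightConst d * (1 + averageConst d)

/-- A ball around `x` with radius `√d` times the side of `dil P` contains `dil P`, and the maximal
function bound at `x` applies to it. -/
theorem dilAverage_le_of_notMem (hd : 1 ≤ d) {P Q : DyadicIndex d} (hPQ : cube P ⊆ cube Q)
    {x : Euc d} (hx : x ∈ cube P)
    (hxm : x ∉ maximalSet (fun y => ‖(dil Q).indicator f y‖ₑ) (heightConst d * dilAverage f Q)) :
    dilAverage f P ≤ averageConst d * dilAverage f Q := by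
  have hr : 0 < Real.sqrt d * (dilFactor d * side P) :=
    mul_pos (Real.sqrt_pos.2 (by exact_mod_cast hd)) (mul_pos dilFactor_pos (side_pos P))
  have h1 := lintegral_closedBall_le_of_notMem_maximalSet hxm _ hr
  have h2 : ∫⁻ y in dil P, ‖f y‖ₑ ≤
      ∫⁻ y in closedBall x (Real.sqrt d * (dilFactor d * side P)), ‖(dil Q).indicator f y‖ₑ := by
    calc ∫⁻ y in dil P, ‖f y‖ₑ = ∫⁻ y in dil P, ‖(dil Q).indicator f y‖ₑ :=
          setLIntegral_congr_fun (measurableSet_dil P) fun y hy => by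
            simp only [indicator_of_mem (dil_subset_dil hd hPQ hy)]
      _ ≤ _ := lintegral_mono_set fun y hy => by
          rw [mem_closedBall, dist_comm, dist_eq_norm]
          exact norm_sub_le_of_mem_dil hx hy
  have h3 := h2.trans h1
  rw [lintegral_dil_eq, mul_pow, ENNReal.ofReal_mul (by positivity),
    ENNReal.ofReal_pow (mul_pos dilFactor_pos (side_pos P)).le, ← volume_box (dilCorner P),
    ENNReal.ofReal_pow (Real.sqrt_nonneg _), ← mul_assoc] at h3
  have h4 := (ENNReal.mul_le_mul_iff_left (volume_dil_ne_zero P) (volume_dil_ne_top P)).1 h3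
  refine h4.trans (le_of_eq ?_)
  rw [averageConst]
  ring

/-- The one-step estimate: between `P` and `Q` with `P` not inside a stopping child of `Q`. -/
theorem IsLocalFamily.step (hd : 1 ≤ d) (hω : IsDiniModulus ω) (hK : IsCZKernel K C ω)
    (hBω : ENNReal.ofReal (diniConst ω) ≤ B)
    (hF : IsLocalFamily K f B F) (hf : MemLp f 1 volume) {O : DyadicIndex d → Set (Euc d)}
    (hO : IsExceptional O)
    (hOF : ∀ Q x, x ∉ O Q → ‖F Q x‖ₑ ≤ 2 * B * (heightConst d * dilAverage f Q) ∧
        x ∉ maximalSet (fun y => ‖(dil Q).indicator f y‖ₑ) (heightConst d * dilAverage f Q))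
    {P Q : DyadicIndex d} (hPQ : cube P ⊆ cube Q)
    (hterm : ∀ P' ∈ stopping (O Q), cube P ⊆ cube P' → P' = P) {x : Euc d} (hx : x ∈ cube P) :
    dilAverage f P ≤ averageConst d * dilAverage f Q ∧
      ‖∫ y in dil Q \ dil P, K x y * f y‖ₑ ≤ stepConst d * (B * dilAverage f Q) := by
  -- Counting measure in `P`: `O Q` takes at most a half, the level set of `F P` at most a quarter,
  -- and the failure set of the difference formula is null.
  obtain ⟨z, hzP, hzO, hzF, hzsub⟩ : ∃ z ∈ cube P, z ∉ O Q ∧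
      ‖F P z‖ₑ ≤ 2 * B * (heightConst d * dilAverage f P) ∧
      F Q z = F P z + ∫ y in dil Q \ dil P, K z y * f y := by
    by_contra hn
    push Not at hn
    set E := {x | 2 * B * (heightConst d * dilAverage f P) < ‖F P x‖ₑ} with hE
    set N := {z | ¬ (z ∈ cube P → F Q z = F P z + ∫ y in dil Q \ dil P, K z y * f y)} with hN
    have hcov : cube P ⊆ (cube P ∩ O Q) ∪ E ∪ N := by
      intro z hz
      by_cases h1 : z ∈ O Q
      · exact Or.inl (Or.inl ⟨hz, h1⟩)
      by_cases h2 : z ∈ E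
      · exact Or.inl (Or.inr h2)
      · exact Or.inr fun h => hn z hz h1 (not_lt.1 h2) (h hz)
    have hN0 : volume N = 0 := ae_iff.1 (hF.sub P Q hPQ)
    have h1 := two_mul_volume_inter_le hd (hO.volume_ne_top Q) hterm
    have h2 : 4 * volume E ≤ volume (cube P) := by
      refine le_trans (mul_le_mul_left ?_ _) (hF.volume_le hf P)
      calc (4 : ℝ≥0∞) = 2 ^ 2 := by norm_num
        _ ≤ 2 ^ (d + 4) := pow_le_pow_right₀ one_le_two (by omega)
    have h3 : volume (cube P) ≤ volume (cube P ∩ O Q) + volume E := by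
      refine (measure_mono hcov).trans ((measure_union_le _ _).trans ?_)
      rw [hN0, add_zero]
      exact measure_union_le _ _
    have h4 : 4 * volume (cube P) ≤ 3 * volume (cube P) := by
      calc 4 * volume (cube P) ≤ 4 * (volume (cube P ∩ O Q) + volume E) := mul_le_mul_right h3 _
        _ = 2 * (2 * volume (cube P ∩ O Q)) + 4 * volume E := by ring
        _ ≤ 2 * volume (cube P) + volume (cube P) := add_le_add (mul_le_mul_right h1 _) h2
        _ = 3 * volume (cube P) := by ring
    have h5 := (ENNReal.mul_le_mul_iff_left (volume_cube_ne_zero P) (volume_cube_ne_top P)).1 h4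
    norm_num at h5
  have hzQ := hOF Q z hzO
  have havg := dilAverage_le_of_notMem hd hPQ hzP hzQ.2
  refine ⟨havg, ?_⟩
  have hm : MeasurableSet (dil Q \ dil P) := (measurableSet_dil Q).diff (measurableSet_dil P)
  have hint : ∀ w ∈ cube P, IntegrableOn (fun y => K w y * f y) (dil Q \ dil P) := fun w hw =>
    hK.integrableOn hd hω (side_pos P) hm
      (fun y hy => side_le_norm_sub_of_notMem_dil hd hw hy.2)
      (memLp_one_iff_integrable.1 hf).integrableOn
  -- The integral at `x` is the one at `z`, which is `F Q z - F P z`, up to the oscillation of the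
  -- kernel. No exceptional set for `x` is left.
  have e1 : ∫ y in dil Q \ dil P, K x y * f y =
      (F Q z - F P z) - ∫ y in dil Q \ dil P, (K z y - K x y) * f y := by
    have h1 : ∫ y in dil Q \ dil P, K z y * f y = F Q z - F P z := by rw [hzsub]; ring
    rw [← h1]
    simp_rw [sub_mul]
    rw [integral_sub (hint z hzP) (hint x hx)]
    ring
  have hosc : ‖∫ y in dil Q \ dil P, (K z y - K x y) * f y‖ₑ ≤
      2 ^ (d + 1) * (heightConst d * dilAverage f Q) * B := by
    have h1 := hK.isSmoothFst.lintegral_sub_le hω (sqrt_mul_side_pos hd P)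
      (norm_sub_le_of_mem_cube hzP hx)
      (lintegral_closedBall_le_of_notMem_maximalSet hzQ.2)
    refine le_trans ?_ (h1.trans (mul_le_mul_right hBω _))
    refine (enorm_integral_le_lintegral_enorm _).trans ?_
    calc ∫⁻ y in dil Q \ dil P, ‖(K z y - K x y) * f y‖ₑ
        = ∫⁻ y in dil Q \ dil P, ‖K z y - K x y‖ₑ * ‖(dil Q).indicator f y‖ₑ :=
          setLIntegral_congr_fun hm fun y hy => by
            simp only [indicator_of_mem hy.1, enorm_mul]
      _ ≤ _ := lintegral_mono_set fun y hy => sqrt_lt_norm_sub_of_notMem_dil hzP hy.2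
  rw [e1]
  calc ‖(F Q z - F P z) - ∫ y in dil Q \ dil P, (K z y - K x y) * f y‖ₑ
      ≤ (‖F Q z‖ₑ + ‖F P z‖ₑ) + ‖∫ y in dil Q \ dil P, (K z y - K x y) * f y‖ₑ :=
        enorm_sub_le.trans (add_le_add_left enorm_sub_le _)
    _ ≤ (2 * B * (heightConst d * dilAverage f Q) +
          2 * B * (heightConst d * (averageConst d * dilAverage f Q))) +
          2 ^ (d + 1) * (heightConst d * dilAverage f Q) * B :=
        add_le_add (add_le_add hzQ.1 (hzF.trans
          (mul_le_mul_right (mul_le_mul_right havg _) _))) hosc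
    _ = stepConst d * (B * dilAverage f Q) := by
        rw [stepConst]
        ring

end Local

end SparseCZ

namespace SparseCZ

open Set Filter Topology Metric

variable {d : ℕ} {𝕜 : Type*} [RCLike 𝕜]

/-! ### Sparse domination -/

/-- The sum of the averages over the tree cubes between `P` and `Q`. -/
noncomputable def chainSum (O : DyadicIndex d → Set (Euc d)) (A : Set (Euc d)) (f : Euc d → 𝕜)
    (P Q : DyadicIndex d) : ℝ≥0∞ :=
  ∑' R : DyadicIndex d,
    {R ∈ tree O A | cube P ⊆ cube R ∧ cube R ⊆ cube Q}.indicator (dilAverage f) R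

section

variable {O : DyadicIndex d → Set (Euc d)} {A : Set (Euc d)} {f : Euc d → 𝕜}

theorem dilAverage_le_chainSum {P Q : DyadicIndex d} (hQ : Q ∈ tree O A)
    (hPQ : cube P ⊆ cube Q) : dilAverage f Q ≤ chainSum O A f P Q := by
  refine le_trans (le_of_eq ?_) (ENNReal.le_tsum Q)
  exact (indicator_of_mem (s := {R ∈ tree O A | cube P ⊆ cube R ∧ cube R ⊆ cube Q})
    ⟨hQ, hPQ, subset_rfl⟩ _).symm

/-- As `Q` is not contained in `R`, its average is not already counted in the sum up to `R`. -/
theorem add_chainSum_le {P R Q : DyadicIndex d} (hQ : Q ∈ tree O A) (hPQ : cube P ⊆ cube Q)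
    (hRQ : cube R ⊆ cube Q) (hn : ¬ cube Q ⊆ cube R) :
    dilAverage f Q + chainSum O A f P R ≤ chainSum O A f P Q := by
  classical
  have h1 : dilAverage f Q =
      ∑' R' : DyadicIndex d, ({Q} : Set (DyadicIndex d)).indicator (dilAverage f) R' := by
    rw [tsum_eq_single Q]
    · simp
    · intro b hb
      exact indicator_of_notMem (s := ({Q} : Set (DyadicIndex d))) hb (dilAverage f)
  rw [chainSum, h1, ← ENNReal.tsum_add]
  refine ENNReal.tsum_le_tsum fun R' => ?_
  by_cases hR' : R' = Q
  · subst hR'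
    rw [indicator_of_mem (mem_singleton _), indicator_of_notMem (fun h => hn h.2.2), add_zero,
      indicator_of_mem]
    exact ⟨hQ, hPQ, subset_rfl⟩
  · rw [indicator_of_notMem (show R' ∉ ({Q} : Set _) from hR'), zero_add]
    have hsub : {S ∈ tree O A | cube P ⊆ cube S ∧ cube S ⊆ cube R} ⊆
        {S ∈ tree O A | cube P ⊆ cube S ∧ cube S ⊆ cube Q} := fun S hS =>
      ⟨hS.1, hS.2.1, hS.2.2.trans hRQ⟩
    exact indicator_le_indicator_of_subset hsub (fun _ => zero_le) R'

theorem sparseOp_image_dil (hd : 1 ≤ d) (f : Euc d → 𝕜) (x : Euc d) :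
    sparseOp (dil '' tree O A) f x =
      ∑' R : DyadicIndex d, (tree O A).indicator
        (fun R => (dil R).indicator (fun _ => dilAverage f R) x) R := by
  rw [sparseOp, tsum_image (fun R : Set (Euc d) => R.indicator
    (fun _ => (volume R)⁻¹ * ∫⁻ y in R, ‖f y‖ₑ) x) (dil_injective hd).injOn]
  exact tsum_subtype (tree O A) fun R => (dil R).indicator (fun _ => dilAverage f R) x

theorem chainSum_le_sparseOp (hd : 1 ≤ d) {P Q : DyadicIndex d} {x : Euc d} (hx : x ∈ cube P) :
    chainSum O A f P Q ≤ sparseOp (dil '' tree O A) f x := by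
  rw [sparseOp_image_dil hd]
  refine ENNReal.tsum_le_tsum fun R => ?_
  by_cases hR : R ∈ {R ∈ tree O A | cube P ⊆ cube R ∧ cube R ⊆ cube Q}
  · rw [indicator_of_mem hR, indicator_of_mem hR.1,
      indicator_of_mem (cube_subset_dil hd R (hR.2.1 hx))]
  · rw [indicator_of_notMem hR]
    exact zero_le

end

/-- The constant in the estimate along a chain of stopping cubes. -/
noncomputable def chainConst (d : ℕ) : ℝ≥0∞ := averageConst d + stepConst d

theorem chainConst_ne_top : chainConst d ≠ ∞ := by
  have h1 := heightConst_ne_top (d := d)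
  unfold chainConst stepConst averageConst
  finiteness

/-- The constant in the sparse bounds. -/
noncomputable def sparseConst (d : ℕ) : ℝ≥0∞ :=
  (1 + ENNReal.ofReal (dilFactor d) ^ d + 2 * heightConst d) * chainConst d

theorem sparseConst_ne_top : sparseConst d ≠ ∞ := by
  have h1 := heightConst_ne_top (d := d)
  have h2 := chainConst_ne_top (d := d)
  unfold sparseConst
  finiteness

/-! ### Telescoping along the tree and the two sparse bounds -/

section

variable {T : Lp 𝕜 2 (volume : Measure (Euc d)) →L[𝕜] Lp 𝕜 2 (volume : Measure (Euc d))}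
  {K : Euc d → Euc d → 𝕜} {C : ℝ} {ω : ℝ → ℝ} {f : Euc d → 𝕜} {B : ℝ≥0∞}
  {F : DyadicIndex d → Euc d → 𝕜} {O : DyadicIndex d → Set (Euc d)} {A : Set (Euc d)}

/-- Induction on the generation gap. If no stopping cube other than `P` contains `P`, one step
suffices. Otherwise one step goes from `Q` to its child `R ⊇ P`, and induction goes from `R` to `P`.
The cube `P` need not belong to the tree, which is what the truncations require. The average over
`dil P` is carried along to absorb the final local term. -/
theorem IsLocalFamily.chain (hd : 1 ≤ d) (hω : IsDiniModulus ω) (hK : IsCZKernel K C ω)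
    (hBω : ENNReal.ofReal (diniConst ω) ≤ B)
    (hF : IsLocalFamily K f B F) (hf : MemLp f 1 volume) (hO : IsExceptional O)
    (hOF : ∀ Q x, x ∉ O Q → ‖F Q x‖ₑ ≤ 2 * B * (heightConst d * dilAverage f Q) ∧
        x ∉ maximalSet (fun y => ‖(dil Q).indicator f y‖ₑ) (heightConst d * dilAverage f Q))
    {P Q : DyadicIndex d} (hQ : Q ∈ tree O A) (hPQ : cube P ⊆ cube Q) {x : Euc d}
    (hx : x ∈ cube P) :
    B * dilAverage f P + ‖∫ y in dil Q \ dil P, K x y * f y‖ₑ ≤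
      chainConst d * (B * chainSum O A f P Q) := by
  obtain ⟨n, hn⟩ : ∃ n : ℕ, Q.1 - P.1 < n := ⟨(Q.1 - P.1).toNat + 1, by omega⟩
  induction n generalizing Q with
  | zero =>
    have := generation_le_of_subset hd hPQ
    omega
  | succ n ih =>
    by_cases hterm : ∀ P' ∈ stopping (O Q), cube P ⊆ cube P' → P' = P
    · obtain ⟨h1, h2⟩ := hF.step hd hω hK hBω hf hO hOF hPQ hterm hx
      calc B * dilAverage f P + ‖∫ y in dil Q \ dil P, K x y * f y‖ₑ
          ≤ B * (averageConst d * dilAverage f Q) + stepConst d * (B * dilAverage f Q) :=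
            add_le_add (mul_le_mul_right h1 _) h2
        _ = chainConst d * (B * dilAverage f Q) := by rw [chainConst]; ring
        _ ≤ _ := mul_le_mul_right (mul_le_mul_right (dilAverage_le_chainSum hQ hPQ) _) _
    · push Not at hterm
      obtain ⟨R, hR, hPR, -⟩ := hterm
      have hRc : R ∈ children O Q := hO.mem_children hR (hPR hx) (hPQ hx)
      have hlt := hO.generation_lt hd hRc
      have h1 := ih (children_mem_tree hQ hRc) hPR (by push_cast at hn; omega)
      have h2 := (hF.step hd hω hK hBω hf hO hOF hRc.2
        (fun P' hP' h => stopping_eq_of_subset hR hP' h) (hPR hx)).2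
      have hnot : ¬ cube Q ⊆ cube R := fun h => by
        have := generation_le_of_subset hd h
        omega
      have hRQ := dil_subset_dil hd hRc.2
      have hPR' := dil_subset_dil hd hPR
      have hint : ∀ S S' : DyadicIndex d, cube P ⊆ cube S' →
          IntegrableOn (fun y => K x y * f y) (dil S \ dil S') := fun S S' hS' =>
        hK.integrableOn hd hω (side_pos S') ((measurableSet_dil S).diff (measurableSet_dil S'))
          (fun y hy => side_le_norm_sub_of_notMem_dil hd (hS' hx) hy.2)
          (memLp_one_iff_integrable.1 hf).integrableOn
      have e1 : ∫ y in dil Q \ dil P, K x y * f y =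
          (∫ y in dil Q \ dil R, K x y * f y) + ∫ y in dil R \ dil P, K x y * f y := by
        rw [← setIntegral_union (Set.disjoint_left.2 fun y hy hy' => hy.2 hy'.1)
          ((measurableSet_dil R).diff (measurableSet_dil P)) (hint Q R hPR) (hint R P subset_rfl),
          sdiff_union_sdiff_cancel hRQ hPR']
      rw [e1]
      calc B * dilAverage f P +
            ‖(∫ y in dil Q \ dil R, K x y * f y) + ∫ y in dil R \ dil P, K x y * f y‖ₑ
          ≤ B * dilAverage f P + (‖∫ y in dil Q \ dil R, K x y * f y‖ₑ +
              ‖∫ y in dil R \ dil P, K x y * f y‖ₑ) := add_le_add_right (enorm_add_le _ _) _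
        _ = ‖∫ y in dil Q \ dil R, K x y * f y‖ₑ + (B * dilAverage f P +
              ‖∫ y in dil R \ dil P, K x y * f y‖ₑ) := by ring
        _ ≤ chainConst d * (B * dilAverage f Q) + chainConst d * (B * chainSum O A f P R) :=
            add_le_add (h2.trans (mul_le_mul_left le_add_self _)) h1
        _ = chainConst d * (B * (dilAverage f Q + chainSum O A f P R)) := by ring
        _ ≤ _ := mul_le_mul_right (mul_le_mul_right (add_chainSum_le hQ hPQ hRc.2 hnot) _) _

/-- Almost every `x` lies in finitely many tree cubes below `Q`. If `P` is the smallest, then `x ∉ O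
P`, since otherwise a child of `P` would contain `x`. So `F P x` is bounded by an average, and the
chain estimate supplies the rest of `F Q x`. -/
theorem IsLocalFamily.ae_le_sparseOp (hd : 1 ≤ d) (hω : IsDiniModulus ω) (hK : IsCZKernel K C ω)
    (hBω : ENNReal.ofReal (diniConst ω) ≤ B)
    (hF : IsLocalFamily K f B F) (hf : MemLp f 1 volume) (hO : IsExceptional O)
    (hOF : ∀ Q x, x ∉ O Q → ‖F Q x‖ₑ ≤ 2 * B * (heightConst d * dilAverage f Q) ∧
        x ∉ maximalSet (fun y => ‖(dil Q).indicator f y‖ₑ) (heightConst d * dilAverage f Q)) :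
    ∀ᵐ x ∂(volume : Measure (Euc d)), ∀ Q ∈ roots A, x ∈ cube Q →
      ‖F Q x‖ₑ ≤ sparseConst d * (B * sparseOp (dil '' tree O A) f x) := by
  have hfin : ∀ᵐ x ∂(volume : Measure (Euc d)), ∀ Q : DyadicIndex d,
      {P ∈ tree O A | cube P ⊆ cube Q ∧ x ∈ cube P}.Finite := ae_all_iff.2 fun Q => hO.ae_finite Q
  have hsub : ∀ᵐ x ∂(volume : Measure (Euc d)), ∀ P Q : DyadicIndex d, cube P ⊆ cube Q →
      x ∈ cube P → F Q x = F P x + ∫ y in dil Q \ dil P, K x y * f y := by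
    refine ae_all_iff.2 fun P => ae_all_iff.2 fun Q => ?_
    by_cases h : cube P ⊆ cube Q
    · filter_upwards [hF.sub P Q h] with x hx _ using hx
    · exact ae_of_all _ fun x h' => absurd h' h
  filter_upwards [hfin, hsub] with x hxfin hxsub Q hQ hxQ
  have hQt : Q ∈ tree O A := ⟨0, hQ⟩
  obtain ⟨P, ⟨hPt, hPQ, hxP⟩, hmin⟩ := exists_min_image _ (fun P : DyadicIndex d => P.1) (hxfin Q)
    ⟨Q, hQt, subset_rfl, hxQ⟩
  have hxO : x ∉ O P := fun h => by
    obtain ⟨R, hR, hxR⟩ := exists_mem_stopping_of_mem hd (hO.isOpen P) (hO.volume_ne_top P) h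
    have hRc := hO.mem_children hR hxR hxP
    have h1 := hmin R ⟨children_mem_tree hPt hRc, hRc.2.trans hPQ, hxR⟩
    have h2 := hO.generation_lt hd hRc
    omega
  have h1 := (hOF P x hxO).1
  have h2 := hF.chain hd hω hK hBω hf hO hOF hQt hPQ hxP
  have h3 : chainConst d * (B * chainSum O A f P Q) ≤
      chainConst d * (B * sparseOp (dil '' tree O A) f x) :=
    mul_le_mul_right (mul_le_mul_right (chainSum_le_sparseOp hd hxP) _) _
  rw [hxsub P Q hPQ hxP]
  calc ‖F P x + ∫ y in dil Q \ dil P, K x y * f y‖ₑ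
      ≤ ‖F P x‖ₑ + ‖∫ y in dil Q \ dil P, K x y * f y‖ₑ := enorm_add_le _ _
    _ ≤ 2 * heightConst d * (B * dilAverage f P) +
          1 * ‖∫ y in dil Q \ dil P, K x y * f y‖ₑ := by
        rw [one_mul]
        refine add_le_add_left (h1.trans (le_of_eq ?_)) _
        ring
    _ ≤ 2 * heightConst d * (chainConst d * (B * sparseOp (dil '' tree O A) f x)) +
          1 * (chainConst d * (B * sparseOp (dil '' tree O A) f x)) := by
        have h4 := h2.trans h3
        exact add_le_add (mul_le_mul_right (le_self_add.trans h4) _)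
          (mul_le_mul_right (le_add_self.trans h4) _)
    _ = (2 * heightConst d + 1) * chainConst d * (B * sparseOp (dil '' tree O A) f x) := by ring
    _ ≤ _ := by
        refine mul_le_mul_left (mul_le_mul_left ?_ _) _
        rw [add_comm]
        exact add_le_add_left le_self_add _

/-- The truncated integral splits into the part over `dil Q \ dil P`, given by the chain estimate,
and a part of `dil P` at distance more than `ε` from `x`, where the size bound gives an average over
`dil P`. -/
theorem IsLocalFamily.maximalTruncation_le (hd : 1 ≤ d) (hω : IsDiniModulus ω)
    (hK : IsCZKernel K C ω) (hBω : ENNReal.ofReal (diniConst ω) ≤ B)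
    (hBC : ENNReal.ofReal C ≤ B)
    (hF : IsLocalFamily K f B F) (hf : MemLp f 1 volume) (hO : IsExceptional O)
    (hOF : ∀ Q x, x ∉ O Q → ‖F Q x‖ₑ ≤ 2 * B * (heightConst d * dilAverage f Q) ∧
        x ∉ maximalSet (fun y => ‖(dil Q).indicator f y‖ₑ) (heightConst d * dilAverage f Q))
    (hA : Bornology.IsBounded A) (hfA : ∀ y, y ∉ A → f y = 0) (x : Euc d) :
    maximalTruncation K f x ≤ sparseConst d * (B * sparseOp (dil '' tree O A) f x) := by
  refine iSup₂_le fun ε hε => ?_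
  obtain ⟨Q, hQ, hxQ⟩ := exists_mem_roots hd hA x
  have hQt : Q ∈ tree O A := ⟨0, hQ⟩
  -- Here `2 ^ n ≤ ε < 2 ^ (n + 1)`. If `ε` is at least the side of `Q`, the minimum gives `P = Q`
  -- and the region `dil Q \ dil P` is empty. Otherwise the closed ball of radius `ε < 2 * side P`
  -- lies in `dil P`.
  obtain ⟨n, hn1, hn2⟩ := exists_mem_Ico_zpow hε one_lt_two
  set P : DyadicIndex d := dyadicIndex (min n Q.1) x with hP
  have hxP : x ∈ cube P := mem_cube_dyadicIndex _ x
  have hPQ : cube P ⊆ cube Q := cube_subset_cube (min_le_right n Q.1) hxP hxQ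
  have hside : side P ≤ ε := (zpow_le_zpow_right₀ one_le_two (min_le_left n Q.1)).trans hn1
  have hfar : ∀ y ∈ dil Q \ dil P, ε < ‖x - y‖ := by
    rintro y ⟨hyQ, hyP⟩
    rcases le_or_gt Q.1 n with h | h
    · have hPQ' : P = Q := by
        refine eq_of_mem_of_generation_eq hxP hxQ ?_
        change min n Q.1 = Q.1
        exact min_eq_right h
      exact absurd (hPQ' ▸ hyQ) hyP
    · by_contra hle
      push Not at hle
      refine hyP (closedBall_subset_dil hd hxP (r := ε) ?_ ?_)
      · have : side P = 2 ^ n := by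
          change (2 : ℝ) ^ (min n Q.1) = 2 ^ n
          rw [min_eq_left h.le]
        rw [this, mul_comm, ← zpow_add_one₀ two_ne_zero]
        exact hn2
      · rwa [mem_closedBall, dist_comm, dist_eq_norm]
  set S : Set (Euc d) := {y | ε < ‖x - y‖} with hS
  have hSm : MeasurableSet S := by
    have hm : Measurable fun y : Euc d => ‖x - y‖ := by fun_prop
    exact measurableSet_lt measurable_const hm
  have hfi := memLp_one_iff_integrable.1 hf
  have hAQ := subset_dil_of_mem_roots hQ
  have e1 : ∫ y in S, K x y * f y =
      (∫ y in dil Q \ dil P, K x y * f y) + ∫ y in dil P ∩ S, K x y * f y := by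
    have h1 : (dil Q \ dil P) ∪ (dil P ∩ S) = S ∩ dil Q := by
      ext y
      constructor
      · rintro (h | h)
        · exact ⟨hfar y h, h.1⟩
        · exact ⟨h.2, dil_subset_dil hd hPQ h.1⟩
      · rintro ⟨h, h'⟩
        by_cases hy : y ∈ dil P
        · exact Or.inr ⟨hy, h⟩
        · exact Or.inl ⟨h', hy⟩
    rw [← setIntegral_union (Set.disjoint_left.2 fun y hy hy' => hy.2 hy'.1)
      ((measurableSet_dil P).inter hSm)
      (hK.integrableOn hd hω hε ((measurableSet_dil Q).diff (measurableSet_dil P))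
        (fun y hy => (hfar y hy).le) hfi.integrableOn)
      (hK.integrableOn hd hω hε ((measurableSet_dil P).inter hSm) (fun y hy => le_of_lt hy.2)
        hfi.integrableOn), h1]
    have hzero : ∀ y ∈ S \ (S ∩ dil Q), K x y * f y = 0 := by
      rintro y ⟨hyS, hy⟩
      rw [hfA y fun hyA => hy ⟨hyS, hAQ hyA⟩, mul_zero]
    exact setIntegral_eq_of_subset_of_forall_sdiff_eq_zero (f := fun y => K x y * f y)
      (μ := volume) hSm inter_subset_left hzero
  have h2 : ‖∫ y in dil P ∩ S, K x y * f y‖ₑ ≤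
      ENNReal.ofReal (dilFactor d) ^ d * (B * dilAverage f P) := by
    calc ‖∫ y in dil P ∩ S, K x y * f y‖ₑ ≤ ∫⁻ y in dil P ∩ S, ‖K x y * f y‖ₑ :=
          enorm_integral_le_lintegral_enorm _
      _ ≤ ENNReal.ofReal (C / side P ^ d) * ∫⁻ y in dil P ∩ S, ‖f y‖ₑ :=
          hK.lintegral_le hd (side_pos P) ((measurableSet_dil P).inter hSm)
            (fun y hy => hside.trans (le_of_lt hy.2)) f
      _ ≤ ENNReal.ofReal (C / side P ^ d) * ∫⁻ y in dil P, ‖f y‖ₑ :=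
          mul_le_mul_right (lintegral_mono_set inter_subset_left) _
      _ = ENNReal.ofReal (dilFactor d) ^ d * (ENNReal.ofReal C * dilAverage f P) := by
          have hp := side_pos P
          have h3 : ENNReal.ofReal (C / side P ^ d) * volume (cube P) = ENNReal.ofReal C := by
            rw [volume_cube, ← ENNReal.ofReal_pow hp.le,
              ← ENNReal.ofReal_mul (div_nonneg (hK.const_nonneg hd) (by positivity)),
              div_mul_cancel₀ _ (by positivity)]
          rw [lintegral_dil_eq, volume_dil, ← h3]
          ring
      _ ≤ _ := mul_le_mul_right (mul_le_mul_left hBC _) _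
  have h3 := hF.chain hd hω hK hBω hf hO hOF hQt hPQ hxP
  have h4 := h3.trans (mul_le_mul_right (mul_le_mul_right (chainSum_le_sparseOp hd hxP) _) _)
  rw [e1]
  calc ‖(∫ y in dil Q \ dil P, K x y * f y) + ∫ y in dil P ∩ S, K x y * f y‖ₑ
      ≤ 1 * ‖∫ y in dil Q \ dil P, K x y * f y‖ₑ +
          ENNReal.ofReal (dilFactor d) ^ d * (B * dilAverage f P) := by
        rw [one_mul]
        exact (enorm_add_le _ _).trans (add_le_add_right h2 _)
    _ ≤ 1 * (chainConst d * (B * sparseOp (dil '' tree O A) f x)) +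
          ENNReal.ofReal (dilFactor d) ^ d *
            (chainConst d * (B * sparseOp (dil '' tree O A) f x)) :=
        add_le_add (mul_le_mul_right (le_add_self.trans h4) _)
          (mul_le_mul_right (le_self_add.trans h4) _)
    _ = (1 + ENNReal.ofReal (dilFactor d) ^ d) * chainConst d *
          (B * sparseOp (dil '' tree O A) f x) := by ring
    _ ≤ _ := mul_le_mul_left (mul_le_mul_left le_self_add _) _

/-- Simultaneous sparse domination of `T` and of its maximal truncations. -/
theorem exists_sparse_domination (hd : 1 ≤ d) (hω : IsDiniModulus ω) (hK : IsCZKernel K C ω)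
    (hT : HasKernel T K)
    {T₁ : Lp 𝕜 1 (volume : Measure (Euc d)) →ₗ[𝕜] (Euc d →ₘ[volume] 𝕜)}
    (hT₁ : IsWeakTypeExtension T T₁) (hB : HasWeakBound T B)
    (hBω : ENNReal.ofReal (diniConst ω) ≤ B) (hBC : ENNReal.ofReal C ≤ B)
    (hf : MemLp f 1 volume) (hfc : HasCompactSupport f) :
    ∃ S : Set (Set (Euc d)), (∀ Q ∈ S, IsCube Q) ∧
      IsSparse (1 / (2 * (4 * Real.sqrt d + 2) ^ d)) S ∧
      (∀ᵐ x ∂volume, ‖T₁ (hf.toLp f) x‖ₑ ≤ sparseConst d * (B * sparseOp S f x)) ∧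
      ∀ x, maximalTruncation K f x ≤ sparseConst d * (B * sparseOp S f x) := by
  have hF := hT₁.isLocalFamily hd hω hK hT hB hf
  obtain ⟨O, hO, hOF⟩ := hF.exists_isExceptional hd hf
  have hA : Bornology.IsBounded (tsupport f) := hfc.isCompact.isBounded
  have hfA : ∀ y, y ∉ tsupport f → f y = 0 := fun y hy => image_eq_zero_of_notMem_tsupport hy
  refine ⟨dil '' tree O (tsupport f), ?_, hO.isSparse_image_dil hd, ?_, fun x =>
    hF.maximalTruncation_le hd hω hK hBω hBC hf hO hOF hA hfA x⟩
  · rintro _ ⟨Q, -, rfl⟩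
    exact isCube_dil Q
  · filter_upwards [hF.ae_le_sparseOp (A := tsupport f) hd hω hK hBω hf hO hOF] with x hx
    obtain ⟨Q, hQ, hxQ⟩ := exists_mem_roots hd hA x
    have h1 := hx Q hQ hxQ
    -- The dilate of a root contains the support, so `F Q` is `T₁ f` itself.
    have h2 : (dil Q).indicator f = f := indicator_eq_self.2
      ((subset_tsupport f).trans (subset_dil_of_mem_roots hQ))
    simpa only [h2] using h1

end

end SparseCZ

/-! ### The main theorem -/

theorem mainTheorem11 (d : ℕ) (hd : 1 ≤ d) :
    ∃ c : ℝ, 0 < c ∧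
      ∀ (𝕜 : Type*) [RCLike 𝕜]
        (T : Lp 𝕜 2 (volume : Measure (EuclideanSpace ℝ (Fin d))) →L[𝕜]
          Lp 𝕜 2 (volume : Measure (EuclideanSpace ℝ (Fin d))))
        (K : EuclideanSpace ℝ (Fin d) → EuclideanSpace ℝ (Fin d) → 𝕜)
        (C : ℝ) (ω : ℝ → ℝ),
        SparseCZ.IsDiniModulus ω → SparseCZ.IsCZKernel K C ω → SparseCZ.HasKernel T K →
        (∃! T₁ : Lp 𝕜 1 (volume : Measure (EuclideanSpace ℝ (Fin d))) →ₗ[𝕜]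
            (EuclideanSpace ℝ (Fin d) →ₘ[volume] 𝕜), SparseCZ.IsWeakTypeExtension T T₁) ∧
        (∀ T₁ : Lp 𝕜 1 (volume : Measure (EuclideanSpace ℝ (Fin d))) →ₗ[𝕜]
            (EuclideanSpace ℝ (Fin d) →ₘ[volume] 𝕜), SparseCZ.IsWeakTypeExtension T T₁ →
          ∀ (f : EuclideanSpace ℝ (Fin d) → 𝕜) (hf : MemLp f 1 volume), HasCompactSupport f →
            ∃ S : Set (Set (EuclideanSpace ℝ (Fin d))),
              (∀ Q ∈ S, SparseCZ.IsCube Q) ∧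
              SparseCZ.IsSparse (1 / (2 * (4 * Real.sqrt d + 2) ^ d)) S ∧
              ∀ᵐ x ∂volume, ‖T₁ (hf.toLp f) x‖ₑ ≤
                ENNReal.ofReal (c * (C + SparseCZ.diniConst ω + ‖T‖)) *
                  SparseCZ.sparseOp S f x) ∧
        (∀ f : EuclideanSpace ℝ (Fin d) → 𝕜, MemLp f 1 volume → HasCompactSupport f →
            ∃ S : Set (Set (EuclideanSpace ℝ (Fin d))),
              (∀ Q ∈ S, SparseCZ.IsCube Q) ∧
              SparseCZ.IsSparse (1 / (2 * (4 * Real.sqrt d + 2) ^ d)) S ∧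
              ∀ᵐ x ∂volume, SparseCZ.maximalTruncation K f x ≤
                ENNReal.ofReal (c * (C + SparseCZ.diniConst ω + ‖T‖)) *
                  SparseCZ.sparseOp S f x) := by
  -- Adding 1 gives positivity of the constant without a lower bound on `sparseConst d`.
  refine ⟨(SparseCZ.sparseConst d).toReal + 1, by positivity, ?_⟩
  intro 𝕜 _ T K C ω hω hK hT
  have hC := hK.const_nonneg hd
  have hD := hω.diniConst_nonneg
  have hTn := norm_nonneg T
  set M : ℝ := C + SparseCZ.diniConst ω + ‖T‖ with hM
  have hMω : ENNReal.ofReal (SparseCZ.diniConst ω) ≤ ENNReal.ofReal M :=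
    ENNReal.ofReal_le_ofReal (by linarith)
  have hMC : ENNReal.ofReal C ≤ ENNReal.ofReal M := ENNReal.ofReal_le_ofReal (by linarith)
  have hMT : ‖T‖ₑ ≤ ENNReal.ofReal M := by
    rw [← ofReal_norm]
    exact ENNReal.ofReal_le_ofReal (by linarith)
  have hweak : ∀ B : ℝ≥0∞, B ≠ ∞ → ENNReal.ofReal M ≤ B → SparseCZ.HasWeakBound T B := by
    intro B hB hMB g hgb hg1 hg2 s hs hs'
    rw [eLpNorm_one_eq_lintegral_enorm]
    exact SparseCZ.weakType_of_bounded hd hω hK hT hB (hMω.trans hMB) (hMT.trans hMB) hgb hg1 hg2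
      hs hs'
  -- The quantity `M` may be zero, while the extension argument divides by `B`. Hence `M + 1` here;
  -- the weak bound with `B = M` itself is still available for the sparse estimates.
  have hex : ∃! T₁ : Lp 𝕜 1 (volume : Measure (EuclideanSpace ℝ (Fin d))) →ₗ[𝕜]
      (EuclideanSpace ℝ (Fin d) →ₘ[volume] 𝕜), SparseCZ.IsWeakTypeExtension T T₁ :=
    SparseCZ.existsUnique_isWeakTypeExtension
      (hweak (ENNReal.ofReal M + 1) (by finiteness) le_self_add) (by simp) (by finiteness)
  have hconst : ∀ a : ℝ≥0∞, SparseCZ.sparseConst d * (ENNReal.ofReal M * a) ≤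
      ENNReal.ofReal (((SparseCZ.sparseConst d).toReal + 1) * M) * a := by
    intro a
    rw [ENNReal.ofReal_mul (by positivity), ← mul_assoc]
    refine mul_le_mul_left (mul_le_mul_left ?_ _) _
    rw [ENNReal.le_ofReal_iff_toReal_le SparseCZ.sparseConst_ne_top (by positivity)]
    linarith
  have hW := hweak (ENNReal.ofReal M) ENNReal.ofReal_ne_top le_rfl
  refine ⟨hex, fun T₁ hT₁ f hf hfc => ?_, fun f hf hfc => ?_⟩
  · obtain ⟨S, hS1, hS2, hS3, -⟩ :=
      SparseCZ.exists_sparse_domination hd hω hK hT hT₁ hW hMω hMC hf hfc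
    exact ⟨S, hS1, hS2, hS3.mono fun x hx => hx.trans (hconst _)⟩
  · obtain ⟨T₁, hT₁, -⟩ := hex
    obtain ⟨S, hS1, hS2, -, hS4⟩ :=
      SparseCZ.exists_sparse_domination hd hω hK hT hT₁ hW hMω hMC hf hfc
    exact ⟨S, hS1, hS2, Filter.Eventually.of_forall fun x => (hS4 x).trans (hconst _)⟩
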